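/- **Setting.** Let $M=(M_p)_{p\ge 0}$ be a sequence of positive numbers with $M_0=1$ such that - (H1) $M_p^2\le M_{p-1}M_{p+1}$ for all $p\ge 1$; - (H2) there are $A,H>0$ with $M_p\le A H^p M_q M_{p-q}$ for all $p\ge q\ge 0$; - (H3)$'$ $\sum_{p\ge1} M_{p-1}/M_p<\infty$. Put $\widetilde M(t)=\sup_p \ln (t^p/M_p)$ for $t>0$, and $\widetilde M(0)=0$. Let $\Omega\subseteq\mathbb R^n$ be open and let $\mathcal F$ be the Fourier transform. **Colombeau algebra.** $\mathcal X(\Omega)$ is the algebra of nets $(u_\varepsilon)_{0<\varepsilon\le1}$ of complex-valued $C^\infty$ functions on $\Omega$ such that for every compact $K\subset\Omega$ and every multi-index $\alpha$ there are $m\in\mathbb Z_+$, $C>0$, $\eta\in\,]0,1]$ with $\sup_K|\partial^\alpha u_\varepsilon|\le C\varepsilon^{-m}$ for $\varepsilon\le\eta$. $\mathcal N(\Omega)$ is the ideal of those $(u_\varepsilon)_\varepsilon\in\mathcal X(\Omega)$ such that for all $K,\alpha$ and all $m\in\mathbb Z_+$ there are $C>0,\eta\in\,]0,1]$ with $\sup_K|\partial^\alpha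 u_\varepsilon|\le C\varepsilon^{m}$ for $\varepsilon\le\eta$. $\mathcal G(\Omega)=\mathcal X(\Omega)/\mathcal N(\Omega)$, with componentwise product, derivatives and restriction to open subsets. $\mathcal G_C(\Omega)$ is the set of $f\in\mathcal G(\Omega)$ having a representative whose members are all supported in one compact subset of $\Omega$; such a representative is called compactly supported. **Ultraregularity.** $\mathcal A$ is the set of sequences $(N_m)_{m\ge 0}$ of nonnegative reals with $N_m\le am+b$ for all $m$, for some $a,b\ge0$. $\mathcal G^{M,\mathcal A}(\Omega)\subseteq\mathcal G(\Omega)$ is the set of classes having a representative $(u_\varepsilon)_\varepsilon$ such that for every compact $K\subset\Omega$ there are $N\in\mathcal A$, $C>0$, $\varepsilon_0\in\,]0,1]$ with $$\sup_{x\in K}|\partial^\alpha u_\varepsilon(x)|\le C^{|\alpha|+1}M_{|\alpha|}\,\varepsilon^{-N_{|\alpha|}}\quad\text{for all }\alpha\text{ and all }\varepsilon\le\varepsilon_0.$$ $\mathrm{singsupp}_{M,\mathcal A}(f)$ is the complement in $\Omega$ of the union of all open $\Omega'\subseteq\Omega$ with $f|_{\Omega'}\in\mathcal G^{M,\mathcal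 A}(\Omega')$. $\mathcal D^M(\Omega)$ is the set of $\phi\in C^\infty(\Omega)$ with compact support in $\Omega$ such that for every compact $K\subset\Omega$ there is $c>0$ with $\sup_K|\partial^\alpha\phi|\le c^{|\alpha|+1}M_{|\alpha|}$ for all $\alpha$. **Wave front set.** A net $(w_\varepsilon)_\varepsilon$ of compactly supported smooth functions is said to *decay* in a set $\Gamma\subseteq\mathbb R^n$ if there are $a,b\ge0$, $C,k>0$, $\varepsilon_0\in\,]0,1]$ with $$|\mathcal F(w_\varepsilon)(\xi)|\le C\varepsilon^{-b}\exp\bigl(-\widetilde M(k\varepsilon^a|\xi|)\bigr)\quad\text{for all }\varepsilon\le\varepsilon_0,\ \xi\in\Gamma .$$ A conic neighborhood of $\xi_0$ is an open set containing $\xi_0$ and invariant under multiplication by positive numbers. - For $f\in\mathcal G_C(\Omega)$, $\Sigma^M_{\mathcal A}(f)$ is the complement in $\mathbb R^n\setminus\{0\}$ of the set of $\xi_0$ that have a conic neighborhood in which some compactly supported representative of $f$ decays. - For $f\in\mathcal G(\Omega)$, $WF^M_{\mathcal A}(f)$ is the complement in $\Omega\times(\mathbb R^n\setminus\{0\})$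 of the set of $(x_0,\xi_0)$ for which there are $\phi\in\mathcal D^M(\Omega)$ with $\phi=1$ on a neighborhood of $x_0$, a conic neighborhood $\Gamma$ of $\xi_0$ and a representative $(f_\varepsilon)_\varepsilon$ of $f$ such that $(\phi f_\varepsilon)_\varepsilon$ decays in $\Gamma$. **Proposition.** Let $f\in\mathcal G(\Omega)$. Then 1. the projection of $WF^M_{\mathcal A}(f)$ on $\Omega$ is $\mathrm{singsupp}_{M,\mathcal A}(f)$; 2. if $f\in\mathcal G_C(\Omega)$, the projection of $WF^M_{\mathcal A}(f)$ on $\mathbb R^n\setminus\{0\}$ is $\Sigma^M_{\mathcal A}(f)$; 3. $WF^M_{\mathcal A}(\partial^\alpha f)\subseteq WF^M_{\mathcal A}(f)$ for every $\alpha\in\mathbb Z_+^n$; 4. $WF^M_{\mathcal A}(gf)\subseteq WF^M_{\mathcal A}(f)$ for every $g\in\mathcal G^{M,\mathcal A}(\Omega)$. -/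

import Mathlib

/-!
Colombeau generalized functions on an open set of `ℝⁿ`, ultraregularity of Denjoy–Carleman
class `M`, the `(M, R)`-singular support and the affine wave front set of class `M`.
-/

namespace UltraReg

open scoped ContDiff Topology FourierTransform

noncomputable section

/-- `ℝⁿ` with the Euclidean norm. -/
abbrev Rn (n : ℕ) : Type := EuclideanSpace ℝ (Fin n)

/-- Nets of functions indexed by `]0, 1]`. Nets of functions on an open set `Ω` are represented by
nets of functions on `ℝⁿ`, whose values outside `Ω` play no role. -/
abbrev Net (n : ℕ) : Type := Set.Ioc (0 : ℝ) 1 → Rn n → ℂ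

/-! ### Partial derivatives -/

/-- The partial derivative `∂ᵢ h`. -/
def pderiv {n : ℕ} (i : Fin n) (h : Rn n → ℂ) : Rn n → ℂ :=
  fun x => fderiv ℝ h x (EuclideanSpace.single i 1)

/-- Successive partial derivatives in the directions of a list. -/
def iterD {n : ℕ} : List (Fin n) → (Rn n → ℂ) → (Rn n → ℂ)
  | [], h => h
  | i :: l, h => iterD l (pderiv i h)

/-- The list `0, …, 0, 1, …, 1, …` in which `i` occurs `α i` times. -/
def dirs {n : ℕ} (α : Fin n → ℕ) : List (Fin n) :=
  (List.finRange n).flatMap fun i => List.replicate (α i) i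

/-- The partial derivative `∂^α h` for a multi-index `α`. -/
def mderiv {n : ℕ} (α : Fin n → ℕ) (h : Rn n → ℂ) : Rn n → ℂ := iterD (dirs α) h

/-- The length `|α|` of a multi-index. -/
def mlen {n : ℕ} (α : Fin n → ℕ) : ℕ := ∑ i, α i

/-! ### Moderate and null nets -/

/-- Moderate nets on `Ω`. -/
def IsModerate {n : ℕ} (Ω : TopologicalSpace.Opens (Rn n)) (u : Net n) : Prop :=
  (∀ ε, ContDiffOn ℝ ∞ (u ε) Ω) ∧
  ∀ K : Set (Rn n), IsCompact K → K ⊆ Ω → ∀ α : Fin n → ℕ,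
    ∃ m : ℕ, ∃ C : ℝ, 0 < C ∧ ∃ η : Set.Ioc (0 : ℝ) 1, ∀ ε ≤ η, ∀ x ∈ K,
      ‖mderiv α (u ε) x‖ ≤ C * (ε : ℝ) ^ (-(m : ℤ))

/-- The estimates of null nets on `Ω`. -/
def IsNegligible {n : ℕ} (Ω : TopologicalSpace.Opens (Rn n)) (u : Net n) : Prop :=
  ∀ K : Set (Rn n), IsCompact K → K ⊆ Ω → ∀ α : Fin n → ℕ, ∀ m : ℕ,
    ∃ C : ℝ, 0 < C ∧ ∃ η : Set.Ioc (0 : ℝ) 1, ∀ ε ≤ η, ∀ x ∈ K,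
      ‖mderiv α (u ε) x‖ ≤ C * (ε : ℝ) ^ m

/-! ### Helper facts: the moderate nets form a differential algebra, the null nets an ideal -/

theorem pderiv_congr {n : ℕ} {Ω : TopologicalSpace.Opens (Rn n)} {f g : Rn n → ℂ}
    (h : Set.EqOn f g Ω) (i : Fin n) : Set.EqOn (pderiv i f) (pderiv i g) Ω := by
  intro x hx
  have : f =ᶠ[𝓝 x] g := Filter.eventuallyEq_of_mem (Ω.isOpen.mem_nhds hx) h
  simp only [pderiv, this.fderiv_eq]

theorem iterD_congr {n : ℕ} {Ω : TopologicalSpace.Opens (Rn n)} (l : List (Fin n)) :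
    ∀ {f g : Rn n → ℂ}, Set.EqOn f g Ω → Set.EqOn (iterD l f) (iterD l g) Ω := by
  induction l with
  | nil => intro f g h; exact h
  | cons i l ih => intro f g h; exact ih (pderiv_congr h i)

theorem contDiffOn_pderiv {n : ℕ} {Ω : TopologicalSpace.Opens (Rn n)} {f : Rn n → ℂ}
    (hf : ContDiffOn ℝ ∞ f Ω) (i : Fin n) : ContDiffOn ℝ ∞ (pderiv i f) Ω := by
  have h := hf.fderiv_of_isOpen (m := ∞) Ω.isOpen (by simp)
  exact h.clm_apply contDiffOn_const

theorem contDiffOn_iterD {n : ℕ} {Ω : TopologicalSpace.Opens (Rn n)} (l : List (Fin n)) :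
    ∀ {f : Rn n → ℂ}, ContDiffOn ℝ ∞ f Ω → ContDiffOn ℝ ∞ (iterD l f) Ω := by
  induction l with
  | nil => intro f h; exact h
  | cons i l ih => intro f h; exact ih (contDiffOn_pderiv h i)

theorem iterD_append {n : ℕ} (l l' : List (Fin n)) :
    ∀ f : Rn n → ℂ, iterD (l ++ l') f = iterD l' (iterD l f) := by
  induction l with
  | nil => intro f; rfl
  | cons i l ih => intro f; exact ih _

theorem diffAt {n : ℕ} {Ω : TopologicalSpace.Opens (Rn n)} {f : Rn n → ℂ}
    (hf : ContDiffOn ℝ ∞ f Ω) {x : Rn n} (hx : x ∈ Ω) : DifferentiableAt ℝ f x :=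
  (hf.contDiffAt (Ω.isOpen.mem_nhds hx)).differentiableAt (by simp)

theorem pderiv_comm {n : ℕ} {Ω : TopologicalSpace.Opens (Rn n)} {f : Rn n → ℂ}
    (hf : ContDiffOn ℝ ∞ f Ω) (i j : Fin n) :
    Set.EqOn (pderiv i (pderiv j f)) (pderiv j (pderiv i f)) Ω := by
  intro x hx
  have hc : ContDiffAt ℝ ∞ f x := hf.contDiffAt (Ω.isOpen.mem_nhds hx)
  have hs : IsSymmSndFDerivAt ℝ f x :=
    hc.isSymmSndFDerivAt (by
      rw [minSmoothness_of_isRCLikeNormedField]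
      exact WithTop.coe_le_coe.2 (le_top : (2 : ℕ∞) ≤ ⊤))
  have hd : DifferentiableAt ℝ (fderiv ℝ f) x :=
    (hc.fderiv_right (m := ∞) (by simp)).differentiableAt (by simp)
  have key : ∀ v w : Rn n, fderiv ℝ (fun y => fderiv ℝ f y v) x w = fderiv ℝ (fderiv ℝ f) x w v := by
    intro v w
    rw [fderiv_clm_apply hd (differentiableAt_const v)]
    simp
  change fderiv ℝ (fun y => fderiv ℝ f y _) x _ = fderiv ℝ (fun y => fderiv ℝ f y _) x _
  rw [key, key]
  exact hs.eq _ _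

theorem iterD_perm {n : ℕ} {Ω : TopologicalSpace.Opens (Rn n)} {l l' : List (Fin n)}
    (h : l.Perm l') : ∀ {f : Rn n → ℂ}, ContDiffOn ℝ ∞ f Ω →
      Set.EqOn (iterD l f) (iterD l' f) Ω := by
  induction h with
  | nil => intro f _; exact fun _ _ => rfl
  | cons i _ ih => intro f hf; exact ih (contDiffOn_pderiv hf i)
  | swap i j l => intro f hf; exact iterD_congr l (pderiv_comm hf i j)
  | trans _ _ ih₁ ih₂ => intro f hf; exact (ih₁ hf).trans (ih₂ hf)

theorem count_dirs {n : ℕ} (α : Fin n → ℕ) (i : Fin n) : (dirs α).count i = α i := by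
  unfold dirs
  rw [List.count_flatMap]
  have : (List.count i ∘ fun j : Fin n => List.replicate (α j) j)
      = fun j => if j = i then α j else 0 := by
    funext j
    simp [List.count_replicate]
  rw [this, ← List.ofFn_eq_map, List.sum_ofFn]
  simp

theorem perm_dirs {n : ℕ} (l : List (Fin n)) : l.Perm (dirs fun i => l.count i) := by
  rw [List.perm_iff_count]
  intro i
  rw [count_dirs]

theorem iterD_add {n : ℕ} {Ω : TopologicalSpace.Opens (Rn n)} (l : List (Fin n)) :
    ∀ {f g : Rn n → ℂ}, ContDiffOn ℝ ∞ f Ω → ContDiffOn ℝ ∞ g Ω →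
      Set.EqOn (iterD l (f + g)) (iterD l f + iterD l g) Ω := by
  induction l with
  | nil => intro f g _ _; exact fun _ _ => rfl
  | cons i l ih =>
    intro f g hf hg
    refine (iterD_congr l (g := pderiv i f + pderiv i g) ?_).trans
      (ih (contDiffOn_pderiv hf i) (contDiffOn_pderiv hg i))
    intro x hx
    simp [pderiv, fderiv_add (diffAt hf hx) (diffAt hg hx)]

theorem pderiv_mul {n : ℕ} {Ω : TopologicalSpace.Opens (Rn n)} {f g : Rn n → ℂ}
    (hf : ContDiffOn ℝ ∞ f Ω) (hg : ContDiffOn ℝ ∞ g Ω) (i : Fin n) :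
    Set.EqOn (pderiv i (f * g)) (pderiv i f * g + f * pderiv i g) Ω := by
  intro x hx
  simp only [pderiv, fderiv_mul (diffAt hf hx) (diffAt hg hx), Pi.add_apply, Pi.mul_apply]
  simp
  ring

/-- Leibniz rule, in the form needed for moderate and null nets. -/
theorem leibniz {n : ℕ} {Ω : TopologicalSpace.Opens (Rn n)} {A B D : Net n → Prop}
    (hmul : ∀ a b, A a → B b → D (a * b)) (hadd : ∀ a b, D a → D b → D (a + b))
    (hcongr : ∀ a b, (∀ ε, Set.EqOn (a ε) (b ε) Ω) → D b → D a) (l : List (Fin n)) :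
    ∀ {u v : Net n}, (∀ ε, ContDiffOn ℝ ∞ (u ε) Ω) → (∀ ε, ContDiffOn ℝ ∞ (v ε) Ω) →
      (∀ l', A fun ε => iterD l' (u ε)) → (∀ l', B fun ε => iterD l' (v ε)) →
      D fun ε => iterD l (u ε * v ε) := by
  induction l with
  | nil => intro u v _ _ hA hB; exact hmul u v (hA []) (hB [])
  | cons i l ih =>
    intro u v hu hv hA hB
    have hu' := fun ε => contDiffOn_pderiv (hu ε) i
    have hv' := fun ε => contDiffOn_pderiv (hv ε) i
    refine hcongr _ _ ?_ (hadd _ _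
      (ih (u := fun ε => pderiv i (u ε)) hu' hv (fun l' => hA (i :: l')) hB)
      (ih (v := fun ε => pderiv i (v ε)) hu hv' hA (fun l' => hB (i :: l'))))
    intro ε
    exact (iterD_congr l (pderiv_mul (hu ε) (hv ε) i)).trans
      (iterD_add l ((hu' ε).mul (hv ε)) ((hu ε).mul (hv' ε)))

/-- Moderate growth on a set. -/
def ModOn {n : ℕ} (K : Set (Rn n)) (w : Net n) : Prop :=
  ∃ m : ℕ, ∃ C : ℝ, 0 < C ∧ ∃ η : Set.Ioc (0 : ℝ) 1, ∀ ε ≤ η, ∀ x ∈ K,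
    ‖w ε x‖ ≤ C * (ε : ℝ) ^ (-(m : ℤ))

/-- Rapid decay on a set. -/
def NegOn {n : ℕ} (K : Set (Rn n)) (w : Net n) : Prop :=
  ∀ m : ℕ, ∃ C : ℝ, 0 < C ∧ ∃ η : Set.Ioc (0 : ℝ) 1, ∀ ε ≤ η, ∀ x ∈ K,
    ‖w ε x‖ ≤ C * (ε : ℝ) ^ m

theorem ModOn.congr {n : ℕ} {K : Set (Rn n)} {a b : Net n}
    (h : ∀ ε, Set.EqOn (a ε) (b ε) K) (hb : ModOn K b) : ModOn K a := by
  obtain ⟨m, C, hC, η, H⟩ := hb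
  exact ⟨m, C, hC, η, fun ε hε x hx => by rw [h ε hx]; exact H ε hε x hx⟩

theorem NegOn.congr {n : ℕ} {K : Set (Rn n)} {a b : Net n}
    (h : ∀ ε, Set.EqOn (a ε) (b ε) K) (hb : NegOn K b) : NegOn K a := by
  intro m
  obtain ⟨C, hC, η, H⟩ := hb m
  exact ⟨C, hC, η, fun ε hε x hx => by rw [h ε hx]; exact H ε hε x hx⟩

theorem ModOn.add {n : ℕ} {K : Set (Rn n)} {a b : Net n}
    (ha : ModOn K a) (hb : ModOn K b) : ModOn K (a + b) := by
  obtain ⟨m, C, hC, η, H⟩ := ha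
  obtain ⟨m', C', hC', η', H'⟩ := hb
  refine ⟨max m m', C + C', add_pos hC hC', min η η', fun ε hε x hx => ?_⟩
  have h1 := H ε (hε.trans (min_le_left _ _)) x hx
  have h2 := H' ε (hε.trans (min_le_right _ _)) x hx
  have e1 : (ε : ℝ) ^ (-(m : ℤ)) ≤ (ε : ℝ) ^ (-((max m m' : ℕ) : ℤ)) :=
    zpow_le_zpow_right_of_le_one₀ ε.2.1 ε.2.2 (by push_cast; omega)
  have e2 : (ε : ℝ) ^ (-(m' : ℤ)) ≤ (ε : ℝ) ^ (-((max m m' : ℕ) : ℤ)) :=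
    zpow_le_zpow_right_of_le_one₀ ε.2.1 ε.2.2 (by push_cast; omega)
  calc ‖(a + b) ε x‖ ≤ ‖a ε x‖ + ‖b ε x‖ := norm_add_le _ _
    _ ≤ C * (ε : ℝ) ^ (-((max m m' : ℕ) : ℤ)) + C' * (ε : ℝ) ^ (-((max m m' : ℕ) : ℤ)) := by
        gcongr
        · exact h1.trans (by gcongr)
        · exact h2.trans (by gcongr)
    _ = _ := by ring

theorem ModOn.mul {n : ℕ} {K : Set (Rn n)} {a b : Net n}
    (ha : ModOn K a) (hb : ModOn K b) : ModOn K (a * b) := by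
  obtain ⟨m, C, hC, η, H⟩ := ha
  obtain ⟨m', C', hC', η', H'⟩ := hb
  refine ⟨m + m', C * C', mul_pos hC hC', min η η', fun ε hε x hx => ?_⟩
  have h1 := H ε (hε.trans (min_le_left _ _)) x hx
  have h2 := H' ε (hε.trans (min_le_right _ _)) x hx
  have h0 : (0 : ℝ) < ε := ε.2.1
  have e : (ε : ℝ) ^ (-((m + m' : ℕ) : ℤ)) = (ε : ℝ) ^ (-(m : ℤ)) * (ε : ℝ) ^ (-(m' : ℤ)) := by
    rw [← zpow_add₀ h0.ne']; push_cast; ring_nf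
  calc ‖(a * b) ε x‖ = ‖a ε x‖ * ‖b ε x‖ := norm_mul _ _
    _ ≤ (C * (ε : ℝ) ^ (-(m : ℤ))) * (C' * (ε : ℝ) ^ (-(m' : ℤ))) := by gcongr
    _ = _ := by rw [e]; ring

theorem NegOn.add {n : ℕ} {K : Set (Rn n)} {a b : Net n}
    (ha : NegOn K a) (hb : NegOn K b) : NegOn K (a + b) := by
  intro m
  obtain ⟨C, hC, η, H⟩ := ha m
  obtain ⟨C', hC', η', H'⟩ := hb m
  refine ⟨C + C', add_pos hC hC', min η η', fun ε hε x hx => ?_⟩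
  have h1 := H ε (hε.trans (min_le_left _ _)) x hx
  have h2 := H' ε (hε.trans (min_le_right _ _)) x hx
  calc ‖(a + b) ε x‖ ≤ ‖a ε x‖ + ‖b ε x‖ := norm_add_le _ _
    _ ≤ C * (ε : ℝ) ^ m + C' * (ε : ℝ) ^ m := add_le_add h1 h2
    _ = _ := by ring

theorem ModOn.mul_negOn {n : ℕ} {K : Set (Rn n)} {a b : Net n}
    (ha : ModOn K a) (hb : NegOn K b) : NegOn K (a * b) := by
  intro q
  obtain ⟨m, C, hC, η, H⟩ := ha
  obtain ⟨C', hC', η', H'⟩ := hb (q + m)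
  refine ⟨C * C', mul_pos hC hC', min η η', fun ε hε x hx => ?_⟩
  have h1 := H ε (hε.trans (min_le_left _ _)) x hx
  have h2 := H' ε (hε.trans (min_le_right _ _)) x hx
  have h0 : (0 : ℝ) < ε := ε.2.1
  calc ‖(a * b) ε x‖ = ‖a ε x‖ * ‖b ε x‖ := norm_mul _ _
    _ ≤ (C * (ε : ℝ) ^ (-(m : ℤ))) * (C' * (ε : ℝ) ^ (q + m)) := by gcongr
    _ = _ := by
      rw [zpow_neg, zpow_natCast, pow_add]
      field_simp

theorem isModerate_iff {n : ℕ} {Ω : TopologicalSpace.Opens (Rn n)} {u : Net n} :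
    IsModerate Ω u ↔ (∀ ε, ContDiffOn ℝ ∞ (u ε) Ω) ∧
      ∀ K : Set (Rn n), IsCompact K → K ⊆ Ω → ∀ l, ModOn K fun ε => iterD l (u ε) := by
  refine and_congr_right fun hs => forall_congr' fun K => forall_congr' fun _ =>
    forall_congr' fun hK => ⟨fun h l => ?_, fun h α => h (dirs α)⟩
  exact ModOn.congr (fun ε => (iterD_perm (perm_dirs l) (hs ε)).mono hK) (h fun i => l.count i)

theorem isNegligible_iff {n : ℕ} {Ω : TopologicalSpace.Opens (Rn n)} {u : Net n}
    (hs : ∀ ε, ContDiffOn ℝ ∞ (u ε) Ω) :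
    IsNegligible Ω u ↔
      ∀ K : Set (Rn n), IsCompact K → K ⊆ Ω → ∀ l, NegOn K fun ε => iterD l (u ε) := by
  refine forall_congr' fun K => forall_congr' fun _ =>
    forall_congr' fun hK => ⟨fun h l => ?_, fun h α => h (dirs α)⟩
  exact NegOn.congr (fun ε => (iterD_perm (perm_dirs l) (hs ε)).mono hK) (h fun i => l.count i)

theorem IsModerate.add {n : ℕ} {Ω : TopologicalSpace.Opens (Rn n)} {u v : Net n}
    (hu : IsModerate Ω u) (hv : IsModerate Ω v) : IsModerate Ω (u + v) := by
  rw [isModerate_iff] at *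
  refine ⟨fun ε => (hu.1 ε).add (hv.1 ε), fun K hc hK l => ?_⟩
  exact ModOn.congr (fun ε => (iterD_add l (hu.1 ε) (hv.1 ε)).mono hK)
    ((hu.2 K hc hK l).add (hv.2 K hc hK l))

theorem IsModerate.mul {n : ℕ} {Ω : TopologicalSpace.Opens (Rn n)} {u v : Net n}
    (hu : IsModerate Ω u) (hv : IsModerate Ω v) : IsModerate Ω (u * v) := by
  rw [isModerate_iff] at *
  refine ⟨fun ε => (hu.1 ε).mul (hv.1 ε), fun K hc hK l => ?_⟩
  exact leibniz (Ω := Ω) (A := ModOn K) (B := ModOn K) (D := ModOn K)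
    (fun _ _ => ModOn.mul) (fun _ _ => ModOn.add)
    (fun a b h => ModOn.congr fun ε => (h ε).mono hK) l hu.1 hv.1
    (hu.2 K hc hK) (hv.2 K hc hK)

theorem IsModerate.mul_negligible {n : ℕ} {Ω : TopologicalSpace.Opens (Rn n)} {u v : Net n}
    (hu : IsModerate Ω u) (hs : ∀ ε, ContDiffOn ℝ ∞ (v ε) Ω) (hv : IsNegligible Ω v) :
    IsNegligible Ω (u * v) := by
  rw [isModerate_iff] at hu
  rw [isNegligible_iff hs] at hv
  rw [isNegligible_iff (u := u * v) fun ε => (hu.1 ε).mul (hs ε)]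
  intro K hc hK l
  exact leibniz (Ω := Ω) (A := ModOn K) (B := NegOn K) (D := NegOn K)
    (fun _ _ => ModOn.mul_negOn) (fun _ _ => NegOn.add)
    (fun a b h => NegOn.congr fun ε => (h ε).mono hK) l hu.1 hs
    (hu.2 K hc hK) (hv K hc hK)

theorem IsNegligible.add {n : ℕ} {Ω : TopologicalSpace.Opens (Rn n)} {u v : Net n}
    (hsu : ∀ ε, ContDiffOn ℝ ∞ (u ε) Ω) (hsv : ∀ ε, ContDiffOn ℝ ∞ (v ε) Ω)
    (hu : IsNegligible Ω u) (hv : IsNegligible Ω v) : IsNegligible Ω (u + v) := by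
  rw [isNegligible_iff hsu] at hu
  rw [isNegligible_iff hsv] at hv
  rw [isNegligible_iff (u := u + v) fun ε => (hsu ε).add (hsv ε)]
  intro K hc hK l
  exact NegOn.congr (fun ε => (iterD_add l (hsu ε) (hsv ε)).mono hK)
    ((hu K hc hK l).add (hv K hc hK l))

theorem iterD_const {n : ℕ} (l : List (Fin n)) :
    ∀ c : ℂ, ∃ c' : ℂ, iterD l (fun _ : Rn n => c) = fun _ => c' := by
  induction l with
  | nil => intro c; exact ⟨c, rfl⟩
  | cons i l ih =>
    intro c
    have : pderiv i (fun _ : Rn n => c) = fun _ => 0 := by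
      funext x
      simp [pderiv]
    simp only [iterD, this]
    exact ih 0

theorem isModerate_const {n : ℕ} (Ω : TopologicalSpace.Opens (Rn n)) (c : ℂ) :
    IsModerate Ω (fun _ _ => c) := by
  rw [isModerate_iff]
  refine ⟨fun _ => contDiffOn_const, fun K _ _ l => ?_⟩
  obtain ⟨c', hc'⟩ := iterD_const (n := n) l c
  refine ⟨0, ‖c'‖ + 1, by positivity, ⟨1, by norm_num, le_rfl⟩, fun ε _ x _ => ?_⟩
  simp [hc']

theorem isNegligible_zero {n : ℕ} (Ω : TopologicalSpace.Opens (Rn n)) :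
    IsNegligible Ω (0 : Net n) := by
  have h0 : ∀ l : List (Fin n), iterD l (0 : Rn n → ℂ) = 0 := by
    intro l
    induction l with
    | nil => rfl
    | cons i l ih =>
      have : pderiv i (0 : Rn n → ℂ) = 0 := by
        funext x
        simp [pderiv]
      simp only [iterD, this, ih]
  intro K _ _ α m
  refine ⟨1, one_pos, ⟨1, by norm_num, le_rfl⟩, fun ε _ x _ => ?_⟩
  have h : (0 : ℝ) ≤ ε := ε.2.1.le
  simp only [mderiv, Pi.zero_apply, h0, norm_zero]
  positivity

theorem isModerate_mderiv {n : ℕ} {Ω : TopologicalSpace.Opens (Rn n)} {u : Net n}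
    (hu : IsModerate Ω u) (α : Fin n → ℕ) : IsModerate Ω fun ε => mderiv α (u ε) := by
  rw [isModerate_iff] at *
  refine ⟨fun ε => contDiffOn_iterD _ (hu.1 ε), fun K hc hK l => ?_⟩
  have := hu.2 K hc hK (dirs α ++ l)
  simpa only [iterD_append, mderiv] using this

theorem isNegligible_mderiv {n : ℕ} {Ω : TopologicalSpace.Opens (Rn n)} {u : Net n}
    (hs : ∀ ε, ContDiffOn ℝ ∞ (u ε) Ω) (hu : IsNegligible Ω u) (α : Fin n → ℕ) :
    IsNegligible Ω fun ε => mderiv α (u ε) := by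
  rw [isNegligible_iff hs] at hu
  rw [isNegligible_iff (u := fun ε => mderiv α (u ε)) fun ε => contDiffOn_iterD _ (hs ε)]
  intro K hc hK l
  have := hu K hc hK (dirs α ++ l)
  simpa only [iterD_append, mderiv] using this

/-! ### The Colombeau algebra -/

/-- The algebra `X(Ω)` of moderate nets. -/
def Moderate {n : ℕ} (Ω : TopologicalSpace.Opens (Rn n)) : Subalgebra ℂ (Net n) where
  carrier := {u | IsModerate Ω u}
  mul_mem' := IsModerate.mul
  add_mem' := IsModerate.add
  algebraMap_mem' c := isModerate_const Ω c

/-- The ideal `N(Ω)` of null nets in `X(Ω)`. -/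
def Null {n : ℕ} (Ω : TopologicalSpace.Opens (Rn n)) : Ideal (Moderate Ω) where
  carrier := {u | IsNegligible Ω (u : Net n)}
  add_mem' {u v} hu hv := IsNegligible.add u.2.1 v.2.1 hu hv
  zero_mem' := isNegligible_zero Ω
  smul_mem' c u hu := IsModerate.mul_negligible c.2 u.2.1 hu

/-- The Colombeau algebra `G(Ω) = X(Ω) / N(Ω)`. -/
abbrev Colombeau {n : ℕ} (Ω : TopologicalSpace.Opens (Rn n)) : Type := Moderate Ω ⧸ Null Ω

/-- The class of a moderate net in `G(Ω)`. -/
def cl {n : ℕ} {Ω : TopologicalSpace.Opens (Rn n)} (u : Moderate Ω) : Colombeau Ω :=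
  Ideal.Quotient.mk (Null Ω) u

/-- The restriction `G(Ω) → G(Ω')` for `Ω' ⊆ Ω`. -/
def restrict {n : ℕ} {Ω Ω' : TopologicalSpace.Opens (Rn n)} (h : Ω' ≤ Ω) :
    Colombeau Ω →+* Colombeau Ω' :=
  Ideal.quotientMap (Null Ω')
    (Subalgebra.inclusion (S := Moderate Ω) (T := Moderate Ω') fun _ hu =>
      ⟨fun ε => (hu.1 ε).mono h, fun K hc hK => hu.2 K hc (hK.trans h)⟩).toRingHom
    fun _ hu K hc hK => hu K hc (hK.trans h)

/-- The derivative `∂^α` of moderate nets. -/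
def mderivNet {n : ℕ} {Ω : TopologicalSpace.Opens (Rn n)} (α : Fin n → ℕ) (u : Moderate Ω) :
    Moderate Ω :=
  ⟨fun ε => mderiv α ((u : Net n) ε), isModerate_mderiv u.2 α⟩

theorem cl_mderivNet_eq {n : ℕ} {Ω : TopologicalSpace.Opens (Rn n)} (α : Fin n → ℕ)
    (u v : Moderate Ω) (h : u - v ∈ Null Ω) : cl (mderivNet α u) = cl (mderivNet α v) := by
  refine (Ideal.Quotient.mk_eq_mk_iff_sub_mem _ _).2 ?_
  have h1 : IsNegligible Ω fun ε => mderiv α ((u - v : Moderate Ω).1 ε) :=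
    isNegligible_mderiv (u - v).2.1 h α
  intro K hc hK β m
  obtain ⟨C, hC, η, H⟩ := h1 K hc hK β m
  refine ⟨C, hC, η, fun ε hε x hx => ?_⟩
  have e : Set.EqOn (mderiv α (u.1 ε)) (mderiv α ((u - v : Moderate Ω).1 ε) + mderiv α (v.1 ε)) Ω := by
    have := iterD_add (Ω := Ω) (dirs α) ((u - v : Moderate Ω).2.1 ε) (v.2.1 ε)
    have e' : (u - v : Moderate Ω).1 ε + v.1 ε = u.1 ε := by
      change u.1 ε - v.1 ε + v.1 ε = u.1 ε
      simp
    rw [e'] at this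
    exact this
  have e2 : Set.EqOn ((mderivNet α u - mderivNet α v : Moderate Ω).1 ε)
      (mderiv α ((u - v : Moderate Ω).1 ε)) Ω := by
    intro y hy
    change mderiv α (u.1 ε) y - mderiv α (v.1 ε) y = _
    rw [e hy]
    simp
  have := iterD_congr (dirs β) e2 (hK hx)
  rw [mderiv, this]
  exact H ε hε x hx

/-- The derivative `∂^α` on `G(Ω)`, `∂^α cl(u_ε) = cl(∂^α u_ε)`. -/
def mderivG {n : ℕ} {Ω : TopologicalSpace.Opens (Rn n)} (α : Fin n → ℕ) (f : Colombeau Ω) :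
    Colombeau Ω :=
  Quotient.liftOn' f (fun u => cl (mderivNet α u)) fun u v h =>
    cl_mderivNet_eq α u v ((Submodule.quotientRel_def _).1 h)

theorem mderivG_cl {n : ℕ} {Ω : TopologicalSpace.Opens (Rn n)} (α : Fin n → ℕ)
    (u : Moderate Ω) : mderivG α (cl u) = cl (mderivNet α u) := rfl

/-- Nets whose members are supported in a common compact subset of `Ω`. -/
def HasCompactSupportIn {n : ℕ} (Ω : TopologicalSpace.Opens (Rn n)) (u : Net n) : Prop :=
  ∃ K : Set (Rn n), IsCompact K ∧ K ⊆ Ω ∧ ∀ ε, tsupport (u ε) ⊆ K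

/-- The set `G_C(Ω)` of generalized functions with compact support. -/
def ColombeauC {n : ℕ} (Ω : TopologicalSpace.Opens (Rn n)) : Set (Colombeau Ω) :=
  {f | ∃ u : Moderate Ω, cl u = f ∧ HasCompactSupportIn Ω (u : Net n)}

/-! ### Ultradifferentiable functions -/

/-- The standing assumptions on the weight sequence `M`: positivity, `M₀ = 1`, logarithmic
convexity (H1), stability under ultradifferential operators (H2), non-quasi-analyticity (H3)'. -/
structure IsWeightSequence (M : ℕ → ℝ) : Prop where
  pos : ∀ p, 0 < M p
  zero : M 0 = 1
  logConvex : ∀ p, M (p + 1) ^ 2 ≤ M p * M (p + 2)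
  stable : ∃ A > 0, ∃ H > 0, ∀ p q, q ≤ p → M p ≤ A * H ^ p * M q * M (p - q)
  nonQuasiAnalytic : Summable fun p => M p / M (p + 1)

/-- The associated function `M̃(t) = sup_p ln (t^p / M_p)`. For a weight sequence the supremum is
finite, and the value at `t = 0` is `0`. -/
def assocFun (M : ℕ → ℝ) (t : ℝ) : ℝ := ⨆ p : ℕ, Real.log (t ^ p / M p)

/-- The Denjoy–Carleman class `E^M(Ω)`. -/
def IsUltradiff {n : ℕ} (M : ℕ → ℝ) (Ω : TopologicalSpace.Opens (Rn n)) (φ : Rn n → ℂ) : Prop :=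
  ContDiffOn ℝ ∞ φ Ω ∧
  ∀ K : Set (Rn n), IsCompact K → K ⊆ Ω → ∃ c : ℝ, 0 < c ∧ ∀ α : Fin n → ℕ, ∀ x ∈ K,
    ‖mderiv α φ x‖ ≤ c ^ (mlen α + 1) * M (mlen α)

/-- The class `D^M(Ω)` of elements of `E^M(Ω)` with compact support in `Ω` (extended by zero). -/
def IsUltraTest {n : ℕ} (M : ℕ → ℝ) (Ω : TopologicalSpace.Opens (Rn n)) (φ : Rn n → ℂ) : Prop :=
  IsUltradiff M Ω φ ∧ HasCompactSupport φ ∧ tsupport φ ⊆ Ω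

/-! ### Ultraregular generalized functions -/

/-- The space `X^{M,R}(Ω)` of ultraregular moderate nets. -/
def IsUltraModerate {n : ℕ} (M : ℕ → ℝ) (R : Set (ℕ → ℝ)) (Ω : TopologicalSpace.Opens (Rn n))
    (u : Net n) : Prop :=
  (∀ ε, ContDiffOn ℝ ∞ (u ε) Ω) ∧
  ∀ K : Set (Rn n), IsCompact K → K ⊆ Ω → ∃ N ∈ R, ∃ C : ℝ, 0 < C ∧
    ∃ ε₀ : Set.Ioc (0 : ℝ) 1, ∀ α : Fin n → ℕ, ∀ ε ≤ ε₀, ∀ x ∈ K,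
      ‖mderiv α (u ε) x‖ ≤ C ^ (mlen α + 1) * M (mlen α) * (ε : ℝ) ^ (-N (mlen α))

/-- `G^{M,R}(Ω) = X^{M,R}(Ω) / (N(Ω) ∩ X^{M,R}(Ω))`, as a subset of `G(Ω)`: the classes that have
a representative in `X^{M,R}(Ω)`. -/
def UltraRegular {n : ℕ} (M : ℕ → ℝ) (R : Set (ℕ → ℝ)) (Ω : TopologicalSpace.Opens (Rn n)) :
    Set (Colombeau Ω) :=
  {f | ∃ u : Moderate Ω, cl u = f ∧ IsUltraModerate M R Ω (u : Net n)}

/-- The set `A` of nonnegative sequences bounded by an affine function of the index. -/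
def Affine : Set (ℕ → ℝ) :=
  {N | (∀ m, 0 ≤ N m) ∧ ∃ a ≥ 0, ∃ b ≥ 0, ∀ m : ℕ, N m ≤ a * m + b}

/-- The `(M, R)`-singular support: the complement in `Ω` of the largest open set on which `f` is
ultraregular, i.e. of the union of all open sets on which it is. -/
def singsupp {n : ℕ} (M : ℕ → ℝ) (R : Set (ℕ → ℝ)) {Ω : TopologicalSpace.Opens (Rn n)}
    (f : Colombeau Ω) : Set (Rn n) :=
  (Ω : Set (Rn n)) \
    {x | ∃ (Ω' : TopologicalSpace.Opens (Rn n)) (h : Ω' ≤ Ω),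
      x ∈ Ω' ∧ restrict h f ∈ UltraRegular M R Ω'}

/-! ### Microlocal notions -/

/-- `Γ` is an open conic neighborhood of `ξ₀`. -/
def IsConicNhd {n : ℕ} (Γ : Set (Rn n)) (ξ₀ : Rn n) : Prop :=
  IsOpen Γ ∧ ξ₀ ∈ Γ ∧ ∀ ξ ∈ Γ, ∀ t : ℝ, 0 < t → t • ξ ∈ Γ

/-- The Fourier estimate `|F(w_ε)(ξ)| ≤ C ε^{-b} exp(-M̃(k ε^a |ξ|))` on `Γ` for small `ε`. It does
not depend on the normalization of the Fourier transform, since `k` and `C` are free and cones are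
invariant under dilations. -/
def HasFourierDecay {n : ℕ} (M : ℕ → ℝ) (Γ : Set (Rn n)) (w : Net n) : Prop :=
  ∃ a : ℝ, 0 ≤ a ∧ ∃ b : ℝ, 0 ≤ b ∧ ∃ C : ℝ, 0 < C ∧ ∃ k : ℝ, 0 < k ∧
    ∃ ε₀ : Set.Ioc (0 : ℝ) 1, ∀ ε ≤ ε₀, ∀ ξ ∈ Γ,
      ‖𝓕 (w ε) ξ‖ ≤ C * (ε : ℝ) ^ (-b) * Real.exp (-assocFun M (k * (ε : ℝ) ^ a * ‖ξ‖))

/-- The cone `Σ^M_A(f)` of a compactly supported generalized function `f`: the complement in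
`ℝⁿ \ {0}` of the directions with a conic neighborhood in which some compactly supported
representative of `f` satisfies the Fourier estimate. (The estimate is not stable under adding null
nets, so a condition on a generalized function means: for some representative.) -/
def sigmaCone {n : ℕ} (M : ℕ → ℝ) {Ω : TopologicalSpace.Opens (Rn n)} (f : Colombeau Ω) :
    Set (Rn n) :=
  {ξ₀ | ξ₀ ≠ 0 ∧ ¬ ∃ Γ : Set (Rn n), IsConicNhd Γ ξ₀ ∧
    ∃ u : Moderate Ω, cl u = f ∧ HasCompactSupportIn Ω (u : Net n) ∧
      HasFourierDecay M Γ (u : Net n)}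

/-- The affine wave front set `WF^M_A(f) ⊆ Ω × (ℝⁿ \ {0})` of class `M`. -/
def waveFront {n : ℕ} (M : ℕ → ℝ) {Ω : TopologicalSpace.Opens (Rn n)} (f : Colombeau Ω) :
    Set (Rn n × Rn n) :=
  {p | p.1 ∈ Ω ∧ p.2 ≠ 0 ∧ ¬ ∃ φ : Rn n → ℂ, IsUltraTest M Ω φ ∧ (∀ᶠ x in 𝓝 p.1, φ x = 1) ∧
    ∃ Γ : Set (Rn n), IsConicNhd Γ p.2 ∧
      ∃ u : Moderate Ω, cl u = f ∧ HasFourierDecay M Γ fun ε x => φ x * (u : Net n) ε x}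

end

end UltraReg

namespace UltraReg

open scoped ContDiff Topology FourierTransform Pointwise
open MeasureTheory Filter TopologicalSpace

noncomputable section

/-! ### Partial derivatives of globally defined smooth functions -/

theorem contDiff_pderiv {n : ℕ} {f : Rn n → ℂ} (hf : ContDiff ℝ ∞ f) (i : Fin n) :
    ContDiff ℝ ∞ (pderiv i f) :=
  (hf.fderiv_right (m := ∞) (by simp)).clm_apply contDiff_const

theorem contDiff_iterD {n : ℕ} (l : List (Fin n)) :
    ∀ {f : Rn n → ℂ}, ContDiff ℝ ∞ f → ContDiff ℝ ∞ (iterD l f) := by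
  induction l with
  | nil => intro f h; exact h
  | cons i l ih => intro f h; exact ih (contDiff_pderiv h i)

theorem tsupport_pderiv_subset {n : ℕ} (f : Rn n → ℂ) (i : Fin n) :
    tsupport (pderiv i f) ⊆ tsupport f := by
  refine closure_minimal (fun x hx => ?_) (isClosed_tsupport f)
  refine support_fderiv_subset ℝ (fun h => hx ?_)
  simp [pderiv, h]

theorem tsupport_iterD_subset {n : ℕ} (l : List (Fin n)) :
    ∀ f : Rn n → ℂ, tsupport (iterD l f) ⊆ tsupport f := by
  induction l with
  | nil => intro f; exact subset_rfl
  | cons i l ih => intro f; exact (ih _).trans (tsupport_pderiv_subset f i)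

theorem hasCompactSupport_pderiv {n : ℕ} {f : Rn n → ℂ} (hf : HasCompactSupport f) (i : Fin n) :
    HasCompactSupport (pderiv i f) :=
  hf.of_isClosed_subset (isClosed_tsupport _) (tsupport_pderiv_subset f i)

theorem hasCompactSupport_iterD {n : ℕ} {f : Rn n → ℂ} (hf : HasCompactSupport f)
    (l : List (Fin n)) : HasCompactSupport (iterD l f) :=
  hf.of_isClosed_subset (isClosed_tsupport _) (tsupport_iterD_subset l f)

/-! ### The Fourier transform of smooth functions with compact support -/

theorem innerSL_single {n : ℕ} (ξ : Rn n) (i : Fin n) :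
    innerSL ℝ ξ (EuclideanSpace.single i (1 : ℝ)) = ξ i := by
  change inner ℝ ξ (EuclideanSpace.single i (1 : ℝ)) = ξ i
  simp [EuclideanSpace.inner_single_right]

theorem fourier_pderiv {n : ℕ} {f : Rn n → ℂ} (hf : ContDiff ℝ ∞ f) (hc : HasCompactSupport f)
    (i : Fin n) (ξ : Rn n) :
    𝓕 (pderiv i f) ξ = 2 * Real.pi * Complex.I * (ξ i : ℂ) * 𝓕 f ξ := by
  have hd : Continuous (fderiv ℝ f) := hf.continuous_fderiv (by simp)
  have hi : Integrable (fderiv ℝ f) := hd.integrable_of_hasCompactSupport (hc.fderiv ℝ)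
  have h := Real.fourier_fderiv (hf.continuous.integrable_of_hasCompactSupport hc)
    (hf.differentiable (by simp)) hi
  have h2 := Real.fourier_continuousLinearMap_apply (v := ξ)
    (a := EuclideanSpace.single i (1 : ℝ)) hi
  rw [h] at h2
  change _ = 𝓕 (pderiv i f) ξ at h2
  rw [← h2]
  calc _ = -(2 * Real.pi * Complex.I) • (-(ξ i)) • 𝓕 f ξ :=
        congrArg (fun t : ℝ => -(2 * Real.pi * Complex.I) • (-t) • 𝓕 f ξ) (innerSL_single ξ i)
    _ = _ := by
        simp only [smul_eq_mul, Complex.real_smul, Complex.ofReal_neg]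
        ring

theorem norm_fourier_iterD_replicate {n : ℕ} (i : Fin n) (p : ℕ) (ξ : Rn n) :
    ∀ {f : Rn n → ℂ}, ContDiff ℝ ∞ f → HasCompactSupport f →
    ‖𝓕 (iterD (List.replicate p i) f) ξ‖ = (2 * Real.pi * |ξ i|) ^ p * ‖𝓕 f ξ‖ := by
  induction p with
  | zero => intro f _ _; simp [iterD]
  | succ p ih =>
    intro f hf hc
    rw [List.replicate_succ, iterD, ih (contDiff_pderiv hf i) (hasCompactSupport_pderiv hc i),
      fourier_pderiv hf hc]
    simp [abs_of_pos Real.pi_pos]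
    ring

theorem norm_fourier_iterD_le {n : ℕ} (l : List (Fin n)) (ξ : Rn n) :
    ∀ {f : Rn n → ℂ}, ContDiff ℝ ∞ f → HasCompactSupport f →
    ‖𝓕 (iterD l f) ξ‖ ≤ (2 * Real.pi * ‖ξ‖) ^ l.length * ‖𝓕 f ξ‖ := by
  induction l with
  | nil => intro f _ _; simp [iterD]
  | cons i l ih =>
    intro f hf hc
    refine (ih (contDiff_pderiv hf i) (hasCompactSupport_pderiv hc i)).trans ?_
    rw [fourier_pderiv hf hc]
    have h : |ξ i| ≤ ‖ξ‖ := by simpa using PiLp.norm_apply_le ξ i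
    have hpi := Real.pi_pos
    simp only [norm_mul, Complex.norm_I, Complex.norm_real, Real.norm_eq_abs, abs_of_pos hpi,
      List.length_cons, Complex.norm_ofNat, mul_one]
    calc (2 * Real.pi * ‖ξ‖) ^ l.length * (2 * Real.pi * |ξ i| * ‖𝓕 f ξ‖)
        ≤ (2 * Real.pi * ‖ξ‖) ^ l.length * (2 * Real.pi * ‖ξ‖ * ‖𝓕 f ξ‖) := by gcongr
      _ = _ := by ring

theorem norm_fourier_le_of_bound {n : ℕ} {f : Rn n → ℂ} {K : Set (Rn n)} (hK : IsCompact K)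
    (hs : tsupport f ⊆ K) {B : ℝ} (hB : ∀ x, ‖f x‖ ≤ B) (ξ : Rn n) :
    ‖𝓕 f ξ‖ ≤ volume.real K * B := by
  have h0 : ∀ x ∉ K, 𝐞 (-inner ℝ x ξ) • f x = 0 := fun x hx => by
    rw [image_eq_zero_of_notMem_tsupport fun h => hx (hs h), smul_zero]
  rw [Real.fourier_eq, ← setIntegral_eq_integral_of_forall_compl_eq_zero h0, mul_comm]
  exact norm_setIntegral_le_of_norm_le_const hK.measure_lt_top fun x _ => by
    rw [Circle.norm_smul]; exact hB x

theorem exists_norm_le_mul_coord {n : ℕ} [NeZero n] (ξ : Rn n) :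
    ∃ i, ‖ξ‖ ≤ n * |ξ i| := by
  obtain ⟨i, hi⟩ := Finite.exists_max fun i => |ξ i|
  refine ⟨i, ?_⟩
  calc ‖ξ‖ = ‖∑ j, EuclideanSpace.single j (ξ j)‖ := by
        congr 1
        ext k
        simp [WithLp.ofLp_sum, Finset.sum_apply, Pi.single_apply]
    _ ≤ ∑ j : Fin n, ‖EuclideanSpace.single j (ξ j)‖ := norm_sum_le _ _
    _ ≤ ∑ _j : Fin n, |ξ i| := Finset.sum_le_sum fun j _ => by simpa using hi j
    _ = n * |ξ i| := by simp

/-- Bounds of the derivatives of order `p` yield decay of order `p` of the Fourier transform. -/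
theorem pow_mul_norm_fourier_le {n : ℕ} {f : Rn n → ℂ} (hf : ContDiff ℝ ∞ f) {K : Set (Rn n)}
    (hK : IsCompact K) (hs : tsupport f ⊆ K) {B : ℝ} (p : ℕ)
    (hB : ∀ l : List (Fin n), l.length = p → ∀ x, ‖iterD l f x‖ ≤ B) (ξ : Rn n) :
    ‖ξ‖ ^ p * ‖𝓕 f ξ‖ ≤ (n : ℝ) ^ p * (volume.real K * B) := by
  have hc : HasCompactSupport f := hK.of_isClosed_subset (isClosed_tsupport f) hs
  rcases Nat.eq_zero_or_pos p with rfl | hp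
  · simpa using norm_fourier_le_of_bound hK hs (hB [] rfl) ξ
  rcases Nat.eq_zero_or_pos n with rfl | hn
  · have : ξ = 0 := Subsingleton.elim _ _
    simp [this, hp.ne']
  have : NeZero n := ⟨hn.ne'⟩
  obtain ⟨i, hi⟩ := exists_norm_le_mul_coord ξ
  have h1 := norm_fourier_le_of_bound hK ((tsupport_iterD_subset (List.replicate p i) f).trans hs)
    (hB _ (List.length_replicate)) ξ
  rw [norm_fourier_iterD_replicate i p ξ hf hc] at h1
  have h2 : |ξ i| ≤ 2 * Real.pi * |ξ i| := by
    nlinarith [abs_nonneg (ξ i), Real.pi_gt_three]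
  calc ‖ξ‖ ^ p * ‖𝓕 f ξ‖ ≤ (n * |ξ i|) ^ p * ‖𝓕 f ξ‖ := by gcongr
    _ ≤ (n * (2 * Real.pi * |ξ i|)) ^ p * ‖𝓕 f ξ‖ := by gcongr
    _ = (n : ℝ) ^ p * ((2 * Real.pi * |ξ i|) ^ p * ‖𝓕 f ξ‖) := by ring
    _ ≤ _ := by gcongr

/-! ### Functions of rapid decay and their inverse Fourier transforms -/

/-- Measurable functions that are bounded by every negative power of the norm. -/
def RapidDecay {n : ℕ} (h : Rn n → ℂ) : Prop :=
  Measurable h ∧ ∀ p : ℕ, ∃ B : ℝ, ∀ ξ, ‖ξ‖ ^ p * ‖h ξ‖ ≤ B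

/-- The total mass of `2ⁿ (1 + |ξ|)^{-n-1}`. -/
def decayConst (n : ℕ) : ℝ :=
  ∫ ξ : Rn n, (2 : ℝ) ^ n * (1 + ‖ξ‖) ^ (-((n : ℝ) + 1))

theorem integrable_decayConst (n : ℕ) :
    Integrable fun ξ : Rn n => (2 : ℝ) ^ n * (1 + ‖ξ‖) ^ (-((n : ℝ) + 1)) :=
  (integrable_one_add_norm (by simp)).const_mul _

theorem decayConst_nonneg (n : ℕ) : 0 ≤ decayConst n :=
  integral_nonneg fun _ => by positivity

theorem norm_le_of_decay {n : ℕ} {y B : ℝ} {ξ : Rn n} (h0 : y ≤ B)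
    (h1 : ‖ξ‖ ^ (n + 1) * y ≤ B) (hy : 0 ≤ y) :
    y ≤ 2 * B * ((2 : ℝ) ^ n * (1 + ‖ξ‖) ^ (-((n : ℝ) + 1))) := by
  have hp : 0 < 1 + ‖ξ‖ := by positivity
  have e : (1 + ‖ξ‖) ^ (-((n : ℝ) + 1)) = ((1 + ‖ξ‖) ^ (n + 1))⁻¹ := by
    rw [Real.rpow_neg hp.le]
    norm_cast
  rw [e, ← mul_assoc, ← div_eq_mul_inv, le_div_iff₀ (by positivity)]
  have h2 : (1 + ‖ξ‖) ^ (n + 1) ≤ 2 ^ n * (1 ^ (n + 1) + ‖ξ‖ ^ (n + 1)) := by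
    simpa using add_pow_le zero_le_one (norm_nonneg ξ) (n + 1)
  calc y * (1 + ‖ξ‖) ^ (n + 1) ≤ y * (2 ^ n * (1 ^ (n + 1) + ‖ξ‖ ^ (n + 1))) := by gcongr
    _ = 2 ^ n * (y + ‖ξ‖ ^ (n + 1) * y) := by ring
    _ ≤ 2 ^ n * (B + B) := by gcongr
    _ = _ := by ring

theorem integrable_of_decay {n : ℕ} {h : Rn n → ℝ} (hm : Measurable h) {B : ℝ}
    (hn : ∀ ξ, 0 ≤ h ξ) (h0 : ∀ ξ, h ξ ≤ B) (h1 : ∀ ξ, ‖ξ‖ ^ (n + 1) * h ξ ≤ B) : Integrable h :=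
  ((integrable_decayConst n).const_mul (2 * B)).mono' hm.aestronglyMeasurable
    (Eventually.of_forall fun ξ => by
      rw [Real.norm_of_nonneg (hn ξ)]; exact norm_le_of_decay (h0 ξ) (h1 ξ) (hn ξ))

theorem integral_le_of_decay {n : ℕ} {h : Rn n → ℝ} {B : ℝ}
    (hn : ∀ ξ, 0 ≤ h ξ) (h0 : ∀ ξ, h ξ ≤ B) (h1 : ∀ ξ, ‖ξ‖ ^ (n + 1) * h ξ ≤ B) :
    ∫ ξ, h ξ ≤ 2 * B * decayConst n := by
  rw [decayConst, ← integral_const_mul]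
  exact integral_mono_of_nonneg (Eventually.of_forall hn)
    ((integrable_decayConst n).const_mul (2 * B))
    (Eventually.of_forall fun ξ => norm_le_of_decay (h0 ξ) (h1 ξ) (hn ξ))

theorem RapidDecay.integrable_pow_mul {n : ℕ} {h : Rn n → ℂ} (hh : RapidDecay h) (p : ℕ) :
    Integrable fun ξ => ‖ξ‖ ^ p * ‖h ξ‖ := by
  obtain ⟨B, hB⟩ := hh.2 p
  obtain ⟨B', hB'⟩ := hh.2 (n + 1 + p)
  refine integrable_of_decay (B := max B B') (by have := hh.1; fun_prop)
    (fun ξ => by positivity) (fun ξ => (hB ξ).trans (le_max_left _ _)) fun ξ => ?_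
  refine le_trans (le_of_eq ?_) ((hB' ξ).trans (le_max_right _ _))
  ring

theorem RapidDecay.integrable {n : ℕ} {h : Rn n → ℂ} (hh : RapidDecay h) : Integrable h := by
  have := hh.integrable_pow_mul 0
  simp only [pow_zero, one_mul] at this
  exact (integrable_norm_iff hh.1.aestronglyMeasurable).1 this

theorem RapidDecay.sub {n : ℕ} {g h : Rn n → ℂ} (hg : RapidDecay g) (hh : RapidDecay h) :
    RapidDecay fun ξ => g ξ - h ξ := by
  refine ⟨hg.1.sub hh.1, fun p => ?_⟩
  obtain ⟨B, hB⟩ := hg.2 p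
  obtain ⟨B', hB'⟩ := hh.2 p
  refine ⟨B + B', fun ξ => ?_⟩
  calc ‖ξ‖ ^ p * ‖g ξ - h ξ‖ ≤ ‖ξ‖ ^ p * (‖g ξ‖ + ‖h ξ‖) := by gcongr; exact norm_sub_le _ _
    _ ≤ _ := by rw [mul_add]; exact add_le_add (hB ξ) (hB' ξ)

theorem RapidDecay.comp_neg {n : ℕ} {h : Rn n → ℂ} (hh : RapidDecay h) :
    RapidDecay fun ξ => h (-ξ) := by
  refine ⟨hh.1.comp measurable_neg, fun p => ?_⟩
  obtain ⟨B, hB⟩ := hh.2 p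
  exact ⟨B, fun ξ => by simpa using hB (-ξ)⟩

theorem RapidDecay.coord_mul {n : ℕ} {h : Rn n → ℂ} (hh : RapidDecay h) (i : Fin n) :
    RapidDecay fun ξ => -(2 * Real.pi * Complex.I) * (ξ i : ℂ) * h ξ := by
  refine ⟨?_, fun p => ?_⟩
  · have := hh.1
    fun_prop
  obtain ⟨B, hB⟩ := hh.2 (p + 1)
  refine ⟨2 * Real.pi * B, fun ξ => ?_⟩
  have h1 : |ξ i| ≤ ‖ξ‖ := by simpa using PiLp.norm_apply_le ξ i
  have hpi := Real.pi_pos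
  simp only [norm_mul, norm_neg, Complex.norm_I, Complex.norm_real, Real.norm_eq_abs,
    abs_of_pos hpi, Complex.norm_ofNat, mul_one]
  calc ‖ξ‖ ^ p * (2 * Real.pi * |ξ i| * ‖h ξ‖) ≤ ‖ξ‖ ^ p * (2 * Real.pi * ‖ξ‖ * ‖h ξ‖) := by
        gcongr
    _ = 2 * Real.pi * (‖ξ‖ ^ (p + 1) * ‖h ξ‖) := by ring
    _ ≤ _ := by gcongr; exact hB ξ

theorem RapidDecay.contDiff_fourier {n : ℕ} {h : Rn n → ℂ} (hh : RapidDecay h) :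
    ContDiff ℝ ∞ (𝓕 h) :=
  Real.contDiff_fourier fun p _ => hh.integrable_pow_mul p

theorem RapidDecay.pderiv_fourier {n : ℕ} {h : Rn n → ℂ} (hh : RapidDecay h) (i : Fin n) :
    pderiv i (𝓕 h) = 𝓕 fun ξ : Rn n => -(2 * Real.pi * Complex.I) * (ξ i : ℂ) * h ξ := by
  funext x
  have h1 := hh.integrable_pow_mul 1
  simp only [pow_one] at h1
  have hi : Integrable (VectorFourier.fourierSMulRight (innerSL ℝ) h) := by
    refine (h1.const_mul (2 * Real.pi * ‖innerSL (E := Rn n) ℝ‖)).mono'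
      hh.integrable.1.fourierSMulRight (Eventually.of_forall fun ξ => ?_)
    refine (VectorFourier.norm_fourierSMulRight_le _ _ _).trans (le_of_eq (by ring))
  rw [pderiv, Real.fderiv_fourier hh.integrable h1, Real.fourier_continuousLinearMap_apply hi]
  refine congrArg (fun k : Rn n → ℂ => 𝓕 k x) (funext fun ξ => ?_)
  calc _ = -(2 * Real.pi * Complex.I) • (ξ i) • h ξ :=
        congrArg (fun t : ℝ => -(2 * Real.pi * Complex.I) • t • h ξ) (innerSL_single ξ i)
    _ = _ := by
        simp only [smul_eq_mul, Complex.real_smul]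
        ring

theorem RapidDecay.norm_iterD_fourier_le {n : ℕ} (l : List (Fin n)) (x : Rn n) :
    ∀ {h : Rn n → ℂ}, RapidDecay h →
      ‖iterD l (𝓕 h) x‖ ≤ (2 * Real.pi) ^ l.length * ∫ ξ, ‖ξ‖ ^ l.length * ‖h ξ‖ := by
  induction l with
  | nil =>
    intro h hh
    simp only [iterD, List.length_nil, pow_zero, one_mul]
    exact VectorFourier.norm_fourierIntegral_le_integral_norm _ volume _ h x
  | cons i l ih =>
    intro h hh
    rw [iterD, hh.pderiv_fourier]
    refine (ih (hh.coord_mul i)).trans ?_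
    rw [List.length_cons, pow_succ (2 * Real.pi), mul_assoc (_ ^ _) (2 * Real.pi),
      ← integral_const_mul (2 * Real.pi)]
    gcongr
    · exact ((hh.coord_mul i).integrable_pow_mul _)
    · exact (hh.integrable_pow_mul _).const_mul _
    · intro ξ
      have h1 : |ξ i| ≤ ‖ξ‖ := by simpa using PiLp.norm_apply_le ξ i
      have hpi := Real.pi_pos
      simp only [norm_mul, norm_neg, Complex.norm_I, Complex.norm_real, Real.norm_eq_abs,
        abs_of_pos hpi, Complex.norm_ofNat, mul_one]
      calc ‖ξ‖ ^ l.length * (2 * Real.pi * |ξ i| * ‖h ξ‖)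
          ≤ ‖ξ‖ ^ l.length * (2 * Real.pi * ‖ξ‖ * ‖h ξ‖) := by gcongr
        _ = _ := by ring

theorem RapidDecay.contDiff_fourierInv {n : ℕ} {h : Rn n → ℂ} (hh : RapidDecay h) :
    ContDiff ℝ ∞ (𝓕⁻ h) := by
  rw [Real.fourierInv_eq_fourier_comp_neg]
  exact hh.comp_neg.contDiff_fourier

theorem RapidDecay.norm_iterD_fourierInv_le {n : ℕ} {h : Rn n → ℂ} (hh : RapidDecay h)
    (l : List (Fin n)) (x : Rn n) :
    ‖iterD l (𝓕⁻ h) x‖ ≤ (2 * Real.pi) ^ l.length * ∫ ξ, ‖ξ‖ ^ l.length * ‖h ξ‖ := by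
  rw [Real.fourierInv_eq_fourier_comp_neg]
  refine (RapidDecay.norm_iterD_fourier_le l x hh.comp_neg).trans (le_of_eq ?_)
  congr 1
  rw [← integral_neg_eq_self]
  simp

theorem fourierInv_sub {n : ℕ} {g h : Rn n → ℂ} (hg : RapidDecay g) (hh : RapidDecay h) :
    𝓕⁻ (fun ξ => g ξ - h ξ) = fun x => 𝓕⁻ g x - 𝓕⁻ h x := by
  funext x
  simp only [Real.fourierInv_eq, smul_sub]
  have key : ∀ {k : Rn n → ℂ}, RapidDecay k → Integrable fun v => 𝐞 (inner ℝ v x) • k v := by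
    intro k hk
    have := (Real.fourierIntegral_convergent_iff (f := k) (μ := volume) (-x)).2 hk.integrable
    simpa using this
  exact integral_sub (key hg) (key hh)

/-- The Fourier transform of a test function decays rapidly. -/
theorem rapidDecay_fourier {n : ℕ} {f : Rn n → ℂ} (hf : ContDiff ℝ ∞ f)
    (hc : HasCompactSupport f) : RapidDecay (𝓕 f) := by
  have hcont : Continuous (𝓕 f) := VectorFourier.fourierIntegral_continuous
    Real.continuous_fourierChar (by exact continuous_inner)
    (hf.continuous.integrable_of_hasCompactSupport hc)
  refine ⟨hcont.measurable, fun p => ?_⟩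
  have hb : ∀ l : List (Fin n), ∃ B, ∀ x, ‖iterD l f x‖ ≤ B := fun l =>
    (contDiff_iterD l hf).continuous.bounded_above_of_compact_support (hasCompactSupport_iterD hc l)
  choose B hB using hb
  have hfin : {l : List (Fin n) | l.length = p}.Finite := List.finite_length_eq _ _
  obtain ⟨C, hC⟩ := (hfin.image B).bddAbove
  exact ⟨_, pow_mul_norm_fourier_le hf hc subset_rfl p fun l hl x =>
    (hB l x).trans (hC ⟨l, hl, rfl⟩)⟩

theorem fourierInv_fourier {n : ℕ} {f : Rn n → ℂ} (hf : ContDiff ℝ ∞ f)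
    (hc : HasCompactSupport f) : 𝓕⁻ (𝓕 f) = f :=
  hf.continuous.fourierInv_fourier_eq (hf.continuous.integrable_of_hasCompactSupport hc)
    (rapidDecay_fourier hf hc).integrable

/-- The Fourier transform of a product is the convolution of the Fourier transforms. -/
theorem fourier_mul {n : ℕ} {v w : Rn n → ℂ} (hv : ContDiff ℝ ∞ v) (hvc : HasCompactSupport v)
    (hw : ContDiff ℝ ∞ w) (hwc : HasCompactSupport w) (ξ : Rn n) :
    𝓕 (fun x => v x * w x) ξ = ∫ ζ, 𝓕 v ζ * 𝓕 w (ξ - ζ) := by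
  have hV := (rapidDecay_fourier hv hvc).integrable
  have hW := hw.continuous.integrable_of_hasCompactSupport hwc (μ := volume)
  have e1 : 𝓕 (fun x => v x * w x) ξ
      = ∫ x, ∫ ζ, 𝐞 (-inner ℝ x (ξ - ζ)) • (w x * 𝓕 v ζ) := by
    rw [Real.fourier_eq]
    refine integral_congr_ae (Eventually.of_forall fun x => ?_)
    have e2 : v x = ∫ ζ, 𝐞 (inner ℝ ζ x) • 𝓕 v ζ := by
      rw [← Real.fourierInv_eq, fourierInv_fourier hv hvc]
    simp only [Circle.smul_def, smul_eq_mul] at e2 ⊢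
    rw [e2, ← integral_mul_const, ← integral_const_mul]
    refine integral_congr_ae (Eventually.of_forall fun ζ => ?_)
    simp only
    rw [inner_sub_right, neg_sub, sub_eq_add_neg, AddChar.map_add_eq_mul, real_inner_comm ζ x,
      Circle.coe_mul]
    ring
  rw [e1, integral_integral_swap]
  · refine integral_congr_ae (Eventually.of_forall fun ζ => ?_)
    simp only
    rw [Real.fourier_eq w, ← integral_const_mul]
    refine integral_congr_ae (Eventually.of_forall fun x => ?_)
    simp only [Circle.smul_def, smul_eq_mul]
    ring
  · have hc : Continuous fun p : Rn n × Rn n => 𝐞 (-inner ℝ p.1 (ξ - p.2)) :=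
      Real.continuous_fourierChar.comp (by fun_prop)
    have hi : Integrable (fun p : Rn n × Rn n => w p.1 * 𝓕 v p.2) (volume.prod volume) :=
      hW.mul_prod hV
    refine hi.mono (hc.aestronglyMeasurable.smul hi.1) (Eventually.of_forall fun p => ?_)
    simp only [Function.uncurry]
    rw [Circle.norm_smul]

/-! ### Weight sequences -/

namespace IsWeightSequence

variable {M : ℕ → ℝ}

theorem monotone_ratio (hM : IsWeightSequence M) : Monotone fun p => M (p + 1) / M p := by
  refine monotone_nat_of_le_succ fun p => ?_
  rw [div_le_div_iff₀ (hM.pos _) (hM.pos _), ← sq, mul_comm]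
  exact hM.logConvex p

theorem mul_le_add (hM : IsWeightSequence M) (p q : ℕ) : M p * M q ≤ M (p + q) := by
  induction q with
  | zero => simp [hM.zero]
  | succ q ih =>
    have h1 : M (q + 1) / M q ≤ M (p + q + 1) / M (p + q) := hM.monotone_ratio (by omega)
    have hq := hM.pos q
    have hpq := hM.pos (p + q)
    calc M p * M (q + 1) = M p * M q * (M (q + 1) / M q) := by field_simp
      _ ≤ M (p + q) * (M (p + q + 1) / M (p + q)) :=
        mul_le_mul ih h1 (div_pos (hM.pos _) hq).le hpq.le
      _ = M (p + (q + 1)) := by field_simp; ring_nf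

theorem exists_shift_le (hM : IsWeightSequence M) (N : ℕ) :
    ∃ D : ℝ, 1 ≤ D ∧ ∀ p, M (p + N) ≤ D ^ (p + 1) * M p := by
  obtain ⟨A, hA, H, hH, h⟩ := hM.stable
  have hN := hM.pos N
  refine ⟨max 1 (max H (A * H ^ N * M N)), le_max_left _ _, fun p => ?_⟩
  set D := max 1 (max H (A * H ^ N * M N))
  have h1 : H ≤ D := (le_max_left _ _).trans (le_max_right _ _)
  have h2 : A * H ^ N * M N ≤ D := (le_max_right _ _).trans (le_max_right _ _)
  have hp := hM.pos p
  calc M (p + N) ≤ A * H ^ (p + N) * M p * M (p + N - p) := h _ _ (by omega)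
    _ = H ^ p * (A * H ^ N * M N) * M p := by rw [Nat.add_sub_cancel_left, pow_add]; ring
    _ ≤ D ^ p * D * M p := by gcongr
    _ = _ := by rw [pow_succ]

theorem bddAbove_pow_div (hM : IsWeightSequence M) {t : ℝ} (ht : 0 < t) :
    BddAbove (Set.range fun p => t ^ p / M p) := by
  have hs : Summable fun p => t ^ p / M p := by
    refine summable_of_ratio_test_tendsto_lt_one (l := t * 0) (by simp)
      (Eventually.of_forall fun p => (div_pos (pow_pos ht p) (hM.pos p)).ne') ?_
    refine (hM.nonQuasiAnalytic.tendsto_atTop_zero.const_mul t).congr fun p => ?_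
    have h1 := hM.pos p
    have h2 := hM.pos (p + 1)
    rw [Real.norm_of_nonneg (by positivity), Real.norm_of_nonneg (by positivity), pow_succ]
    field_simp
  exact hs.tendsto_atTop_zero.bddAbove_range

theorem bddAbove_log (hM : IsWeightSequence M) {t : ℝ} (ht : 0 < t) :
    BddAbove (Set.range fun p => Real.log (t ^ p / M p)) := by
  obtain ⟨B, hB⟩ := hM.bddAbove_pow_div ht
  refine ⟨Real.log B, ?_⟩
  rintro _ ⟨p, rfl⟩
  exact Real.log_le_log (div_pos (pow_pos ht p) (hM.pos p)) (hB ⟨p, rfl⟩)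

theorem assocFun_zero (hM : IsWeightSequence M) : assocFun M 0 = 0 := by
  have : ∀ p : ℕ, Real.log ((0 : ℝ) ^ p / M p) = 0 := by
    intro p
    rcases p with _ | p
    · simp [hM.zero]
    · simp
  simp [assocFun, this]

/-- `exp (-M̃(t))` is the infimum of `M_p / t^p`. -/
theorem le_mul_exp_neg_assocFun_iff (hM : IsWeightSequence M) {t X Y : ℝ} (ht : 0 ≤ t)
    (hX : 0 ≤ X) (hY : 0 < Y) :
    X ≤ Y * Real.exp (-assocFun M t) ↔ ∀ p, t ^ p * X ≤ Y * M p := by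
  rcases ht.eq_or_lt with rfl | ht
  · rw [hM.assocFun_zero]
    refine ⟨fun h p => ?_, fun h => by simpa [hM.zero] using h 0⟩
    rcases p with _ | p
    · simpa [hM.zero] using h
    · simpa using (mul_pos hY (hM.pos (p + 1))).le
  constructor
  · intro h p
    have h1 : Real.log (t ^ p / M p) ≤ assocFun M t := le_ciSup (hM.bddAbove_log ht) p
    have hp := hM.pos p
    have htp := pow_pos ht p
    rw [Real.log_le_iff_le_exp (by positivity)] at h1
    rw [Real.exp_neg, ← div_eq_mul_inv, le_div_iff₀ (Real.exp_pos _)] at h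
    rw [div_le_iff₀ hp] at h1
    calc t ^ p * X ≤ Real.exp (assocFun M t) * M p * X := by gcongr
      _ = X * Real.exp (assocFun M t) * M p := by ring
      _ ≤ Y * M p := by gcongr
  · intro h
    rcases hX.eq_or_lt with rfl | hX
    · positivity
    have h1 : assocFun M t ≤ Real.log (Y / X) := by
      refine ciSup_le fun p => Real.log_le_log (div_pos (pow_pos ht p) (hM.pos p)) ?_
      rw [div_le_div_iff₀ (hM.pos p) hX]
      exact h p
    rw [Real.le_log_iff_exp_le (by positivity), le_div_iff₀ hX] at h1
    rw [Real.exp_neg, ← div_eq_mul_inv, le_div_iff₀ (Real.exp_pos _), mul_comm]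
    exact h1

end IsWeightSequence

/-! ### Ultradifferentiable bounds with explicit constants -/

/-- The bounds `|∂^α f(x)| ≤ A c^{|α|} M_{|α|}` at a point. -/
def UltraAt {n : ℕ} (M : ℕ → ℝ) (A c : ℝ) (f : Rn n → ℂ) (x : Rn n) : Prop :=
  ∀ l : List (Fin n), ‖iterD l f x‖ ≤ A * c ^ l.length * M l.length

theorem UltraAt.mono {n : ℕ} {M : ℕ → ℝ} (hM : IsWeightSequence M) {A A' c c' : ℝ}
    {f : Rn n → ℂ} {x : Rn n} (h : UltraAt M A c f x) (hA : A ≤ A') (hc : c ≤ c') (hA' : 0 ≤ A')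
    (h0 : 0 ≤ c) : UltraAt M A' c' f x := fun l => by
  have := (hM.pos l.length).le
  exact (h l).trans (by gcongr)

theorem norm_iterD_mul_le {n : ℕ} {M : ℕ → ℝ} (hM : IsWeightSequence M)
    {Ω : TopologicalSpace.Opens (Rn n)} {c d : ℝ} (hc : 0 ≤ c) (hd : 0 ≤ d) {x : Rn n}
    (hx : x ∈ Ω) (l : List (Fin n)) :
    ∀ {f g : Rn n → ℂ} {A B : ℝ} {s t : ℕ}, 0 ≤ A → 0 ≤ B →
      ContDiffOn ℝ ∞ f Ω → ContDiffOn ℝ ∞ g Ω →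
      (∀ l', ‖iterD l' f x‖ ≤ A * c ^ l'.length * M (s + l'.length)) →
      (∀ l', ‖iterD l' g x‖ ≤ B * d ^ l'.length * M (t + l'.length)) →
      ‖iterD l (f * g) x‖ ≤ A * B * (c + d) ^ l.length * M (s + t + l.length) := by
  induction l with
  | nil =>
    intro f g A B s t hA hB _ _ hf hg
    have h1 := hf []
    have h2 := hg []
    simp only [iterD, List.length_nil, pow_zero, mul_one, add_zero] at h1 h2 ⊢
    have := hM.mul_le_add s t
    have hs := (hM.pos s).le
    calc ‖(f * g) x‖ = ‖f x‖ * ‖g x‖ := norm_mul _ _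
      _ ≤ (A * M s) * (B * M t) := by gcongr
      _ = A * B * (M s * M t) := by ring
      _ ≤ _ := by gcongr
  | cons i l ih =>
    intro f g A B s t hA hB hfs hgs hf hg
    have hfs' := contDiffOn_pderiv hfs i
    have hgs' := contDiffOn_pderiv hgs i
    have e : iterD (i :: l) (f * g) x
        = iterD l (pderiv i f * g) x + iterD l (f * pderiv i g) x :=
      ((iterD_congr l (pderiv_mul hfs hgs i)).trans
        (iterD_add l (hfs'.mul hgs) (hfs.mul hgs'))) hx
    have h1 := ih (s := s + 1) (t := t) (A := A * c) (B := B) (by positivity) hB hfs' hgs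
      (fun l' => by
        refine (hf (i :: l')).trans (le_of_eq ?_)
        rw [List.length_cons, pow_succ, show s + 1 + l'.length = s + (l'.length + 1) by omega]
        ring) hg
    have h2 := ih (s := s) (t := t + 1) (A := A) (B := B * d) hA (by positivity) hfs hgs' hf
      (fun l' => by
        refine (hg (i :: l')).trans (le_of_eq ?_)
        rw [List.length_cons, pow_succ, show t + 1 + l'.length = t + (l'.length + 1) by omega]
        ring)
    rw [e]
    refine (norm_add_le _ _).trans ((add_le_add h1 h2).trans (le_of_eq ?_))
    rw [List.length_cons, show s + 1 + t + l.length = s + t + (l.length + 1) by omega,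
      show s + (t + 1) + l.length = s + t + (l.length + 1) by omega]
    ring

theorem UltraAt.mul {n : ℕ} {M : ℕ → ℝ} (hM : IsWeightSequence M)
    {Ω : TopologicalSpace.Opens (Rn n)} {A B c d : ℝ} (hA : 0 ≤ A) (hB : 0 ≤ B) (hc : 0 ≤ c)
    (hd : 0 ≤ d) {x : Rn n} (hx : x ∈ Ω) {f g : Rn n → ℂ} (hfs : ContDiffOn ℝ ∞ f Ω)
    (hgs : ContDiffOn ℝ ∞ g Ω) (hf : UltraAt M A c f x) (hg : UltraAt M B d g x) :
    UltraAt M (A * B) (c + d) (f * g) x := fun l => by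
  simpa using norm_iterD_mul_le hM hc hd hx l (s := 0) (t := 0) hA hB hfs hgs
    (by simpa [UltraAt] using hf) (by simpa [UltraAt] using hg)

/-- The bounds `|ξ|^p |h(ξ)| ≤ A c^p M_p` for `ξ ∈ Γ`. -/
def DecayOn {n : ℕ} (M : ℕ → ℝ) (A c : ℝ) (Γ : Set (Rn n)) (h : Rn n → ℂ) : Prop :=
  ∀ ξ ∈ Γ, ∀ p : ℕ, ‖ξ‖ ^ p * ‖h ξ‖ ≤ A * c ^ p * M p

theorem DecayOn.mono {n : ℕ} {M : ℕ → ℝ} (hM : IsWeightSequence M) {A A' c c' : ℝ}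
    {Γ Γ' : Set (Rn n)} {h : Rn n → ℂ} (hh : DecayOn M A c Γ h) (hΓ : Γ' ⊆ Γ) (hA : A ≤ A')
    (hc : c ≤ c') (hA' : 0 ≤ A') (h0 : 0 ≤ c) : DecayOn M A' c' Γ' h := fun ξ hξ p => by
  have := (hM.pos p).le
  exact (hh ξ (hΓ hξ) p).trans (by gcongr)

theorem decayOn_fourier_of_ultraAt {n : ℕ} {M : ℕ → ℝ} {A c : ℝ}
    {f : Rn n → ℂ} (hf : ContDiff ℝ ∞ f) {K : Set (Rn n)} (hK : IsCompact K)
    (hs : tsupport f ⊆ K) (h : ∀ x, UltraAt M A c f x) :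
    DecayOn M (volume.real K * A) (n * c) Set.univ (𝓕 f) := fun ξ _ p => by
  refine (pow_mul_norm_fourier_le hf hK hs p (B := A * c ^ p * M p)
    (fun l hl x => by simpa [hl] using h x l) ξ).trans (le_of_eq ?_)
  ring

/-- Decay at infinity of class `M` bounds all moments. -/
theorem exists_moment_le {M : ℕ → ℝ} (hM : IsWeightSequence M) (n : ℕ) :
    ∃ D : ℝ, 1 ≤ D ∧ ∀ {A c : ℝ} {h : Rn n → ℂ}, 0 ≤ A → 1 ≤ c → DecayOn M A c Set.univ h →
      ∀ p, ∫ ξ, ‖ξ‖ ^ p * ‖h ξ‖ ≤ D * A * c ^ (n + 1) * (D * c) ^ p * M p := by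
  obtain ⟨D, hD, hDM⟩ := hM.exists_shift_le (n + 1)
  have hd := decayConst_nonneg n
  refine ⟨D * (1 + 2 * decayConst n), one_le_mul_of_one_le_of_one_le hD (by linarith), ?_⟩
  intro A c h hA hc hh p
  have hp := hM.pos p
  have hc0 : 0 ≤ c := zero_le_one.trans hc
  have hD0 : 0 ≤ D := zero_le_one.trans hD
  set B : ℝ := A * c ^ (n + 1) * D * (D * c) ^ p * M p with hB
  have h0 : ∀ ξ, ‖ξ‖ ^ p * ‖h ξ‖ ≤ B := fun ξ => by
    refine (hh ξ trivial p).trans ?_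
    calc A * c ^ p * M p = A * 1 * 1 * (1 * c) ^ p * M p := by ring
      _ ≤ A * c ^ (n + 1) * D * (D * c) ^ p * M p := by
        gcongr
        exact one_le_pow₀ hc
  have h1 : ∀ ξ, ‖ξ‖ ^ (n + 1) * (‖ξ‖ ^ p * ‖h ξ‖) ≤ B := fun ξ => by
    have := hh ξ trivial (p + (n + 1))
    calc ‖ξ‖ ^ (n + 1) * (‖ξ‖ ^ p * ‖h ξ‖) = ‖ξ‖ ^ (p + (n + 1)) * ‖h ξ‖ := by ring
      _ ≤ A * c ^ (p + (n + 1)) * M (p + (n + 1)) := this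
      _ ≤ A * c ^ (p + (n + 1)) * (D ^ (p + 1) * M p) := by gcongr; exact hDM p
      _ = B := by rw [hB]; ring
  refine (integral_le_of_decay (fun ξ => by positivity) h0 h1).trans ?_
  have hE : D ≤ D * (1 + 2 * decayConst n) := le_mul_of_one_le_right hD0 (by linarith)
  calc 2 * B * decayConst n
      = (D * (2 * decayConst n)) * A * c ^ (n + 1) * (D * c) ^ p * M p := by rw [hB]; ring
    _ ≤ _ := by
      gcongr
      linarith

/-- Every conic neighborhood contains a smaller one at positive angular distance from its
boundary. -/
theorem IsConicNhd.exists_shrink {n : ℕ} {Γ : Set (Rn n)} {ξ₀ : Rn n} (h : IsConicNhd Γ ξ₀) :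
    ∃ Γ' : Set (Rn n), IsConicNhd Γ' ξ₀ ∧ ∃ r : ℝ, 0 < r ∧ r ≤ 1 / 2 ∧
      ∀ ξ ∈ Γ', ∀ η, ‖η - ξ‖ ≤ r * ‖ξ‖ → η ∈ Γ := by
  obtain ⟨ho, hm, hcone⟩ := h
  obtain ⟨r, hr, hball⟩ := Metric.isOpen_iff.1 ho ξ₀ hm
  set b := Metric.ball ξ₀ (r / 2)
  have hn := norm_nonneg ξ₀
  refine ⟨⋃ t ∈ Set.Ioi (0 : ℝ), t • b, ⟨?_, ?_, ?_⟩, r / (2 * (‖ξ₀‖ + r)), by positivity, ?_, ?_⟩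
  · exact isOpen_biUnion fun t ht => Metric.isOpen_ball.smul₀ (ne_of_gt ht)
  · refine Set.mem_biUnion (show (1 : ℝ) ∈ Set.Ioi (0 : ℝ) by simp) ?_
    rw [one_smul]
    exact Metric.mem_ball_self (by positivity)
  · intro ξ hξ t ht
    obtain ⟨s, hs, hξ⟩ := Set.mem_iUnion₂.1 hξ
    obtain ⟨ζ, hζ, rfl⟩ := hξ
    refine Set.mem_biUnion (show t * s ∈ Set.Ioi (0 : ℝ) from mul_pos ht hs) ⟨ζ, hζ, ?_⟩
    exact mul_smul t s ζ
  · rw [div_le_iff₀ (by positivity)]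
    linarith
  · intro ξ hξ η hη
    obtain ⟨s, hs, hξ⟩ := Set.mem_iUnion₂.1 hξ
    obtain ⟨ζ, hζ, rfl⟩ := hξ
    have hs : 0 < s := hs
    have hζ' : ‖ζ - ξ₀‖ < r / 2 := mem_ball_iff_norm.1 hζ
    simp only at hη
    have hz : ‖ζ‖ ≤ ‖ξ₀‖ + r := by
      have := norm_le_norm_add_norm_sub' ζ ξ₀
      linarith
    have h1 : ‖s⁻¹ • η - ζ‖ ≤ r / 2 := by
      have e : s⁻¹ • η - ζ = s⁻¹ • (η - s • ζ) := by
        rw [smul_sub, inv_smul_smul₀ hs.ne']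
      rw [e, norm_smul, Real.norm_of_nonneg (inv_nonneg.2 hs.le)]
      rw [norm_smul, Real.norm_of_nonneg hs.le] at hη
      calc s⁻¹ * ‖η - s • ζ‖ ≤ s⁻¹ * (r / (2 * (‖ξ₀‖ + r)) * (s * ‖ζ‖)) := by gcongr
        _ = r / (2 * (‖ξ₀‖ + r)) * ‖ζ‖ := by field_simp
        _ ≤ r / (2 * (‖ξ₀‖ + r)) * (‖ξ₀‖ + r) := by gcongr
        _ = r / 2 := by field_simp
    have h2 : s⁻¹ • η ∈ Γ := by
      refine hball (mem_ball_iff_norm.2 ?_)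
      calc ‖s⁻¹ • η - ξ₀‖ ≤ ‖s⁻¹ • η - ζ‖ + ‖ζ - ξ₀‖ := norm_sub_le_norm_sub_add_norm_sub _ _ _
        _ < r := by linarith
    have := hcone _ h2 s hs
    rwa [smul_inv_smul₀ hs.ne'] at this

/-- Multiplication by a function with Fourier transform of decay `M` preserves the decay `M` in
cones, after shrinking the cone. -/
theorem decayOn_fourier_mul {n : ℕ} {M : ℕ → ℝ} (hM : IsWeightSequence M) {v w : Rn n → ℂ}
    (hv : ContDiff ℝ ∞ v) (hvc : HasCompactSupport v) (hw : ContDiff ℝ ∞ w)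
    (hwc : HasCompactSupport w) {Γ Γ' : Set (Rn n)} {r : ℝ} (hr : 0 < r) (hr2 : r ≤ 1 / 2)
    (hΓ : ∀ ξ ∈ Γ', ∀ η, ‖η - ξ‖ ≤ r * ‖ξ‖ → η ∈ Γ) {A B c d : ℝ}
    (hB0 : 0 ≤ B) (hc0 : 0 ≤ c) (hd0 : 0 ≤ d)
    (hmom : ∀ p, ∫ ζ, ‖ζ‖ ^ p * ‖𝓕 v ζ‖ ≤ A * c ^ p * M p)
    (hB : ∀ η, ‖𝓕 w η‖ ≤ B) (hdec : DecayOn M B d Γ (𝓕 w)) :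
    DecayOn M (2 * A * B) (r⁻¹ * (c + d)) Γ' (𝓕 fun x => v x * w x) := by
  have hV := rapidDecay_fourier hv hvc
  have hA0 : 0 ≤ A := by
    have := (integral_nonneg fun ζ : Rn n => by positivity).trans (hmom 0)
    simpa [hM.zero] using this
  intro ξ hξ p
  have hp := hM.pos p
  have hr1 : (1 : ℝ) ≤ r⁻¹ := by rw [one_le_inv₀ hr]; linarith
  have hpt : ∀ ζ, ‖ξ‖ ^ p * (‖𝓕 v ζ‖ * ‖𝓕 w (ξ - ζ)‖) ≤
      (r⁻¹ ^ p * B * d ^ p * M p) * (‖ζ‖ ^ 0 * ‖𝓕 v ζ‖)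
        + r⁻¹ ^ p * B * (‖ζ‖ ^ p * ‖𝓕 v ζ‖) := by
    intro ζ
    rcases le_total ‖ζ‖ (r * ‖ξ‖) with h | h
    · have hη : ξ - ζ ∈ Γ := hΓ ξ hξ _ (by simpa using h)
      have h1 : ‖ξ‖ ≤ r⁻¹ * ‖ξ - ζ‖ := by
        have h2 : ‖ξ‖ - ‖ζ‖ ≤ ‖ξ - ζ‖ := norm_sub_norm_le _ _
        rw [inv_mul_eq_div, le_div_iff₀ hr]
        nlinarith [norm_nonneg ξ]
      have h3 := hdec _ hη p
      calc ‖ξ‖ ^ p * (‖𝓕 v ζ‖ * ‖𝓕 w (ξ - ζ)‖)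
          ≤ (r⁻¹ * ‖ξ - ζ‖) ^ p * (‖𝓕 v ζ‖ * ‖𝓕 w (ξ - ζ)‖) := by gcongr
        _ = r⁻¹ ^ p * ‖𝓕 v ζ‖ * (‖ξ - ζ‖ ^ p * ‖𝓕 w (ξ - ζ)‖) := by ring
        _ ≤ r⁻¹ ^ p * ‖𝓕 v ζ‖ * (B * d ^ p * M p) := by gcongr
        _ = (r⁻¹ ^ p * B * d ^ p * M p) * (‖ζ‖ ^ 0 * ‖𝓕 v ζ‖) := by ring
        _ ≤ _ := le_add_of_nonneg_right (by positivity)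
    · have h1 : ‖ξ‖ ≤ r⁻¹ * ‖ζ‖ := by
        rw [inv_mul_eq_div, le_div_iff₀ hr]
        linarith
      calc ‖ξ‖ ^ p * (‖𝓕 v ζ‖ * ‖𝓕 w (ξ - ζ)‖)
          ≤ (r⁻¹ * ‖ζ‖) ^ p * (‖𝓕 v ζ‖ * B) := by gcongr; exact hB _
        _ = r⁻¹ ^ p * B * (‖ζ‖ ^ p * ‖𝓕 v ζ‖) := by ring
        _ ≤ _ := le_add_of_nonneg_left (by positivity)
  have hi := ((hV.integrable_pow_mul 0).const_mul (r⁻¹ ^ p * B * d ^ p * M p)).add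
    ((hV.integrable_pow_mul p).const_mul (r⁻¹ ^ p * B))
  have h0 := hmom 0
  rw [pow_zero, mul_one, hM.zero, mul_one] at h0
  rw [fourier_mul hv hvc hw hwc]
  calc ‖ξ‖ ^ p * ‖∫ ζ, 𝓕 v ζ * 𝓕 w (ξ - ζ)‖
      ≤ ‖ξ‖ ^ p * ∫ ζ, ‖𝓕 v ζ‖ * ‖𝓕 w (ξ - ζ)‖ := by
        gcongr
        exact (norm_integral_le_integral_norm _).trans (le_of_eq (by simp only [norm_mul]))
    _ = ∫ ζ, ‖ξ‖ ^ p * (‖𝓕 v ζ‖ * ‖𝓕 w (ξ - ζ)‖) := (integral_const_mul _ _).symm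
    _ ≤ ∫ ζ, ((r⁻¹ ^ p * B * d ^ p * M p) * (‖ζ‖ ^ 0 * ‖𝓕 v ζ‖)
        + r⁻¹ ^ p * B * (‖ζ‖ ^ p * ‖𝓕 v ζ‖)) :=
        integral_mono_of_nonneg (Eventually.of_forall fun ζ => by positivity) hi
          (Eventually.of_forall hpt)
    _ = (r⁻¹ ^ p * B * d ^ p * M p) * (∫ ζ, ‖ζ‖ ^ 0 * ‖𝓕 v ζ‖)
        + r⁻¹ ^ p * B * ∫ ζ, ‖ζ‖ ^ p * ‖𝓕 v ζ‖ := by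
        rw [integral_add ((hV.integrable_pow_mul 0).const_mul _)
          ((hV.integrable_pow_mul p).const_mul _), integral_const_mul, integral_const_mul]
    _ ≤ (r⁻¹ ^ p * B * d ^ p * M p) * A + r⁻¹ ^ p * B * (A * c ^ p * M p) := by
        gcongr
        exact hmom p
    _ ≤ (r⁻¹ ^ p * B * (c + d) ^ p * M p) * A + r⁻¹ ^ p * B * (A * (c + d) ^ p * M p) := by
        gcongr <;> linarith
    _ = _ := by rw [mul_pow]; ring

/-! ### Test functions of a non-quasi-analytic class -/

/-- Bounded Lipschitz functions on the line, with explicit constants. -/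
def BoundedLip (B L : ℝ) (g : ℝ → ℝ) : Prop :=
  (∀ x, |g x| ≤ B) ∧ ∀ x y, |g x - g y| ≤ L * |x - y|

/-- The mean of `g` over `[x - s, x + s]`. -/
def avg (s : ℝ) (g : ℝ → ℝ) (x : ℝ) : ℝ := (2 * s)⁻¹ * ∫ t in (x - s)..(x + s), g t

/-- The symmetric difference quotient of `g`, the derivative of `avg s g`. -/
def diffQuot (s : ℝ) (g : ℝ → ℝ) (x : ℝ) : ℝ := (2 * s)⁻¹ * (g (x + s) - g (x - s))

namespace BoundedLip

variable {B L s : ℝ} {g : ℝ → ℝ}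

theorem continuous (hg : BoundedLip B L g) : Continuous g := by
  have hL : 0 ≤ L := by simpa using (abs_nonneg _).trans (hg.2 1 0)
  refine (LipschitzWith.of_dist_le_mul (K := ⟨L, hL⟩) fun x y => ?_).continuous
  rw [Real.dist_eq, Real.dist_eq]
  exact hg.2 x y

theorem nonneg_right (hg : BoundedLip B L g) : 0 ≤ L := by
  simpa using (abs_nonneg _).trans (hg.2 1 0)

theorem diffQuot (hs : 0 < s) (hg : BoundedLip B L g) :
    BoundedLip (s⁻¹ * B) (s⁻¹ * L) (diffQuot s g) := by
  constructor
  · intro x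
    rw [UltraReg.diffQuot, abs_mul, abs_of_pos (by positivity)]
    calc (2 * s)⁻¹ * |g (x + s) - g (x - s)| ≤ (2 * s)⁻¹ * (B + B) := by
          gcongr
          exact (abs_sub _ _).trans (add_le_add (hg.1 _) (hg.1 _))
      _ = s⁻¹ * B := by field_simp; ring
  · intro x y
    have e : UltraReg.diffQuot s g x - UltraReg.diffQuot s g y
        = (2 * s)⁻¹ * ((g (x + s) - g (y + s)) - (g (x - s) - g (y - s))) := by
      simp only [UltraReg.diffQuot]; ring
    have h1 := hg.2 (x + s) (y + s)
    have h2 := hg.2 (x - s) (y - s)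
    rw [show x + s - (y + s) = x - y by ring] at h1
    rw [show x - s - (y - s) = x - y by ring] at h2
    rw [e, abs_mul, abs_of_pos (by positivity)]
    calc (2 * s)⁻¹ * |(g (x + s) - g (y + s)) - (g (x - s) - g (y - s))|
        ≤ (2 * s)⁻¹ * (L * |x - y| + L * |x - y|) := by
          gcongr
          exact (abs_sub _ _).trans (add_le_add h1 h2)
      _ = s⁻¹ * L * |x - y| := by field_simp; ring

end BoundedLip

theorem avg_eq (s : ℝ) (g : ℝ → ℝ) (x : ℝ) :
    avg s g x = (2 * s)⁻¹ * ∫ t in (-s)..s, g (x + t) := by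
  rw [avg, intervalIntegral.integral_comp_add_left (fun t => g t) x]
  ring_nf

theorem abs_avg_le {s C : ℝ} (hs : 0 < s) {g : ℝ → ℝ} {x : ℝ}
    (h : ∀ t, |t| ≤ s → |g (x + t)| ≤ C) : |avg s g x| ≤ C := by
  rw [avg_eq, abs_mul, abs_of_pos (by positivity)]
  have h1 : ‖∫ t in (-s)..s, g (x + t)‖ ≤ C * |s - (-s)| := by
    refine intervalIntegral.norm_integral_le_of_norm_le_const fun t ht => ?_
    rw [Set.uIoc_of_le (by linarith)] at ht
    exact h t (abs_le.2 ⟨ht.1.le, ht.2⟩)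
  rw [Real.norm_eq_abs, abs_of_pos (by linarith : 0 < s - (-s))] at h1
  calc (2 * s)⁻¹ * |∫ t in (-s)..s, g (x + t)| ≤ (2 * s)⁻¹ * (C * (s - (-s))) := by gcongr
    _ = C := by field_simp; ring

theorem avg_sub {s : ℝ} {g h : ℝ → ℝ} (hg : Continuous g) (hh : Continuous h) (x : ℝ) :
    avg s (fun t => g t - h t) x = avg s g x - avg s h x := by
  simp only [avg]
  rw [intervalIntegral.integral_sub (hg.intervalIntegrable _ _) (hh.intervalIntegrable _ _)]
  ring

theorem avg_const {s : ℝ} (hs : 0 < s) (c x : ℝ) : avg s (fun _ => c) x = c := by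
  simp only [avg, intervalIntegral.integral_const, smul_eq_mul]
  field_simp
  ring

theorem avg_translate (s : ℝ) (g : ℝ → ℝ) (r x : ℝ) :
    avg s (fun t => g (t + r)) x = avg s g (x + r) := by
  simp only [avg_eq]
  congr 2
  funext t
  ring_nf

theorem avg_const_mul (s c : ℝ) (g : ℝ → ℝ) (x : ℝ) :
    avg s (fun t => c * g t) x = c * avg s g x := by
  simp only [avg, intervalIntegral.integral_const_mul]
  ring

theorem avg_diffQuot {s r : ℝ} {g : ℝ → ℝ} (hg : Continuous g) :
    avg s (diffQuot r g) = diffQuot r (avg s g) := by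
  funext x
  have h1 : Continuous fun t => g (t + r) := by fun_prop
  have h2 : Continuous fun t => g (t + -r) := by fun_prop
  have e : ∀ h : ℝ → ℝ, diffQuot r h = fun t => (2 * r)⁻¹ * (h (t + r) - h (t + -r)) := fun h => by
    funext t
    rw [diffQuot, sub_eq_add_neg t r]
  rw [e, e, avg_const_mul, avg_sub h1 h2, avg_translate, avg_translate]

theorem hasDerivAt_avg {s : ℝ} {g : ℝ → ℝ} (hg : Continuous g) (x : ℝ) :
    HasDerivAt (avg s g) (diffQuot s g x) x := by
  have key : ∀ y, HasDerivAt (fun u => ∫ t in (0 : ℝ)..u, g t) (g y) y := fun y =>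
    intervalIntegral.integral_hasDerivAt_right (hg.intervalIntegrable _ _)
      (hg.stronglyMeasurableAtFilter _ _) hg.continuousAt
  have e : avg s g = fun x => (2 * s)⁻¹ *
      ((∫ t in (0 : ℝ)..(x + s), g t) - ∫ t in (0 : ℝ)..(x - s), g t) := by
    funext x
    rw [avg, intervalIntegral.integral_interval_sub_left (hg.intervalIntegrable _ _)
      (hg.intervalIntegrable _ _)]
  rw [e]
  have h1 : HasDerivAt (fun x => ∫ t in (0 : ℝ)..(x + s), g t) (g (x + s)) x :=
    (key (x + s)).comp_add_const x s
  have h2 : HasDerivAt (fun x => ∫ t in (0 : ℝ)..(x - s), g t) (g (x - s)) x :=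
    (key (x - s)).comp_sub_const x s
  exact (h1.sub h2).const_mul _

theorem BoundedLip.avg {B L s : ℝ} {g : ℝ → ℝ} (hs : 0 < s) (hg : BoundedLip B L g) :
    BoundedLip B L (avg s g) := by
  refine ⟨fun x => abs_avg_le hs fun t _ => hg.1 _, fun x y => ?_⟩
  have hc := hg.continuous
  have e : UltraReg.avg s g x - UltraReg.avg s g y
      = UltraReg.avg s (fun t => g (t + x) - g (t + y)) 0 := by
    rw [avg_sub (g := fun t => g (t + x)) (h := fun t => g (t + y)) (by fun_prop) (by fun_prop),
      avg_translate, avg_translate, zero_add, zero_add]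
  rw [e]
  exact abs_avg_le hs fun t _ => by simpa using hg.2 (0 + t + x) (0 + t + y)

/-- The mean over `k` scales `a j, …, a (j + k - 1)`. -/
def iterAvg (a : ℕ → ℝ) : ℕ → ℕ → (ℝ → ℝ) → ℝ → ℝ
  | _, 0, g => g
  | j, k + 1, g => avg (a j) (iterAvg a (j + 1) k g)

/-- The mean over all scales `a j, a (j + 1), …`. -/
def limAvg (a : ℕ → ℝ) (j : ℕ) (g : ℝ → ℝ) (x : ℝ) : ℝ :=
  limUnder atTop fun k => iterAvg a j k g x

section LimAvg

variable {a : ℕ → ℝ} {B L : ℝ} {g : ℝ → ℝ}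

theorem BoundedLip.iterAvg (ha : ∀ j, 0 < a j) (hg : BoundedLip B L g) (k : ℕ) :
    ∀ j, BoundedLip B L (iterAvg a j k g) := by
  induction k with
  | zero => exact fun _ => hg
  | succ k ih => exact fun j => (ih (j + 1)).avg (ha j)

theorem abs_iterAvg_succ_sub_le (ha : ∀ j, 0 < a j) (hg : BoundedLip B L g) (k : ℕ) :
    ∀ j x, |iterAvg a j (k + 1) g x - iterAvg a j k g x| ≤ L * a (j + k) := by
  induction k with
  | zero =>
    intro j x
    have hc := hg.continuous
    have e : iterAvg a j 1 g x - iterAvg a j 0 g x = avg (a j) (fun t => g t - g x) x := by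
      rw [avg_sub hc continuous_const, avg_const (ha j)]
      rfl
    rw [e]
    refine abs_avg_le (ha j) fun t ht => (hg.2 _ _).trans ?_
    have := hg.nonneg_right
    simp only [add_sub_cancel_left, add_zero]
    gcongr
  | succ k ih =>
    intro j x
    have e : iterAvg a j (k + 1 + 1) g x - iterAvg a j (k + 1) g x
        = avg (a j) (fun t => iterAvg a (j + 1) (k + 1) g t - iterAvg a (j + 1) k g t) x := by
      rw [avg_sub (hg.iterAvg ha _ _).continuous (hg.iterAvg ha _ _).continuous]
      rfl
    rw [e]
    refine abs_avg_le (ha j) fun t _ => ?_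
    rw [show j + (k + 1) = j + 1 + k by ring]
    exact ih (j + 1) _

theorem tendsto_iterAvg (ha : ∀ j, 0 < a j) (hs : Summable a) (hg : BoundedLip B L g) (j : ℕ)
    (x : ℝ) : Tendsto (fun k => iterAvg a j k g x) atTop (𝓝 (limAvg a j g x)) := by
  have hs' : Summable fun k => L * a (j + k) := by
    have := (summable_nat_add_iff j).2 hs
    exact (this.congr fun k => by rw [add_comm]).mul_left L
  refine (cauchySeq_of_dist_le_of_summable _ (fun k => ?_) hs').tendsto_limUnder
  rw [dist_comm, Real.dist_eq]
  exact abs_iterAvg_succ_sub_le ha hg k j x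

theorem BoundedLip.limAvg (ha : ∀ j, 0 < a j) (hs : Summable a) (hg : BoundedLip B L g) (j : ℕ) :
    BoundedLip B L (limAvg a j g) :=
  ⟨fun x => le_of_tendsto' (tendsto_iterAvg ha hs hg j x).abs fun k => (hg.iterAvg ha k j).1 x,
    fun x y => le_of_tendsto'
      ((tendsto_iterAvg ha hs hg j x).sub (tendsto_iterAvg ha hs hg j y)).abs
      fun k => (hg.iterAvg ha k j).2 x y⟩

theorem limAvg_eq_avg (ha : ∀ j, 0 < a j) (hs : Summable a) (hg : BoundedLip B L g) (j : ℕ) :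
    limAvg a j g = avg (a j) (limAvg a (j + 1) g) := by
  funext x
  refine tendsto_nhds_unique ((tendsto_add_atTop_iff_nat 1).2 (tendsto_iterAvg ha hs hg j x)) ?_
  simp only [iterAvg, avg]
  refine Tendsto.const_mul _ ?_
  refine intervalIntegral.tendsto_integral_filter_of_dominated_convergence (fun _ => B) ?_ ?_ ?_ ?_
  · exact Eventually.of_forall fun k =>
      (hg.iterAvg ha k (j + 1)).continuous.aestronglyMeasurable
  · exact Eventually.of_forall fun k => Eventually.of_forall fun t _ =>
      (hg.iterAvg ha k (j + 1)).1 t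
  · simp
  · exact Eventually.of_forall fun t _ => tendsto_iterAvg ha hs hg (j + 1) t

theorem iterAvg_diffQuot (ha : ∀ j, 0 < a j) (hg : BoundedLip B L g) (r : ℝ) (k : ℕ) :
    ∀ j, iterAvg a j k (diffQuot r g) = diffQuot r (iterAvg a j k g) := by
  induction k with
  | zero => exact fun _ => rfl
  | succ k ih =>
    intro j
    rw [iterAvg, ih, avg_diffQuot (hg.iterAvg ha _ _).continuous]
    rfl

theorem limAvg_diffQuot (ha : ∀ j, 0 < a j) (hs : Summable a) (hg : BoundedLip B L g) {r : ℝ}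
    (hr : 0 < r) (j : ℕ) : limAvg a j (diffQuot r g) = diffQuot r (limAvg a j g) := by
  funext x
  refine tendsto_nhds_unique (tendsto_iterAvg ha hs (hg.diffQuot hr) j x) ?_
  simp only [iterAvg_diffQuot ha hg, diffQuot]
  exact ((tendsto_iterAvg ha hs hg j _).sub (tendsto_iterAvg ha hs hg j _)).const_mul _

theorem hasDerivAt_limAvg (ha : ∀ j, 0 < a j) (hs : Summable a) (hg : BoundedLip B L g) (j : ℕ)
    (x : ℝ) : HasDerivAt (limAvg a j g) (limAvg a (j + 1) (diffQuot (a j) g) x) x := by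
  rw [limAvg_eq_avg ha hs hg j, limAvg_diffQuot ha hs hg (ha j)]
  exact hasDerivAt_avg (hg.limAvg ha hs (j + 1)).continuous x

theorem iterAvg_eq_of_eq (ha : ∀ j, 0 < a j) (hs : Summable a) {c : ℝ} (k : ℕ) :
    ∀ j x, (∀ t, |t - x| ≤ ∑' i, a (i + j) → g t = c) → iterAvg a j k g x = c := by
  induction k with
  | zero =>
    intro j x h
    refine h x ?_
    simp only [sub_self, abs_zero]
    exact tsum_nonneg fun i => (ha _).le
  | succ k ih =>
    intro j x h
    have hsum : ∑' i, a (i + j) = a j + ∑' i, a (i + (j + 1)) := by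
      rw [((summable_nat_add_iff j).2 hs).tsum_eq_zero_add]
      simp only [zero_add]
      congr 2
      funext i
      ring_nf
    have h1 : ∀ t, |t| ≤ a j → iterAvg a (j + 1) k g (x + t) - c = 0 := by
      intro t ht
      rw [sub_eq_zero]
      refine ih (j + 1) _ fun u hu => h u ?_
      rw [hsum]
      calc |u - x| = |t + (u - (x + t))| := by ring_nf
        _ ≤ |t| + |u - (x + t)| := abs_add_le _ _
        _ ≤ _ := add_le_add ht hu
    rw [iterAvg, avg_eq]
    have h2 : ∫ t in (-a j)..(a j), iterAvg a (j + 1) k g (x + t) = ∫ _t in (-a j)..(a j), c := by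
      refine intervalIntegral.integral_congr fun t ht => ?_
      rw [Set.uIcc_of_le (by linarith [ha j])] at ht
      exact sub_eq_zero.1 (h1 t (abs_le.2 ht))
    rw [h2, ← avg_eq (a j) (fun _ => c) x, avg_const (ha j)]

theorem limAvg_eq_of_eq (ha : ∀ j, 0 < a j) (hs : Summable a) (hg : BoundedLip B L g) {c x : ℝ}
    (h : ∀ t, |t - x| ≤ ∑' i, a i → g t = c) : limAvg a 0 g x = c := by
  refine tendsto_nhds_unique (tendsto_iterAvg ha hs hg 0 x) ?_
  simp only [iterAvg_eq_of_eq ha hs _ 0 x (c := c) (g := g) (by simpa using h)]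
  exact tendsto_const_nhds

end LimAvg

/-- A smooth cutoff function on the line of class `M`, given with all its derivatives. -/
theorem exists_cutoff_real {M : ℕ → ℝ} (hM : IsWeightSequence M) {ρ : ℝ} (hρ : 0 < ρ) :
    ∃ F : ℕ → ℝ → ℝ, (∀ k x, HasDerivAt (F k) (F (k + 1) x) x) ∧
      (∃ c : ℝ, 0 ≤ c ∧ ∀ k x, |F k x| ≤ c ^ k * M k) ∧
      (∀ x, |x| ≤ ρ / 2 → F 0 x = 1) ∧ ∀ x, 5 * ρ / 2 ≤ |x| → F 0 x = 0 := by
  set S := ∑' p, M p / M (p + 1)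
  have hpos : ∀ p, 0 < M p / M (p + 1) := fun p => div_pos (hM.pos _) (hM.pos _)
  have hS : 0 ≤ S := tsum_nonneg fun p => (hpos p).le
  set δ := ρ / (2 * (1 + S))
  have hδ : 0 < δ := by positivity
  set a : ℕ → ℝ := fun p => δ * (M p / M (p + 1))
  have ha : ∀ p, 0 < a p := fun p => mul_pos hδ (hpos p)
  have hs : Summable a := hM.nonQuasiAnalytic.mul_left δ
  have hsum : ∑' p, a p ≤ ρ / 2 := by
    rw [tsum_mul_left]
    change ρ / (2 * (1 + S)) * S ≤ ρ / 2
    rw [div_mul_eq_mul_div, div_le_div_iff₀ (by positivity) (by positivity)]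
    nlinarith
  set g : ℝ → ℝ := fun x => max (min (2 - |x| / ρ) 1) 0
  have hg : BoundedLip 1 ρ⁻¹ g := by
    constructor
    · intro x
      rw [abs_of_nonneg (le_max_right _ _)]
      exact max_le (min_le_right _ _) zero_le_one
    · intro x y
      calc |g x - g y| ≤ |min (2 - |x| / ρ) 1 - min (2 - |y| / ρ) 1| :=
            abs_max_sub_max_le_abs _ _ _
        _ ≤ max |(2 - |x| / ρ) - (2 - |y| / ρ)| |(1 : ℝ) - 1| := abs_min_sub_min_le_max _ _ _ _
        _ = |ρ⁻¹ * (|y| - |x|)| := by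
            rw [sub_self, abs_zero, max_eq_left (abs_nonneg _)]
            congr 1
            field_simp
            ring
        _ = ρ⁻¹ * |(|y| - |x|)| := by rw [abs_mul, abs_of_pos (inv_pos.2 hρ)]
        _ ≤ ρ⁻¹ * |x - y| := by
            have := abs_abs_sub_abs_le y x
            rw [abs_sub_comm x y]
            gcongr
  let G : ℕ → ℝ → ℝ := fun k => Nat.rec g (fun k h => diffQuot (a k) h) k
  have hG : ∀ k, BoundedLip (δ⁻¹ ^ k * M k) (δ⁻¹ ^ k * M k * ρ⁻¹) (G k) := by
    intro k
    induction k with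
    | zero =>
      rw [pow_zero, hM.zero, one_mul, one_mul]
      exact hg
    | succ k ih =>
      have e : (a k)⁻¹ * (δ⁻¹ ^ k * M k) = δ⁻¹ ^ (k + 1) * M (k + 1) := by
        have h1 := hM.pos k
        have h2 := hM.pos (k + 1)
        simp only [a, inv_pow, pow_succ]
        field_simp
      have := ih.diffQuot (ha k)
      rw [← mul_assoc (a k)⁻¹ (δ⁻¹ ^ k * M k), e] at this
      exact this
  refine ⟨fun k => limAvg a k (G k), fun k x => hasDerivAt_limAvg ha hs (hG k) k x,
    ⟨δ⁻¹, by positivity, fun k x => ((hG k).limAvg ha hs k).1 x⟩, fun x hx => ?_, fun x hx => ?_⟩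
  · refine limAvg_eq_of_eq ha hs (hG 0) fun t ht => ?_
    have h1 : |t| ≤ ρ := by
      calc |t| = |(t - x) + x| := by ring_nf
        _ ≤ |t - x| + |x| := abs_add_le _ _
        _ ≤ ρ := by linarith
    have h2 : |t| / ρ ≤ 1 := by rwa [div_le_one hρ]
    change max (min (2 - |t| / ρ) 1) 0 = 1
    rw [min_eq_right (by linarith), max_eq_left zero_le_one]
  · refine limAvg_eq_of_eq ha hs (hG 0) fun t ht => ?_
    have h1 : 2 * ρ ≤ |t| := by
      have : |x| ≤ |x - t| + |t| := by
        calc |x| = |(x - t) + t| := by ring_nf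
          _ ≤ _ := abs_add_le _ _
      rw [abs_sub_comm] at this
      linarith
    have h2 : 2 ≤ |t| / ρ := by rwa [le_div_iff₀ hρ]
    change max (min (2 - |t| / ρ) 1) 0 = 0
    exact max_eq_right ((min_le_left _ _).trans (by linarith))

theorem contDiff_of_hasDerivAt_seq {F : ℕ → ℝ → ℝ} (hF : ∀ k x, HasDerivAt (F k) (F (k + 1) x) x)
    (k : ℕ) : ContDiff ℝ ∞ (F k) := by
  have hd : ∀ k, deriv (F k) = F (k + 1) := fun k => funext fun x => (hF k x).deriv
  refine contDiff_infty.2 fun m => ?_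
  induction m generalizing k with
  | zero =>
    exact contDiff_zero.2 (continuous_iff_continuousAt.2 fun x => (hF k x).continuousAt)
  | succ m ih =>
    rw [show ((m + 1 : ℕ) : WithTop ℕ∞) = (m : WithTop ℕ∞) + 1 by norm_cast,
      contDiff_succ_iff_deriv]
    refine ⟨fun x => (hF k x).differentiableAt, by simp, ?_⟩
    rw [hd]
    exact ih (k + 1)

theorem iterD_zero {n : ℕ} (l : List (Fin n)) : iterD l (fun _ : Rn n => (0 : ℂ)) = fun _ => 0 := by
  induction l with
  | nil => rfl
  | cons i l ih =>
    have : pderiv i (fun _ : Rn n => (0 : ℂ)) = fun _ => 0 := by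
      funext x
      simp [pderiv]
    rw [iterD, this, ih]

theorem pderiv_coord {n : ℕ} {F : ℕ → ℝ → ℝ} (hF : ∀ k x, HasDerivAt (F k) (F (k + 1) x) x)
    (k : ℕ) (i j : Fin n) (y : ℝ) :
    pderiv j (fun x : Rn n => (F k (x i - y) : ℂ))
      = if j = i then fun x : Rn n => (F (k + 1) (x i - y) : ℂ) else fun _ => 0 := by
  funext x
  have h1 : HasFDerivAt (fun x : Rn n => x i - y)
      (EuclideanSpace.proj i : Rn n →L[ℝ] ℝ) x :=
    (EuclideanSpace.proj i : Rn n →L[ℝ] ℝ).hasFDerivAt.sub_const y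
  have h2 : HasFDerivAt (fun x : Rn n => (F k (x i - y) : ℂ)) _ x :=
    (hF k (x i - y)).ofReal_comp.hasFDerivAt.comp x h1
  rw [pderiv, h2.fderiv]
  by_cases hij : j = i
  · subst hij; simp
  · have : i ≠ j := fun h => hij h.symm
    simp [hij, this]

/-- Cutoff functions of class `M` supported in a given ball. -/
theorem exists_cutoff {n : ℕ} {M : ℕ → ℝ} (hM : IsWeightSequence M) (x₀ : Rn n) {r : ℝ}
    (hr : 0 < r) :
    ∃ ψ : Rn n → ℂ, ContDiff ℝ ∞ ψ ∧ tsupport ψ ⊆ Metric.closedBall x₀ r ∧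
      (∀ᶠ x in 𝓝 x₀, ψ x = 1) ∧ ∃ A : ℝ, 1 ≤ A ∧ ∀ x, UltraAt M A A ψ x := by
  set ρ := 2 * r / (5 * (n + 1)) with hρdef
  have hρ : 0 < ρ := by positivity
  obtain ⟨F, hF, ⟨c, hc, hFc⟩, hF1, hF0⟩ := exists_cutoff_real hM hρ
  set φ : Fin n → Rn n → ℂ := fun i x => (F 0 (x i - x₀ i) : ℂ)
  have hφs : ∀ i, ContDiff ℝ ∞ (φ i) := fun i => by
    refine Complex.ofRealCLM.contDiff.comp ((contDiff_of_hasDerivAt_seq hF 0).comp ?_)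
    exact ((EuclideanSpace.proj i : Rn n →L[ℝ] ℝ).contDiff).sub contDiff_const
  have hiter : ∀ (i : Fin n) (l : List (Fin n)) (k : ℕ) (x : Rn n),
      ‖iterD l (fun x : Rn n => (F k (x i - x₀ i) : ℂ)) x‖
        ≤ c ^ (k + l.length) * M (k + l.length) := by
    intro i l
    induction l with
    | nil => intro k x; simpa [iterD] using hFc k (x i - x₀ i)
    | cons j l ih =>
      intro k x
      rw [iterD, pderiv_coord hF]
      split_ifs
      · refine (ih (k + 1) x).trans (le_of_eq ?_)
        rw [List.length_cons, show k + 1 + l.length = k + (l.length + 1) by ring]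
      · have := (hM.pos (k + (j :: l).length)).le
        rw [iterD_zero]
        simp only [norm_zero]
        positivity
  have hφ : ∀ i x, UltraAt M 1 c (φ i) x := fun i x l => by
    simpa using hiter i l 0 x
  have hprod : ∀ s : Finset (Fin n), ContDiff ℝ ∞ (∏ i ∈ s, φ i) ∧
      ∃ d : ℝ, 0 ≤ d ∧ ∀ x, UltraAt M 1 d (∏ i ∈ s, φ i) x := by
    intro s
    induction s using Finset.induction_on with
    | empty =>
      refine ⟨contDiff_const, 0, le_rfl, fun x l => ?_⟩
      rcases l with _ | ⟨i, l⟩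
      · simp [iterD, hM.zero]
      · have : pderiv i (1 : Rn n → ℂ) = fun _ => 0 := by
          funext y
          simp [pderiv, Pi.one_def]
        rw [Finset.prod_empty, iterD, this, iterD_zero]
        simp
    | insert i s hi ih =>
      obtain ⟨h1, d, hd, h2⟩ := ih
      rw [Finset.prod_insert hi]
      refine ⟨(hφs i).mul h1, c + d, add_nonneg hc hd, fun x => ?_⟩
      have := UltraAt.mul hM (Ω := ⊤) zero_le_one zero_le_one hc hd (x := x) trivial
        (hφs i).contDiffOn h1.contDiffOn (hφ i x) (h2 x)
      simpa using this
  obtain ⟨hs, d, hd, hu⟩ := hprod Finset.univ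
  refine ⟨∏ i, φ i, hs, ?_, ?_, max 1 d, le_max_left _ _, fun x =>
    (hu x).mono hM (le_max_left _ _) (le_max_right _ _) (zero_le_one.trans (le_max_left _ _)) hd⟩
  · refine closure_minimal (fun x hx => ?_) Metric.isClosed_closedBall
    rw [Metric.mem_closedBall, dist_eq_norm]
    rcases Nat.eq_zero_or_pos n with rfl | hn
    · have : x - x₀ = 0 := Subsingleton.elim _ _
      simp [this, hr.le]
    have : NeZero n := ⟨hn.ne'⟩
    obtain ⟨i, hi⟩ := exists_norm_le_mul_coord (x - x₀)
    have h1 : |x i - x₀ i| ≤ 5 * ρ / 2 := by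
      by_contra hcon
      refine hx ?_
      rw [Finset.prod_apply]
      exact Finset.prod_eq_zero (Finset.mem_univ i)
        (by simp only [φ]; rw [hF0 _ (not_le.1 hcon).le]; simp)
    calc ‖x - x₀‖ ≤ n * |x i - x₀ i| := hi
      _ ≤ (n + 1) * (5 * ρ / 2) := by gcongr; linarith
      _ = r := by rw [hρdef]; field_simp
  · filter_upwards [Metric.closedBall_mem_nhds x₀ (half_pos hρ)] with x hx
    rw [Finset.prod_apply]
    refine Finset.prod_eq_one fun i _ => ?_
    rw [Metric.mem_closedBall, dist_eq_norm] at hx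
    have h1 : |x i - x₀ i| ≤ ‖x - x₀‖ := by simpa using PiLp.norm_apply_le (x - x₀) i
    simp only [φ]
    rw [hF1 _ (h1.trans hx)]
    simp

/-! ### Nets indexed by `]0, 1]` -/

instance : Nonempty (Set.Ioc (0 : ℝ) 1) := ⟨⟨1, one_pos, le_rfl⟩⟩

theorem one_le_inv_index (ε : Set.Ioc (0 : ℝ) 1) : 1 ≤ (ε : ℝ)⁻¹ :=
  (one_le_inv₀ ε.2.1).2 ε.2.2

theorem eventually_le_inv_index (C : ℝ) : ∀ᶠ ε : Set.Ioc (0 : ℝ) 1 in atBot, C ≤ (ε : ℝ)⁻¹ := by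
  have hp : 0 < max C 1 := lt_max_of_lt_right one_pos
  refine eventually_atBot.2 ⟨⟨(max C 1)⁻¹, by positivity, ?_⟩, fun ε hε => ?_⟩
  · exact inv_le_one_of_one_le₀ (le_max_right _ _)
  · exact (le_max_left C 1).trans ((le_inv_comm₀ ε.2.1 hp).1 hε)

/-- Nets of reals bounded by a power of `ε⁻¹`. -/
def Tempered (κ : Set.Ioc (0 : ℝ) 1 → ℝ) : Prop :=
  ∃ m : ℕ, ∀ᶠ ε in atBot, κ ε ≤ (ε : ℝ)⁻¹ ^ m

theorem tempered_inv_pow (m : ℕ) : Tempered fun ε => (ε : ℝ)⁻¹ ^ m :=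
  ⟨m, Eventually.of_forall fun _ => le_rfl⟩

theorem tempered_const (C : ℝ) : Tempered fun _ => C :=
  ⟨1, by simpa using eventually_le_inv_index C⟩

theorem Tempered.mul {κ μ : Set.Ioc (0 : ℝ) 1 → ℝ} (hκ : Tempered κ) (hμ : Tempered μ)
    (h0 : ∀ ε, 0 ≤ μ ε) : Tempered fun ε => κ ε * μ ε := by
  obtain ⟨m, h1⟩ := hκ
  obtain ⟨k, h2⟩ := hμ
  refine ⟨m + k, ?_⟩
  filter_upwards [h1, h2] with ε h1 h2
  have := zero_le_one.trans (one_le_inv_index ε)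
  have := h0 ε
  rw [pow_add]
  gcongr

theorem Tempered.add {κ μ : Set.Ioc (0 : ℝ) 1 → ℝ} (hκ : Tempered κ) (hμ : Tempered μ) :
    Tempered fun ε => κ ε + μ ε := by
  obtain ⟨m, h1⟩ := hκ
  obtain ⟨k, h2⟩ := hμ
  refine ⟨m + k + 1, ?_⟩
  filter_upwards [h1, h2, eventually_le_inv_index 2] with ε h1 h2 h3
  have h := one_le_inv_index ε
  calc κ ε + μ ε ≤ (ε : ℝ)⁻¹ ^ (m + k) + (ε : ℝ)⁻¹ ^ (m + k) := by
        refine add_le_add (h1.trans ?_) (h2.trans ?_)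
        · exact pow_le_pow_right₀ h (by omega)
        · exact pow_le_pow_right₀ h (by omega)
    _ = (ε : ℝ)⁻¹ ^ (m + k) * 2 := by ring
    _ ≤ (ε : ℝ)⁻¹ ^ (m + k) * (ε : ℝ)⁻¹ := by gcongr
    _ = _ := by rw [pow_succ]

theorem Tempered.pow {κ : Set.Ioc (0 : ℝ) 1 → ℝ} (hκ : Tempered κ) (h0 : ∀ ε, 0 ≤ κ ε) (k : ℕ) :
    Tempered fun ε => κ ε ^ k := by
  induction k with
  | zero => simpa using tempered_const 1
  | succ k ih => simpa only [pow_succ] using ih.mul hκ h0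

theorem tempered_rpow {b : ℝ} : Tempered fun ε => (ε : ℝ) ^ (-b) := by
  refine ⟨⌈b⌉₊, Eventually.of_forall fun ε => ?_⟩
  change (ε : ℝ) ^ (-b) ≤ _
  rw [Real.rpow_neg ε.2.1.le, ← Real.inv_rpow ε.2.1.le, ← Real.rpow_natCast]
  exact Real.rpow_le_rpow_of_exponent_le (one_le_inv_index ε) (Nat.le_ceil b)

/-- Two tempered nets are dominated by a common power of `ε⁻¹`. -/
theorem Tempered.exists_common {κ μ : Set.Ioc (0 : ℝ) 1 → ℝ} (hκ : Tempered κ)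
    (hμ : Tempered μ) :
    ∃ m : ℕ, ∀ᶠ ε in atBot, κ ε ≤ (ε : ℝ)⁻¹ ^ m ∧ μ ε ≤ (ε : ℝ)⁻¹ ^ m := by
  obtain ⟨m, h1⟩ := hκ
  obtain ⟨k, h2⟩ := hμ
  refine ⟨m + k, ?_⟩
  filter_upwards [h1, h2] with ε h1 h2
  have h := one_le_inv_index ε
  exact ⟨h1.trans (pow_le_pow_right₀ h (by omega)), h2.trans (pow_le_pow_right₀ h (by omega))⟩

theorem modOn_iff {n : ℕ} {K : Set (Rn n)} {w : Net n} :
    ModOn K w ↔ ∃ m : ℕ, ∀ᶠ ε in atBot, ∀ x ∈ K, ‖w ε x‖ ≤ (ε : ℝ)⁻¹ ^ m := by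
  constructor
  · rintro ⟨m, C, _, η, H⟩
    refine ⟨m + 1, ?_⟩
    filter_upwards [eventually_le_atBot η, eventually_le_inv_index C] with ε h1 h2 x hx
    refine (H ε h1 x hx).trans ?_
    have := zero_le_one.trans (one_le_inv_index ε)
    rw [zpow_neg, zpow_natCast, ← inv_pow, pow_succ, mul_comm]
    gcongr
  · rintro ⟨m, h⟩
    obtain ⟨η, h⟩ := eventually_atBot.1 h
    refine ⟨m, 1, one_pos, η, fun ε hε x hx => (h ε hε x hx).trans (le_of_eq ?_)⟩
    rw [zpow_neg, zpow_natCast, inv_pow, one_mul]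

theorem negOn_iff {n : ℕ} {K : Set (Rn n)} {w : Net n} :
    NegOn K w ↔ ∀ m : ℕ, ∀ᶠ ε in atBot, ∀ x ∈ K, ‖w ε x‖ ≤ (ε : ℝ) ^ m := by
  constructor
  · intro h m
    obtain ⟨C, _, η, H⟩ := h (m + 1)
    filter_upwards [eventually_le_atBot η, eventually_le_inv_index C] with ε h1 h2 x hx
    refine (H ε h1 x hx).trans ?_
    have h0 := ε.2.1
    calc C * (ε : ℝ) ^ (m + 1) ≤ (ε : ℝ)⁻¹ * (ε : ℝ) ^ (m + 1) := by gcongr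
      _ = (ε : ℝ) ^ m := by rw [pow_succ]; field_simp
  · intro h m
    obtain ⟨η, h⟩ := eventually_atBot.1 (h m)
    exact ⟨1, one_pos, η, fun ε hε x hx => by simpa using h ε hε x hx⟩

/-- A net bounded by constants times a negligible net is negligible. -/
theorem NegOn.of_le {n : ℕ} {K : Set (Rn n)} {w : Net n} (C : ℝ)
    (h : ∀ m : ℕ, ∀ᶠ ε in atBot, ∀ x ∈ K, ‖w ε x‖ ≤ C * (ε : ℝ) ^ m) : NegOn K w := by
  refine fun m => ?_
  obtain ⟨η, h⟩ := eventually_atBot.1 (h m)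
  refine ⟨max C 1, lt_max_of_lt_right one_pos, η, fun ε hε x hx => (h ε hε x hx).trans ?_⟩
  have := ε.2.1.le
  gcongr
  exact le_max_left _ _

/-! ### Nets with decay of the Fourier transforms -/

/-- Decay of class `M` of a net of functions, with constants powers of `ε⁻¹`. -/
def NetDecay {n : ℕ} (M : ℕ → ℝ) (Γ : Set (Rn n)) (h : Net n) : Prop :=
  ∃ m : ℕ, ∀ᶠ ε : Set.Ioc (0 : ℝ) 1 in atBot, DecayOn M ((ε : ℝ)⁻¹ ^ m) ((ε : ℝ)⁻¹ ^ m) Γ (h ε)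

theorem netDecay_of_tempered {n : ℕ} {M : ℕ → ℝ} (hM : IsWeightSequence M) {Γ : Set (Rn n)}
    {h : Net n} {A c : Set.Ioc (0 : ℝ) 1 → ℝ} (hA : Tempered A) (hc : Tempered c)
    (h0 : ∀ ε, 0 ≤ c ε) (hh : ∀ᶠ ε in atBot, DecayOn M (A ε) (c ε) Γ (h ε)) : NetDecay M Γ h := by
  obtain ⟨m, hm⟩ := hA.exists_common hc
  refine ⟨m, ?_⟩
  filter_upwards [hm, hh] with ε h1 h2
  have := zero_le_one.trans (one_le_inv_index ε)
  exact h2.mono hM subset_rfl h1.1 h1.2 (by positivity) (h0 ε)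

theorem NetDecay.mono {n : ℕ} {M : ℕ → ℝ} {Γ Γ' : Set (Rn n)} {h : Net n} (hh : NetDecay M Γ h)
    (hΓ : Γ' ⊆ Γ) : NetDecay M Γ' h := by
  obtain ⟨m, hm⟩ := hh
  refine ⟨m, ?_⟩
  filter_upwards [hm] with ε h1
  exact fun ξ hξ => h1 ξ (hΓ hξ)

theorem DecayOn.inter_of_norm_le_add {n : ℕ} {M : ℕ → ℝ} (hM : IsWeightSequence M) {A c : ℝ}
    {Γ Γ' : Set (Rn n)} {h h' k : Rn n → ℂ} (hh : DecayOn M A c Γ h) (hh' : DecayOn M A c Γ' h')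
    (hk : ∀ ξ, ‖k ξ‖ ≤ ‖h ξ‖ + ‖h' ξ‖) : DecayOn M (2 * A) c (Γ ∩ Γ') k := by
  intro ξ hξ p
  have := hM.pos p
  calc ‖ξ‖ ^ p * ‖k ξ‖ ≤ ‖ξ‖ ^ p * (‖h ξ‖ + ‖h' ξ‖) := by gcongr; exact hk ξ
    _ = ‖ξ‖ ^ p * ‖h ξ‖ + ‖ξ‖ ^ p * ‖h' ξ‖ := by ring
    _ ≤ A * c ^ p * M p + A * c ^ p * M p := add_le_add (hh ξ hξ.1 p) (hh' ξ hξ.2 p)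
    _ = _ := by ring

theorem NetDecay.inter_of_norm_le_add {n : ℕ} {M : ℕ → ℝ} (hM : IsWeightSequence M)
    {Γ Γ' : Set (Rn n)} {h h' k : Net n} (hh : NetDecay M Γ h) (hh' : NetDecay M Γ' h')
    (hk : ∀ ε ξ, ‖k ε ξ‖ ≤ ‖h ε ξ‖ + ‖h' ε ξ‖) : NetDecay M (Γ ∩ Γ') k := by
  obtain ⟨m, h1⟩ := hh
  obtain ⟨m', h2⟩ := hh'
  have h0 : ∀ ε : Set.Ioc (0 : ℝ) 1, 0 ≤ (ε : ℝ)⁻¹ := fun ε =>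
    zero_le_one.trans (one_le_inv_index ε)
  refine netDecay_of_tempered hM ((tempered_const 2).mul (tempered_inv_pow (m + m'))
    fun ε => pow_nonneg (h0 ε) _) (tempered_inv_pow (m + m')) (fun ε => pow_nonneg (h0 ε) _) ?_
  filter_upwards [h1, h2] with ε h1 h2
  have e1 : (ε : ℝ)⁻¹ ^ m ≤ (ε : ℝ)⁻¹ ^ (m + m') :=
    pow_le_pow_right₀ (one_le_inv_index ε) (by omega)
  have e2 : (ε : ℝ)⁻¹ ^ m' ≤ (ε : ℝ)⁻¹ ^ (m + m') :=
    pow_le_pow_right₀ (one_le_inv_index ε) (by omega)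
  exact (h1.mono hM subset_rfl e1 e1 (pow_nonneg (h0 ε) _)
    (pow_nonneg (h0 ε) _)).inter_of_norm_le_add hM
    (h2.mono hM subset_rfl e2 e2 (pow_nonneg (h0 ε) _) (pow_nonneg (h0 ε) _)) (hk ε)

theorem hasFourierDecay_iff {n : ℕ} {M : ℕ → ℝ} (hM : IsWeightSequence M) {Γ : Set (Rn n)}
    {w : Net n} : HasFourierDecay M Γ w ↔ NetDecay M Γ fun ε => 𝓕 (w ε) := by
  constructor
  · rintro ⟨a, _, b, _, C, hC, k, hk, ε₀, H⟩
    refine netDecay_of_tempered hM (A := fun ε => C * (ε : ℝ) ^ (-b))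
      (c := fun ε => k⁻¹ * (ε : ℝ) ^ (-a))
      ((tempered_const C).mul tempered_rpow fun ε => Real.rpow_nonneg ε.2.1.le _)
      ((tempered_const k⁻¹).mul tempered_rpow fun ε => Real.rpow_nonneg ε.2.1.le _)
      (fun ε => by have := ε.2.1; positivity) ?_
    filter_upwards [eventually_le_atBot ε₀] with ε hε ξ hξ p
    have h0 := ε.2.1
    have ha : 0 < (ε : ℝ) ^ a := Real.rpow_pos_of_pos h0 a
    have h1 := (hM.le_mul_exp_neg_assocFun_iff (by positivity) (norm_nonneg _)
      (by positivity)).1 (H ε hε ξ hξ) p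
    rw [Real.rpow_neg h0.le a, ← mul_inv]
    calc ‖ξ‖ ^ p * ‖𝓕 (w ε) ξ‖
        = ((k * (ε : ℝ) ^ a)⁻¹) ^ p * ((k * (ε : ℝ) ^ a * ‖ξ‖) ^ p * ‖𝓕 (w ε) ξ‖) := by
          rw [mul_pow _ ‖ξ‖, inv_pow]
          field_simp
      _ ≤ ((k * (ε : ℝ) ^ a)⁻¹) ^ p * (C * (ε : ℝ) ^ (-b) * M p) := by gcongr
      _ = _ := by ring
  · rintro ⟨m, hm⟩
    obtain ⟨ε₀, H⟩ := eventually_atBot.1 hm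
    refine ⟨m, by positivity, m, by positivity, 1, one_pos, 1, one_pos, ε₀, fun ε hε ξ hξ => ?_⟩
    have h0 := ε.2.1
    rw [hM.le_mul_exp_neg_assocFun_iff (by positivity) (norm_nonneg _) (by positivity)]
    intro p
    have h1 := H ε hε ξ hξ p
    rw [Real.rpow_neg h0.le, Real.rpow_natCast, one_mul, one_mul]
    rw [inv_pow] at h1
    calc ((ε : ℝ) ^ m * ‖ξ‖) ^ p * ‖𝓕 (w ε) ξ‖
        = ((ε : ℝ) ^ m) ^ p * (‖ξ‖ ^ p * ‖𝓕 (w ε) ξ‖) := by ring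
      _ ≤ ((ε : ℝ) ^ m) ^ p * (((ε : ℝ) ^ m)⁻¹ * ((ε : ℝ) ^ m)⁻¹ ^ p * M p) := by gcongr
      _ = _ := by
        rw [inv_pow]
        field_simp

/-! ### Ultraregular nets -/

/-- Bounds of class `M` on `K`, with constants powers of `ε⁻¹`. -/
def UltraOn {n : ℕ} (M : ℕ → ℝ) (K : Set (Rn n)) (u : Net n) : Prop :=
  ∃ m : ℕ, ∀ᶠ ε : Set.Ioc (0 : ℝ) 1 in atBot, ∀ x ∈ K,
    UltraAt M ((ε : ℝ)⁻¹ ^ m) ((ε : ℝ)⁻¹ ^ m) (u ε) x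

theorem ultraOn_of_tempered {n : ℕ} {M : ℕ → ℝ} (hM : IsWeightSequence M) {K : Set (Rn n)}
    {u : Net n} {A c : Set.Ioc (0 : ℝ) 1 → ℝ} (hA : Tempered A) (hc : Tempered c)
    (h0 : ∀ ε, 0 ≤ c ε) (hu : ∀ᶠ ε in atBot, ∀ x ∈ K, UltraAt M (A ε) (c ε) (u ε) x) :
    UltraOn M K u := by
  obtain ⟨m, hm⟩ := hA.exists_common hc
  refine ⟨m, ?_⟩
  filter_upwards [hm, hu] with ε h1 h2 x hx
  have := zero_le_one.trans (one_le_inv_index ε)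
  exact (h2 x hx).mono hM h1.1 h1.2 (by positivity) (h0 ε)

theorem ultraOn_const {n : ℕ} {M : ℕ → ℝ} (hM : IsWeightSequence M) {A : ℝ} (hA : 1 ≤ A)
    {ψ : Rn n → ℂ} (h : ∀ x, UltraAt M A A ψ x) (K : Set (Rn n)) :
    UltraOn M K fun _ => ψ :=
  ultraOn_of_tempered hM (tempered_const A) (tempered_const A) (fun _ => zero_le_one.trans hA)
    (Eventually.of_forall fun _ x _ => h x)

theorem UltraOn.mul {n : ℕ} {M : ℕ → ℝ} (hM : IsWeightSequence M)
    {Ω : TopologicalSpace.Opens (Rn n)} {K : Set (Rn n)} (hK : K ⊆ Ω) {u v : Net n}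
    (hus : ∀ ε, ContDiffOn ℝ ∞ (u ε) Ω) (hvs : ∀ ε, ContDiffOn ℝ ∞ (v ε) Ω)
    (hu : UltraOn M K u) (hv : UltraOn M K v) : UltraOn M K (u * v) := by
  obtain ⟨m, hm⟩ := hu
  obtain ⟨k, hk⟩ := hv
  have h0 : ∀ (ε : Set.Ioc (0 : ℝ) 1) (k : ℕ), 0 ≤ (ε : ℝ)⁻¹ ^ k := fun ε k =>
    pow_nonneg (zero_le_one.trans (one_le_inv_index ε)) k
  refine ultraOn_of_tempered hM ((tempered_inv_pow m).mul (tempered_inv_pow k) fun ε => h0 ε k)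
    ((tempered_inv_pow m).add (tempered_inv_pow k)) (fun ε => add_nonneg (h0 ε m) (h0 ε k)) ?_
  filter_upwards [hm, hk] with ε h1 h2 x hx
  exact UltraAt.mul hM (h0 ε m) (h0 ε k) (h0 ε m) (h0 ε k) (hK hx) (hus ε) (hvs ε) (h1 x hx)
    (h2 x hx)

theorem UltraOn.modOn {n : ℕ} {M : ℕ → ℝ} {K : Set (Rn n)} {u : Net n} (hu : UltraOn M K u)
    (l : List (Fin n)) : ModOn K fun ε => iterD l (u ε) := by
  obtain ⟨m, hm⟩ := hu
  have h0 : ∀ (ε : Set.Ioc (0 : ℝ) 1) (k : ℕ), 0 ≤ (ε : ℝ)⁻¹ ^ k := fun ε k =>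
    pow_nonneg (zero_le_one.trans (one_le_inv_index ε)) k
  have ht : Tempered fun ε => M l.length * (((ε : ℝ)⁻¹ ^ m) * ((ε : ℝ)⁻¹ ^ m) ^ l.length) :=
    (tempered_const _).mul ((tempered_inv_pow m).mul ((tempered_inv_pow m).pow
      (fun ε => h0 ε m) _) fun ε => pow_nonneg (h0 ε m) _)
      fun ε => mul_nonneg (h0 ε m) (pow_nonneg (h0 ε m) _)
  obtain ⟨k, hk⟩ := ht
  refine modOn_iff.2 ⟨k, ?_⟩
  filter_upwards [hm, hk] with ε h1 h2 x hx
  exact ((h1 x hx l).trans (le_of_eq (by ring))).trans h2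

theorem length_dirs {n : ℕ} (α : Fin n → ℕ) : (dirs α).length = mlen α := by
  rw [dirs, List.length_flatMap, mlen]
  simp [← List.ofFn_eq_map, List.sum_ofFn]

theorem mlen_count {n : ℕ} (l : List (Fin n)) : mlen (fun i => l.count i) = l.length := by
  rw [← length_dirs]
  exact (perm_dirs l).length_eq.symm

theorem isUltraModerate_affine_iff {n : ℕ} {M : ℕ → ℝ} (hM : IsWeightSequence M)
    {Ω : TopologicalSpace.Opens (Rn n)} {u : Net n} :
    IsUltraModerate M Affine Ω u ↔ (∀ ε, ContDiffOn ℝ ∞ (u ε) Ω) ∧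
      ∀ K : Set (Rn n), IsCompact K → K ⊆ Ω → UltraOn M K u := by
  refine and_congr_right fun hs => forall_congr' fun K => forall_congr' fun _ =>
    forall_congr' fun hK => ⟨?_, ?_⟩
  · rintro ⟨N, ⟨_, a, ha, b, hb, hN⟩, C, hC, ε₀, H⟩
    refine ultraOn_of_tempered hM (A := fun ε => C * (ε : ℝ) ^ (-b))
      (c := fun ε => C * (ε : ℝ) ^ (-a))
      ((tempered_const C).mul tempered_rpow fun ε => Real.rpow_nonneg ε.2.1.le _)
      ((tempered_const C).mul tempered_rpow fun ε => Real.rpow_nonneg ε.2.1.le _)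
      (fun ε => by have := ε.2.1; positivity) ?_
    filter_upwards [eventually_le_atBot ε₀] with ε hε x hx l
    have h0 := ε.2.1
    have h1 := H (fun i => l.count i) ε hε x hx
    rw [mlen_count, mderiv, ← iterD_perm (perm_dirs l) (hs ε) (hK hx)] at h1
    have hMl := hM.pos l.length
    have e : (ε : ℝ) ^ (-N l.length) ≤ (ε : ℝ) ^ (-b) * ((ε : ℝ) ^ (-a)) ^ l.length := by
      rw [← Real.rpow_natCast, ← Real.rpow_mul h0.le, ← Real.rpow_add h0]
      refine Real.rpow_le_rpow_of_exponent_ge h0 ε.2.2 ?_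
      have := hN l.length
      linarith
    calc _ ≤ C ^ (l.length + 1) * M l.length * (ε : ℝ) ^ (-N l.length) := h1
      _ ≤ C ^ (l.length + 1) * M l.length * ((ε : ℝ) ^ (-b) * ((ε : ℝ) ^ (-a)) ^ l.length) := by
        gcongr
      _ = _ := by ring
  · rintro ⟨m, hm⟩
    obtain ⟨ε₀, H⟩ := eventually_atBot.1 hm
    refine ⟨fun p => m * p + m, ⟨fun p => by positivity, m, by positivity, m, by positivity,
      fun p => le_rfl⟩, 1, one_pos, ε₀, fun α ε hε x hx => ?_⟩
    have h0 := ε.2.1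
    have h1 := H ε hε x hx (dirs α)
    rw [length_dirs] at h1
    refine h1.trans (le_of_eq ?_)
    rw [Real.rpow_neg h0.le, one_pow, one_mul]
    have e : (ε : ℝ) ^ ((m : ℝ) * (mlen α : ℝ) + m) = ((ε : ℝ) ^ m) ^ mlen α * (ε : ℝ) ^ m := by
      rw [Real.rpow_add h0, Real.rpow_mul h0.le, Real.rpow_natCast, Real.rpow_natCast]
    rw [e, mul_inv]
    simp only [inv_pow]
    ring

theorem isUltraTest_of_ultraAt {n : ℕ} {M : ℕ → ℝ} {Ω : TopologicalSpace.Opens (Rn n)}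
    {ψ : Rn n → ℂ} (hs : ContDiff ℝ ∞ ψ) (hc : HasCompactSupport ψ) (hΩ : tsupport ψ ⊆ Ω) {A : ℝ}
    (hA : 1 ≤ A) (h : ∀ x, UltraAt M A A ψ x) : IsUltraTest M Ω ψ := by
  refine ⟨⟨hs.contDiffOn, fun K _ _ => ⟨A, zero_lt_one.trans_le hA, fun α x _ => ?_⟩⟩, hc, hΩ⟩
  refine (h x (dirs α)).trans (le_of_eq ?_)
  rw [length_dirs]
  ring

/-! ### Moderate and null nets with compact support -/

theorem IsModerate.mono {n : ℕ} {Ω Ω' : Opens (Rn n)} (h : Ω' ≤ Ω) {u : Net n}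
    (hu : IsModerate Ω u) : IsModerate Ω' u :=
  ⟨fun ε => (hu.1 ε).mono h, fun K hc hK => hu.2 K hc (hK.trans h)⟩

theorem IsNegligible.mono {n : ℕ} {Ω Ω' : Opens (Rn n)} (h : Ω' ≤ Ω) {u : Net n}
    (hu : IsNegligible Ω u) : IsNegligible Ω' u :=
  fun K hc hK => hu K hc (hK.trans h)

theorem IsModerate.contDiff {n : ℕ} {u : Net n} (hu : IsModerate ⊤ u) (ε : Set.Ioc (0 : ℝ) 1) :
    ContDiff ℝ ∞ (u ε) := by
  have := hu.1 ε
  rwa [Opens.coe_top, contDiffOn_univ] at this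

theorem contDiff_of_tsupport_subset {n : ℕ} {Ω : Opens (Rn n)} {f : Rn n → ℂ}
    (hf : ContDiffOn ℝ ∞ f Ω) (hs : tsupport f ⊆ Ω) : ContDiff ℝ ∞ f :=
  contDiff_iff_contDiffAt.2 fun x => by
    by_cases hx : x ∈ tsupport f
    · exact hf.contDiffAt (Ω.isOpen.mem_nhds (hs hx))
    · exact contDiffAt_const.congr_of_eventuallyEq (notMem_tsupport_iff_eventuallyEq.1 hx)

theorem iterD_eq_zero_of_notMem {n : ℕ} {f : Rn n → ℂ} {K : Set (Rn n)} (hs : tsupport f ⊆ K)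
    (l : List (Fin n)) {x : Rn n} (hx : x ∉ K) : iterD l f x = 0 :=
  image_eq_zero_of_notMem_tsupport fun h => hx (hs (tsupport_iterD_subset l f h))

theorem modOn_of_support {n : ℕ} {K : Set (Rn n)} {w : Net n} (hs : ∀ ε, tsupport (w ε) ⊆ K)
    {l : List (Fin n)} (h : ModOn K fun ε => iterD l (w ε)) (S : Set (Rn n)) :
    ModOn S fun ε => iterD l (w ε) := by
  obtain ⟨m, C, hC, η, H⟩ := h
  refine ⟨m, C, hC, η, fun ε hε x _ => ?_⟩
  by_cases hx : x ∈ K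
  · exact H ε hε x hx
  · have := ε.2.1
    simp only [iterD_eq_zero_of_notMem (hs ε) l hx, norm_zero]
    positivity

theorem negOn_of_support {n : ℕ} {K : Set (Rn n)} {w : Net n} (hs : ∀ ε, tsupport (w ε) ⊆ K)
    {l : List (Fin n)} (h : NegOn K fun ε => iterD l (w ε)) (S : Set (Rn n)) :
    NegOn S fun ε => iterD l (w ε) := by
  intro m
  obtain ⟨C, hC, η, H⟩ := h m
  refine ⟨C, hC, η, fun ε hε x _ => ?_⟩
  by_cases hx : x ∈ K
  · exact H ε hε x hx
  · have := ε.2.1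
    simp only [iterD_eq_zero_of_notMem (hs ε) l hx, norm_zero]
    positivity

theorem IsModerate.extend {n : ℕ} {Ω : Opens (Rn n)} {w : Net n} (hw : IsModerate Ω w)
    {K : Set (Rn n)} (hK : IsCompact K) (hKΩ : K ⊆ Ω) (hs : ∀ ε, tsupport (w ε) ⊆ K) :
    IsModerate ⊤ w :=
  isModerate_iff.2 ⟨fun ε => (contDiff_of_tsupport_subset (hw.1 ε) ((hs ε).trans hKΩ)).contDiffOn,
    fun S _ _ l => modOn_of_support hs ((isModerate_iff.1 hw).2 K hK hKΩ l) S⟩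

theorem IsNegligible.extend {n : ℕ} {Ω : Opens (Rn n)} {w : Net n} (hw : IsNegligible Ω w)
    (hsm : ∀ ε, ContDiffOn ℝ ∞ (w ε) Ω) {K : Set (Rn n)} (hK : IsCompact K) (hKΩ : K ⊆ Ω)
    (hs : ∀ ε, tsupport (w ε) ⊆ K) : IsNegligible ⊤ w :=
  fun S _ _ α => negOn_of_support hs ((isNegligible_iff hsm).1 hw K hK hKΩ (dirs α)) S

theorem isModerate_of_contDiffOn {n : ℕ} {Ω : Opens (Rn n)} {φ : Rn n → ℂ}
    (hφ : ContDiffOn ℝ ∞ φ Ω) : IsModerate Ω fun _ => φ := by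
  refine isModerate_iff.2 ⟨fun _ => hφ, fun K hK hKΩ l => ?_⟩
  obtain ⟨C, hC⟩ := hK.exists_bound_of_continuousOn
    (((contDiffOn_iterD l hφ).continuousOn).mono hKΩ)
  refine ⟨0, max C 1, lt_max_of_lt_right one_pos, ⟨1, one_pos, le_rfl⟩, fun ε _ x hx => ?_⟩
  simpa using Or.inl (hC x hx)

theorem tsupport_mul_net_subset {n : ℕ} {φ : Rn n → ℂ} {K : Set (Rn n)} (hφ : tsupport φ ⊆ K)
    (f : Rn n → ℂ) : tsupport (fun x => φ x * f x) ⊆ K :=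
  (tsupport_mul_subset_left (f := φ) (g := f)).trans hφ

/-- Moderate nets on `ℝⁿ` supported in `K`. -/
structure IsTestNet {n : ℕ} (K : Set (Rn n)) (w : Net n) : Prop where
  moderate : IsModerate ⊤ w
  support : ∀ ε, tsupport (w ε) ⊆ K

theorem isTestNet_mul {n : ℕ} {Ω : Opens (Rn n)} {φ : Rn n → ℂ} (hφ : ContDiffOn ℝ ∞ φ Ω)
    {K : Set (Rn n)} (hK : IsCompact K) (hKΩ : K ⊆ Ω) (hs : tsupport φ ⊆ K) {u : Net n}
    (hu : IsModerate Ω u) : IsTestNet K fun ε x => φ x * u ε x := by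
  have h : ∀ ε, tsupport (fun x => φ x * u ε x) ⊆ K := fun ε => tsupport_mul_net_subset hs _
  exact ⟨((isModerate_of_contDiffOn hφ).mul hu).extend hK hKΩ h, h⟩

theorem isNegligible_mul_of_support {n : ℕ} {Ω : Opens (Rn n)} {φ : Rn n → ℂ}
    (hφ : ContDiffOn ℝ ∞ φ Ω) {K : Set (Rn n)} (hK : IsCompact K) (hKΩ : K ⊆ Ω)
    (hs : tsupport φ ⊆ K) {u : Net n} (hsm : ∀ ε, ContDiffOn ℝ ∞ (u ε) Ω)
    (hu : IsNegligible Ω u) : IsNegligible ⊤ fun ε x => φ x * u ε x :=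
  IsNegligible.extend (IsModerate.mul_negligible (isModerate_of_contDiffOn hφ) hsm hu)
    (fun ε => hφ.mul (hsm ε)) hK hKΩ fun _ => tsupport_mul_net_subset hs _

namespace IsTestNet

variable {n : ℕ} {K : Set (Rn n)} {w : Net n}

theorem contDiff (hw : IsTestNet K w) (ε : Set.Ioc (0 : ℝ) 1) : ContDiff ℝ ∞ (w ε) :=
  hw.moderate.contDiff ε

theorem hasCompactSupport (hw : IsTestNet K w) (hK : IsCompact K) (ε : Set.Ioc (0 : ℝ) 1) :
    HasCompactSupport (w ε) :=
  hK.of_isClosed_subset (isClosed_tsupport _) (hw.support ε)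

theorem rapidDecay (hw : IsTestNet K w) (hK : IsCompact K) (ε : Set.Ioc (0 : ℝ) 1) :
    RapidDecay (𝓕 (w ε)) :=
  rapidDecay_fourier (hw.contDiff ε) (hw.hasCompactSupport hK ε)

theorem exists_fourier_le (hw : IsTestNet K w) (hK : IsCompact K) :
    ∃ m : ℕ, ∀ᶠ ε : Set.Ioc (0 : ℝ) 1 in atBot, ∀ ξ, ‖𝓕 (w ε) ξ‖ ≤ (ε : ℝ)⁻¹ ^ m := by
  have h := (isModerate_iff.1 hw.moderate).2 K hK (Set.subset_univ K) []
  obtain ⟨m, hm⟩ := modOn_iff.1 (modOn_of_support hw.support h Set.univ)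
  have h0 : ∀ ε : Set.Ioc (0 : ℝ) 1, 0 ≤ (ε : ℝ)⁻¹ ^ m := fun ε =>
    pow_nonneg (zero_le_one.trans (one_le_inv_index ε)) m
  obtain ⟨k, hk⟩ := (tempered_const (volume.real K)).mul (tempered_inv_pow m) h0
  refine ⟨k, ?_⟩
  filter_upwards [hm, hk] with ε h1 h2 ξ
  exact (norm_fourier_le_of_bound hK (hw.support ε) (fun x => h1 x trivial) ξ).trans h2

theorem eventually_pow_mul_fourier_le (hw : IsTestNet K w) (hK : IsCompact K)
    (hneg : IsNegligible ⊤ w) (p m : ℕ) :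
    ∀ᶠ ε : Set.Ioc (0 : ℝ) 1 in atBot, ∀ ξ, ‖ξ‖ ^ p * ‖𝓕 (w ε) ξ‖ ≤ (ε : ℝ) ^ m := by
  have h : ∀ l : List (Fin n), ∀ᶠ ε : Set.Ioc (0 : ℝ) 1 in atBot, ∀ x,
      ‖iterD l (w ε) x‖ ≤ (ε : ℝ) ^ (m + 1) := fun l => by
    have := negOn_of_support hw.support
      ((isNegligible_iff hw.moderate.1).1 hneg K hK (Set.subset_univ K) l) Set.univ
    simpa using negOn_iff.1 this (m + 1)
  have hfin : {l : List (Fin n) | l.length = p}.Finite := List.finite_length_eq _ _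
  filter_upwards [(eventually_all_finite hfin).2 fun l _ => h l,
    eventually_le_inv_index ((n : ℝ) ^ p * volume.real K)] with ε h1 h2 ξ
  refine (pow_mul_norm_fourier_le (hw.contDiff ε) hK (hw.support ε) p
    (fun l hl x => h1 l hl x) ξ).trans ?_
  have h0 := ε.2.1
  calc (n : ℝ) ^ p * (volume.real K * (ε : ℝ) ^ (m + 1))
      = (n : ℝ) ^ p * volume.real K * (ε : ℝ) ^ (m + 1) := by ring
    _ ≤ (ε : ℝ)⁻¹ * (ε : ℝ) ^ (m + 1) := by gcongr
    _ = (ε : ℝ) ^ m := by rw [pow_succ]; field_simp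

end IsTestNet

/-- Ultraregular nets with compact support have decaying Fourier transforms. -/
theorem netDecay_of_ultraOn {n : ℕ} {M : ℕ → ℝ} (hM : IsWeightSequence M) {K : Set (Rn n)}
    (hK : IsCompact K) {v : Net n} (hv : ∀ ε, ContDiff ℝ ∞ (v ε)) (hs : ∀ ε, tsupport (v ε) ⊆ K)
    (hu : UltraOn M Set.univ v) : NetDecay M Set.univ fun ε => 𝓕 (v ε) := by
  obtain ⟨m, hm⟩ := hu
  have h0 : ∀ ε : Set.Ioc (0 : ℝ) 1, 0 ≤ (ε : ℝ)⁻¹ ^ m := fun ε =>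
    pow_nonneg (zero_le_one.trans (one_le_inv_index ε)) m
  refine netDecay_of_tempered hM
    ((tempered_const (volume.real K)).mul (tempered_inv_pow m) h0)
    ((tempered_const (n : ℝ)).mul (tempered_inv_pow m) h0)
    (fun ε => mul_nonneg (Nat.cast_nonneg n) (h0 ε)) ?_
  filter_upwards [hm] with ε h1
  exact decayOn_fourier_of_ultraAt (hv ε) hK (hs ε) fun x => h1 x trivial

theorem ultraOn_univ_mul {n : ℕ} {M : ℕ → ℝ} (hM : IsWeightSequence M) {Ω : Opens (Rn n)}
    {ψ : Rn n → ℂ} (hψ : ContDiff ℝ ∞ ψ) {K : Set (Rn n)} (hK : IsCompact K) (hKΩ : K ⊆ Ω)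
    (hψs : tsupport ψ ⊆ K) {A : ℝ} (hA : 1 ≤ A) (hψu : ∀ x, UltraAt M A A ψ x) {v : Net n}
    (hv : IsUltraModerate M Affine Ω v) : UltraOn M Set.univ fun ε x => ψ x * v ε x := by
  obtain ⟨m, hm⟩ : UltraOn M K fun ε x => ψ x * v ε x :=
    (ultraOn_const hM hA hψu K).mul hM hKΩ (fun _ => hψ.contDiffOn) hv.1
      (((isUltraModerate_affine_iff hM).1 hv).2 K hK hKΩ)
  refine ⟨m, ?_⟩
  filter_upwards [hm] with ε h1 x _
  by_cases hx : x ∈ K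
  · exact h1 x hx
  · intro l
    have := (hM.pos l.length).le
    have := zero_le_one.trans (one_le_inv_index ε)
    rw [iterD_eq_zero_of_notMem (tsupport_mul_net_subset hψs _) l hx, norm_zero]
    positivity

theorem exists_conic_netDecay_mul {n : ℕ} {M : ℕ → ℝ} (hM : IsWeightSequence M)
    {Γ : Set (Rn n)} {ξ₀ : Rn n} (hΓ : IsConicNhd Γ ξ₀) :
    ∃ Γ' : Set (Rn n), IsConicNhd Γ' ξ₀ ∧ ∀ {K K' : Set (Rn n)} {v w : Net n},
      IsCompact K → (∀ ε, ContDiff ℝ ∞ (v ε)) → (∀ ε, tsupport (v ε) ⊆ K) →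
      UltraOn M Set.univ v → IsCompact K' → IsTestNet K' w → NetDecay M Γ (fun ε => 𝓕 (w ε)) →
      NetDecay M Γ' fun ε => 𝓕 fun x => v ε x * w ε x := by
  obtain ⟨Γ', hΓ', r, hr, hr2, hsub⟩ := hΓ.exists_shrink
  refine ⟨Γ', hΓ', ?_⟩
  intro K K' v w hK hv hvs hvu hK' hw hwd
  obtain ⟨D, hD, hmom⟩ := exists_moment_le hM n
  obtain ⟨m, hm⟩ := netDecay_of_ultraOn hM hK hv hvs hvu
  obtain ⟨k₁, hk₁⟩ := hw.exists_fourier_le hK'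
  obtain ⟨k₂, hk₂⟩ := hwd
  have h1 : ∀ (k : ℕ) (ε : Set.Ioc (0 : ℝ) 1), 1 ≤ (ε : ℝ)⁻¹ ^ k := fun k ε =>
    one_le_pow₀ (one_le_inv_index ε)
  have h0 : ∀ (k : ℕ) (ε : Set.Ioc (0 : ℝ) 1), 0 ≤ (ε : ℝ)⁻¹ ^ k := fun k ε =>
    zero_le_one.trans (h1 k ε)
  have hD0 : 0 ≤ D := zero_le_one.trans hD
  have hr0 : 0 ≤ r⁻¹ := inv_nonneg.2 hr.le
  have tA : Tempered fun ε => D * (ε : ℝ)⁻¹ ^ m * ((ε : ℝ)⁻¹ ^ m) ^ (n + 1) :=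
    ((tempered_const D).mul (tempered_inv_pow m) (h0 m)).mul
      ((tempered_inv_pow m).pow (h0 m) _) fun ε => pow_nonneg (h0 m ε) _
  have nA : ∀ ε : Set.Ioc (0 : ℝ) 1, 0 ≤ D * (ε : ℝ)⁻¹ ^ m * ((ε : ℝ)⁻¹ ^ m) ^ (n + 1) :=
    fun ε => mul_nonneg (mul_nonneg hD0 (h0 m ε)) (pow_nonneg (h0 m ε) _)
  have tc : Tempered fun ε => r⁻¹ * (D * (ε : ℝ)⁻¹ ^ m + (ε : ℝ)⁻¹ ^ (k₁ + k₂)) :=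
    (tempered_const r⁻¹).mul (((tempered_const D).mul (tempered_inv_pow m) (h0 m)).add
      (tempered_inv_pow (k₁ + k₂))) fun ε => add_nonneg (mul_nonneg hD0 (h0 m ε)) (h0 _ ε)
  refine netDecay_of_tempered hM
    (((tempered_const 2).mul tA nA).mul (tempered_inv_pow (k₁ + k₂)) (h0 _)) tc
    (fun ε => mul_nonneg hr0 (add_nonneg (mul_nonneg hD0 (h0 m ε)) (h0 _ ε))) ?_
  filter_upwards [hm, hk₁, hk₂] with ε e1 e2 e3
  have l1 : (ε : ℝ)⁻¹ ^ k₁ ≤ (ε : ℝ)⁻¹ ^ (k₁ + k₂) :=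
    pow_le_pow_right₀ (one_le_inv_index ε) (by omega)
  have l2 : (ε : ℝ)⁻¹ ^ k₂ ≤ (ε : ℝ)⁻¹ ^ (k₁ + k₂) :=
    pow_le_pow_right₀ (one_le_inv_index ε) (by omega)
  exact decayOn_fourier_mul hM (hv ε) (hK.of_isClosed_subset (isClosed_tsupport _) (hvs ε))
    (hw.contDiff ε) (hw.hasCompactSupport hK' ε) hr hr2 hsub (h0 _ ε)
    (mul_nonneg hD0 (h0 m ε)) (h0 _ ε) (hmom (h0 m ε) (h1 m ε) e1)
    (fun η => (e2 η).trans l1) (e3.mono hM subset_rfl l2 l2 (h0 _ ε) (h0 _ ε))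

/-! ### The wave front set through nets of compact support -/

theorem cl_eq_iff {n : ℕ} {Ω : Opens (Rn n)} {u v : Moderate Ω} :
    cl u = cl v ↔ IsNegligible Ω fun ε x => (u : Net n) ε x - (v : Net n) ε x :=
  Ideal.Quotient.eq

theorem IsNegligible.congr {n : ℕ} {Ω : Opens (Rn n)} {u v : Net n}
    (h : ∀ ε, Set.EqOn (u ε) (v ε) Ω) (hv : IsNegligible Ω v) : IsNegligible Ω u :=
  fun K hc hK α => NegOn.congr (fun ε => (iterD_congr (dirs α) (h ε)).mono hK) (hv K hc hK α)

theorem exists_cutoff_opens {n : ℕ} {M : ℕ → ℝ} (hM : IsWeightSequence M) {V : Opens (Rn n)}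
    {x₀ : Rn n} (hx : x₀ ∈ V) :
    ∃ (ψ : Rn n → ℂ) (K : Set (Rn n)) (U : Opens (Rn n)), IsCompact K ∧ K ⊆ V ∧
      ContDiff ℝ ∞ ψ ∧ tsupport ψ ⊆ K ∧ x₀ ∈ U ∧ U ≤ V ∧ (∀ x ∈ U, ψ x = 1) ∧
      ∃ A : ℝ, 1 ≤ A ∧ ∀ x, UltraAt M A A ψ x := by
  obtain ⟨r, hr, hrV⟩ := Metric.nhds_basis_closedBall.mem_iff.1 (V.isOpen.mem_nhds hx)
  obtain ⟨ψ, hs, hsupp, h1, A, hA, hu⟩ := exists_cutoff hM x₀ hr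
  obtain ⟨U, hU, hUo, hxU⟩ := eventually_nhds_iff.1 h1
  exact ⟨ψ, Metric.closedBall x₀ r, ⟨U, hUo⟩ ⊓ V, isCompact_closedBall _ _, hrV, hs, hsupp,
    ⟨hxU, hx⟩, inf_le_right, fun x hx => hU x hx.1, A, hA, hu⟩

/-- Near `x₀` a representative of `f` coincides with a test net that decays in a conic neighborhood
of `ξ₀`. -/
def MicroRegular {n : ℕ} (M : ℕ → ℝ) {Ω : Opens (Rn n)} (f : Colombeau Ω) (x₀ ξ₀ : Rn n) : Prop :=
  ∃ u : Moderate Ω, cl u = f ∧ ∃ V : Opens (Rn n), x₀ ∈ V ∧ V ≤ Ω ∧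
    ∃ (K : Set (Rn n)) (w : Net n), IsCompact K ∧ K ⊆ Ω ∧ IsTestNet K w ∧
      (∀ ε, Set.EqOn (w ε) ((u : Net n) ε) V) ∧
      ∃ Γ, IsConicNhd Γ ξ₀ ∧ NetDecay M Γ fun ε => 𝓕 (w ε)

theorem mem_waveFront_iff {n : ℕ} {M : ℕ → ℝ} (hM : IsWeightSequence M) {Ω : Opens (Rn n)}
    {f : Colombeau Ω} {p : Rn n × Rn n} :
    p ∈ waveFront M f ↔ p.1 ∈ Ω ∧ p.2 ≠ 0 ∧ ¬ MicroRegular M f p.1 p.2 := by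
  refine and_congr_right fun hx => and_congr_right fun _ => not_congr ⟨?_, ?_⟩
  · rintro ⟨φ, ⟨⟨hφs, _⟩, hφc, hφΩ⟩, hφ1, Γ, hΓ, u, hu, hd⟩
    obtain ⟨V, hV, hVo, hxV⟩ := eventually_nhds_iff.1 hφ1
    refine ⟨u, hu, ⟨V, hVo⟩ ⊓ Ω, ⟨hxV, hx⟩, inf_le_right, tsupport φ, _, hφc, hφΩ,
      isTestNet_mul hφs hφc hφΩ subset_rfl u.2, fun ε x hx => ?_, Γ, hΓ,
      (hasFourierDecay_iff hM).1 hd⟩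
    simp [hV x hx.1]
  · rintro ⟨u, hu, V, hxV, hVΩ, K, w, hK, hKΩ, hw, hwu, Γ, hΓ, hd⟩
    obtain ⟨ψ, K', U, hK', hK'V, hψ, hψs, hxU, _, hψ1, A, hA, hψu⟩ := exists_cutoff_opens hM hxV
    obtain ⟨Γ', hΓ', hdec⟩ := exists_conic_netDecay_mul hM hΓ
    refine ⟨ψ, isUltraTest_of_ultraAt hψ (hK'.of_isClosed_subset (isClosed_tsupport _) hψs)
      (hψs.trans (hK'V.trans hVΩ)) hA hψu,
      eventually_nhds_iff.2 ⟨U, hψ1, U.isOpen, hxU⟩, Γ', hΓ', u, hu, ?_⟩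
    have h := hdec hK' (fun _ => hψ) (fun _ => hψs) (ultraOn_const hM hA hψu _) hK hw hd
    have e : (fun (ε : Set.Ioc (0 : ℝ) 1) x => ψ x * (u : Net n) ε x)
        = fun ε x => ψ x * w ε x := by
      funext ε x
      by_cases hx : x ∈ V
      · rw [hwu ε hx]
      · rw [image_eq_zero_of_notMem_tsupport fun h => hx (hK'V (hψs h)), zero_mul, zero_mul]
    rw [e]
    exact (hasFourierDecay_iff hM).2 h

/-! ### Derivatives and products -/

theorem MicroRegular.mderivG {n : ℕ} {M : ℕ → ℝ} (hM : IsWeightSequence M) {Ω : Opens (Rn n)}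
    {f : Colombeau Ω} {x₀ ξ₀ : Rn n} (h : MicroRegular M f x₀ ξ₀) (α : Fin n → ℕ) :
    MicroRegular M (mderivG α f) x₀ ξ₀ := by
  obtain ⟨u, rfl, V, hxV, hVΩ, K, w, hK, hKΩ, hw, hwu, Γ, hΓ, m, hm⟩ := h
  refine ⟨mderivNet α u, rfl, V, hxV, hVΩ, K, fun ε => mderiv α (w ε), hK, hKΩ,
    ⟨isModerate_mderiv hw.moderate α, fun ε => (tsupport_iterD_subset _ _).trans (hw.support ε)⟩,
    fun ε => iterD_congr (dirs α) (hwu ε), Γ, hΓ, ?_⟩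
  set q := (dirs α).length
  obtain ⟨D, hD, hDM⟩ := hM.exists_shift_le q
  have h0 : ∀ ε : Set.Ioc (0 : ℝ) 1, 0 ≤ (ε : ℝ)⁻¹ ^ m := fun ε =>
    pow_nonneg (zero_le_one.trans (one_le_inv_index ε)) m
  have hD0 : 0 ≤ D := zero_le_one.trans hD
  refine netDecay_of_tempered hM
    (A := fun ε => (2 * Real.pi) ^ q * D * ((ε : ℝ)⁻¹ ^ m * ((ε : ℝ)⁻¹ ^ m) ^ q))
    (c := fun ε => D * (ε : ℝ)⁻¹ ^ m)
    ((tempered_const _).mul ((tempered_inv_pow m).mul ((tempered_inv_pow m).pow h0 q)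
      fun ε => pow_nonneg (h0 ε) _) fun ε => mul_nonneg (h0 ε) (pow_nonneg (h0 ε) _))
    ((tempered_const D).mul (tempered_inv_pow m) h0) (fun ε => mul_nonneg hD0 (h0 ε)) ?_
  filter_upwards [hm] with ε h1 ξ hξ p
  have h2 := norm_fourier_iterD_le (dirs α) ξ (hw.contDiff ε) (hw.hasCompactSupport hK ε)
  have h3 := h1 ξ hξ (p + q)
  have hpi := Real.pi_pos
  set E : ℝ := (ε : ℝ)⁻¹ ^ m
  have hE : 0 ≤ E := h0 ε
  calc ‖ξ‖ ^ p * ‖𝓕 (iterD (dirs α) (w ε)) ξ‖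
      ≤ ‖ξ‖ ^ p * ((2 * Real.pi * ‖ξ‖) ^ q * ‖𝓕 (w ε) ξ‖) := by gcongr
    _ = (2 * Real.pi) ^ q * (‖ξ‖ ^ (p + q) * ‖𝓕 (w ε) ξ‖) := by ring
    _ ≤ (2 * Real.pi) ^ q * (E * E ^ (p + q) * M (p + q)) := by gcongr
    _ ≤ (2 * Real.pi) ^ q * (E * E ^ (p + q) * (D ^ (p + 1) * M p)) := by gcongr; exact hDM p
    _ = _ := by ring

theorem MicroRegular.mul {n : ℕ} {M : ℕ → ℝ} (hM : IsWeightSequence M) {Ω : Opens (Rn n)}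
    {f g : Colombeau Ω} (hg : g ∈ UltraRegular M Affine Ω) {x₀ ξ₀ : Rn n}
    (h : MicroRegular M f x₀ ξ₀) : MicroRegular M (g * f) x₀ ξ₀ := by
  obtain ⟨u, rfl, V, hxV, hVΩ, K, w, hK, hKΩ, hw, hwu, Γ, hΓ, hd⟩ := h
  obtain ⟨v, rfl, hv⟩ := hg
  obtain ⟨ψ, K', U, hK', hK'V, hψ, hψs, hxU, hUV, hψ1, A, hA, hψu⟩ := exists_cutoff_opens hM hxV
  obtain ⟨Γ', hΓ', hdec⟩ := exists_conic_netDecay_mul hM hΓ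
  have hK'Ω : K' ⊆ Ω := hK'V.trans hVΩ
  have hvt : IsTestNet K' fun ε x => ψ x * (v : Net n) ε x :=
    isTestNet_mul hψ.contDiffOn hK' hK'Ω hψs v.2
  have hvu := ultraOn_univ_mul hM hψ hK' hK'Ω hψs hA hψu hv
  refine ⟨v * u, rfl, U, hxU, hUV.trans hVΩ, K', _, hK', hK'Ω,
    ⟨hvt.moderate.mul hw.moderate, fun ε => (tsupport_mul_net_subset (hvt.support ε) _)⟩,
    fun ε x hx => ?_, Γ', hΓ', hdec hK' hvt.contDiff hvt.support hvu hK hw hd⟩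
  change ψ x * (v : Net n) ε x * w ε x = (v : Net n) ε x * (u : Net n) ε x
  rw [hψ1 x hx, one_mul, hwu ε (hUV hx)]

theorem exists_cl_eq {n : ℕ} {Ω : Opens (Rn n)} (f : Colombeau Ω) : ∃ u : Moderate Ω, cl u = f :=
  Ideal.Quotient.mk_surjective f

theorem cl_eq_restrict_iff {n : ℕ} {Ω Ω' : Opens (Rn n)} (h : Ω' ≤ Ω) {u : Moderate Ω}
    {v : Moderate Ω'} :
    cl v = restrict h (cl u) ↔ IsNegligible Ω' fun ε x => (v : Net n) ε x - (u : Net n) ε x :=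
  cl_eq_iff (v := ⟨(u : Net n), u.2.mono h⟩)

theorem IsModerate.sub {n : ℕ} {Ω : Opens (Rn n)} {u v : Net n} (hu : IsModerate Ω u)
    (hv : IsModerate Ω v) : IsModerate Ω fun ε x => u ε x - v ε x :=
  (Moderate Ω).sub_mem hu hv

/-! ### Projection to the base -/

theorem microRegular_of_ultraRegular {n : ℕ} {M : ℕ → ℝ} (hM : IsWeightSequence M)
    {Ω Ω' : Opens (Rn n)} (h : Ω' ≤ Ω) {f : Colombeau Ω} {x₀ : Rn n} (hx : x₀ ∈ Ω')
    (hf : restrict h f ∈ UltraRegular M Affine Ω') (ξ₀ : Rn n) : MicroRegular M f x₀ ξ₀ := by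
  obtain ⟨u, rfl⟩ := exists_cl_eq f
  obtain ⟨v, hvu, hv⟩ := hf
  rw [cl_eq_restrict_iff] at hvu
  obtain ⟨ψ, K, U, hK, hKΩ', hψ, hψs, hxU, hUΩ', hψ1, A, hA, hψu⟩ := exists_cutoff_opens hM hx
  have hd : IsModerate Ω' fun ε x => (v : Net n) ε x - (u : Net n) ε x := v.2.sub (u.2.mono h)
  have hN := isTestNet_mul hψ.contDiffOn hK hKΩ' hψs hd
  have hN0 := isNegligible_mul_of_support hψ.contDiffOn hK hKΩ' hψs hd.1 hvu
  let N : Moderate Ω := ⟨_, hN.moderate.mono le_top⟩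
  have hw := isTestNet_mul hψ.contDiffOn hK hKΩ' hψs v.2
  refine ⟨u + N, ?_, U, hxU, hUΩ'.trans h, K, _, hK, hKΩ'.trans h, hw, fun ε x hx => ?_,
    Set.univ, ⟨isOpen_univ, trivial, fun _ _ _ _ => trivial⟩,
    netDecay_of_ultraOn hM hK hw.contDiff hw.support
      (ultraOn_univ_mul hM hψ hK hKΩ' hψs hA hψu hv)⟩
  · refine cl_eq_iff.2 ((hN0.mono le_top).congr fun ε x _ => ?_)
    change (u : Net n) ε x + ψ x * ((v : Net n) ε x - (u : Net n) ε x) - (u : Net n) ε x = _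
    ring
  · change ψ x * (v : Net n) ε x
      = (u : Net n) ε x + ψ x * ((v : Net n) ε x - (u : Net n) ε x)
    rw [hψ1 x hx]
    ring

/-- A net of functions of rapid decay, negligibly close to the Fourier transforms of `w`, that
decays in `Γ`. -/
def DecayingModification {n : ℕ} (M : ℕ → ℝ) (Γ : Set (Rn n)) (w h : Net n) : Prop :=
  (∀ ε, RapidDecay (h ε)) ∧
  (∀ p m : ℕ, ∀ᶠ ε : Set.Ioc (0 : ℝ) 1 in atBot, ∀ ξ,
    ‖ξ‖ ^ p * ‖h ε ξ - 𝓕 (w ε) ξ‖ ≤ (ε : ℝ) ^ m) ∧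
  NetDecay M Γ h

open Classical in
theorem DecayingModification.union {n : ℕ} {M : ℕ → ℝ} (hM : IsWeightSequence M)
    {Γ Γ' : Set (Rn n)} (hΓ : MeasurableSet Γ) {w h h' : Net n}
    (hh : DecayingModification M Γ w h) (hh' : DecayingModification M Γ' w h') :
    DecayingModification M (Γ ∪ Γ') w fun ε => Γ.piecewise (h ε) (h' ε) := by
  have key : ∀ ε ξ, Γ.piecewise (h ε) (h' ε) ξ = h ε ξ ∨ Γ.piecewise (h ε) (h' ε) ξ = h' ε ξ := by
    intro ε ξ
    by_cases hξ : ξ ∈ Γ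
    · exact Or.inl (Set.piecewise_eq_of_mem _ _ _ hξ)
    · exact Or.inr (Set.piecewise_eq_of_notMem _ _ _ hξ)
  refine ⟨fun ε => ⟨(hh.1 ε).1.piecewise hΓ (hh'.1 ε).1, fun p => ?_⟩, fun p m => ?_, ?_⟩
  · obtain ⟨B, hB⟩ := (hh.1 ε).2 p
    obtain ⟨B', hB'⟩ := (hh'.1 ε).2 p
    refine ⟨max B B', fun ξ => ?_⟩
    change ‖ξ‖ ^ p * ‖Γ.piecewise (h ε) (h' ε) ξ‖ ≤ _
    rcases key ε ξ with e | e <;> rw [e]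
    · exact (hB ξ).trans (le_max_left _ _)
    · exact (hB' ξ).trans (le_max_right _ _)
  · filter_upwards [hh.2.1 p m, hh'.2.1 p m] with ε h1 h2 ξ
    rcases key ε ξ with e | e <;> rw [e]
    · exact h1 ξ
    · exact h2 ξ
  · obtain ⟨m, hm⟩ := hh.2.2
    obtain ⟨k, hk⟩ := hh'.2.2
    refine ⟨m + k, ?_⟩
    filter_upwards [hm, hk] with ε h1 h2 ξ hξ p
    have h0 := zero_le_one.trans (one_le_inv_index ε)
    have e1 : (ε : ℝ)⁻¹ ^ m ≤ (ε : ℝ)⁻¹ ^ (m + k) :=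
      pow_le_pow_right₀ (one_le_inv_index ε) (by omega)
    have e2 : (ε : ℝ)⁻¹ ^ k ≤ (ε : ℝ)⁻¹ ^ (m + k) :=
      pow_le_pow_right₀ (one_le_inv_index ε) (by omega)
    by_cases hmem : ξ ∈ Γ
    · rw [Set.piecewise_eq_of_mem _ _ _ hmem]
      exact h1.mono hM subset_rfl e1 e1 (pow_nonneg h0 _) (pow_nonneg h0 _) ξ hmem p
    · rw [Set.piecewise_eq_of_notMem _ _ _ hmem]
      exact h2.mono hM subset_rfl e2 e2 (pow_nonneg h0 _) (pow_nonneg h0 _) ξ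
        (hξ.resolve_left hmem) p

/-- A net that is microlocally regular over `x₀` in all directions has modified Fourier transforms
decaying in all directions, after localization near `x₀`. -/
theorem exists_decayingModification {n : ℕ} {M : ℕ → ℝ} (hM : IsWeightSequence M)
    {Ω : Opens (Rn n)} (u : Moderate Ω) {x₀ : Rn n} (hx : x₀ ∈ Ω)
    (hreg : ∀ ξ₀ ≠ 0, MicroRegular M (cl u) x₀ ξ₀) :
    ∃ V : Opens (Rn n), x₀ ∈ V ∧ V ≤ Ω ∧ ∀ (ψ : Rn n → ℂ) (K : Set (Rn n)) (A : ℝ),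
      IsCompact K → K ⊆ V → ContDiff ℝ ∞ ψ → tsupport ψ ⊆ K → 1 ≤ A →
      (∀ x, UltraAt M A A ψ x) →
      ∃ h, DecayingModification M {0}ᶜ (fun ε x => ψ x * (u : Net n) ε x) h := by
  let P : Set (Rn n) → Prop := fun S => ∃ Γ : Set (Rn n), IsOpen Γ ∧
    (∀ ξ ∈ S, ∀ t : ℝ, 0 < t → t • ξ ∈ Γ) ∧
    ∃ V : Opens (Rn n), x₀ ∈ V ∧ V ≤ Ω ∧ ∀ (ψ : Rn n → ℂ) (K : Set (Rn n)) (A : ℝ),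
      IsCompact K → K ⊆ V → ContDiff ℝ ∞ ψ → tsupport ψ ⊆ K → 1 ≤ A →
      (∀ x, UltraAt M A A ψ x) →
      ∃ h, DecayingModification M Γ (fun ε x => ψ x * (u : Net n) ε x) h
  have hP : P (Metric.sphere 0 1) := by
    refine (isCompact_sphere (0 : Rn n) 1).induction_on ?_ ?_ ?_ ?_
    · refine ⟨∅, isOpen_empty, by simp, Ω, hx, le_rfl, fun ψ K A hK hKΩ hψ hψs _ _ =>
        ⟨fun ε => 𝓕 fun x => ψ x * (u : Net n) ε x, ?_, fun p m => ?_, 0, ?_⟩⟩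
      · exact (isTestNet_mul hψ.contDiffOn hK hKΩ hψs u.2).rapidDecay hK
      · refine Eventually.of_forall fun ε ξ => ?_
        have := ε.2.1
        simp only [sub_self, norm_zero, mul_zero]
        positivity
      · exact Eventually.of_forall fun ε ξ hξ => hξ.elim
    · rintro s t hst ⟨Γ, hΓ, hc, hV⟩
      exact ⟨Γ, hΓ, fun ξ hξ => hc ξ (hst hξ), hV⟩
    · rintro s t ⟨Γ, hΓ, hc, V, hxV, hVΩ, H⟩ ⟨Γ', hΓ', hc', V', hxV', hVΩ', H'⟩
      refine ⟨Γ ∪ Γ', hΓ.union hΓ', ?_, V ⊓ V', ⟨hxV, hxV'⟩, inf_le_left.trans hVΩ, ?_⟩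
      · rintro ξ (hξ | hξ) t ht
        · exact Or.inl (hc ξ hξ t ht)
        · exact Or.inr (hc' ξ hξ t ht)
      · intro ψ K A hK hKV hψ hψs hA hψu
        obtain ⟨h, hh⟩ := H ψ K A hK (hKV.trans Set.inter_subset_left) hψ hψs hA hψu
        obtain ⟨h', hh'⟩ := H' ψ K A hK (hKV.trans Set.inter_subset_right) hψ hψs hA hψu
        exact ⟨_, hh.union hM hΓ.measurableSet hh'⟩
    · intro ξ₀ hξ₀
      have hne : ξ₀ ≠ 0 := by
        rintro rfl
        simp at hξ₀
      obtain ⟨v, hvu, V, hxV, hVΩ, K', w, hK', hK'Ω, hw, hwv, Γ, hΓ, hd⟩ := hreg ξ₀ hne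
      obtain ⟨Γ', hΓ', hdec⟩ := exists_conic_netDecay_mul hM hΓ
      refine ⟨Γ', mem_nhdsWithin_of_mem_nhds (hΓ'.1.mem_nhds hΓ'.2.1), Γ', hΓ'.1, hΓ'.2.2, V, hxV,
        hVΩ, fun ψ K A hK hKV hψ hψs hA hψu => ?_⟩
      have hKΩ : K ⊆ Ω := hKV.trans hVΩ
      have e : (fun (ε : Set.Ioc (0 : ℝ) 1) x => ψ x * w ε x)
          = fun ε x => ψ x * (v : Net n) ε x := by
        funext ε x
        by_cases hx : x ∈ V
        · rw [hwv ε hx]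
        · rw [image_eq_zero_of_notMem_tsupport fun h => hx (hKV (hψs h)), zero_mul, zero_mul]
      have hψv := isTestNet_mul hψ.contDiffOn hK hKΩ hψs v.2
      have hψu' := isTestNet_mul hψ.contDiffOn hK hKΩ hψs u.2
      have hD : IsModerate Ω fun ε x => (v : Net n) ε x - (u : Net n) ε x := v.2.sub u.2
      have hψD := isTestNet_mul hψ.contDiffOn hK hKΩ hψs hD
      have hneg := isNegligible_mul_of_support hψ.contDiffOn hK hKΩ hψs hD.1 (cl_eq_iff.1 hvu)
      refine ⟨fun ε => 𝓕 fun x => ψ x * (v : Net n) ε x, hψv.rapidDecay hK, fun p m => ?_, ?_⟩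
      · filter_upwards [hψD.eventually_pow_mul_fourier_le hK hneg p m] with ε h1 ξ
        refine le_of_eq_of_le ?_ (h1 ξ)
        have i1 := (hψv.contDiff ε).continuous.integrable_of_hasCompactSupport
          (hψv.hasCompactSupport hK ε) (μ := volume)
        have i2 := (hψu'.contDiff ε).continuous.integrable_of_hasCompactSupport
          (hψu'.hasCompactSupport hK ε) (μ := volume)
        have e2 : 𝓕 (fun x => ψ x * ((v : Net n) ε x - (u : Net n) ε x)) ξ
            = 𝓕 (fun x => ψ x * (v : Net n) ε x) ξ - 𝓕 (fun x => ψ x * (u : Net n) ε x) ξ := by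
          simp only [Real.fourier_eq, mul_sub, smul_sub]
          exact integral_sub ((Real.fourierIntegral_convergent_iff ξ).2 i1)
            ((Real.fourierIntegral_convergent_iff ξ).2 i2)
        rw [e2]
      · have := hdec hK (fun _ => hψ) (fun _ => hψs) (ultraOn_const hM hA hψu _) hK' hw hd
        have e3 : (fun ε => 𝓕 fun x => ψ x * w ε x) = fun ε => 𝓕 fun x => ψ x * (v : Net n) ε x :=
          congrArg (fun k : Net n => fun ε => 𝓕 (k ε)) e
        rw [← e3]
        exact this
  obtain ⟨Γ, _, hc, V, hxV, hVΩ, H⟩ := hP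
  refine ⟨V, hxV, hVΩ, fun ψ K A hK hKV hψ hψs hA hψu => ?_⟩
  obtain ⟨h, h1, h2, h3⟩ := H ψ K A hK hKV hψ hψs hA hψu
  refine ⟨h, h1, h2, h3.mono fun ξ hξ => ?_⟩
  have hpos : 0 < ‖ξ‖ := norm_pos_iff.2 hξ
  have := hc (‖ξ‖⁻¹ • ξ) (by simp [norm_smul, hpos.ne']) ‖ξ‖ hpos
  rwa [smul_inv_smul₀ hpos.ne'] at this

theorem DecayingModification.netDecay_univ {n : ℕ} {M : ℕ → ℝ} (hM : IsWeightSequence M)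
    {w h : Net n} {K : Set (Rn n)} (hK : IsCompact K) (hw : IsTestNet K w)
    (hh : DecayingModification M {0}ᶜ w h) : NetDecay M Set.univ h := by
  obtain ⟨m, hm⟩ := hh.2.2
  obtain ⟨k, hk⟩ := hw.exists_fourier_le hK
  have h0 : ∀ (k : ℕ) (ε : Set.Ioc (0 : ℝ) 1), 0 ≤ (ε : ℝ)⁻¹ ^ k := fun k ε =>
    pow_nonneg (zero_le_one.trans (one_le_inv_index ε)) k
  refine netDecay_of_tempered hM (((tempered_inv_pow k).add (tempered_const 1)).add
    (tempered_inv_pow m)) (tempered_inv_pow m) (h0 m) ?_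
  filter_upwards [hm, hk, hh.2.1 0 0] with ε h1 h2 h3 ξ _ p
  have hp := (hM.pos p).le
  have hk0 := h0 k ε
  have hm0 := h0 m ε
  by_cases hξ : ξ = 0
  · subst hξ
    rcases p with _ | p
    · have h4 := h3 0
      simp only [pow_zero, one_mul] at h4
      simp only [pow_zero, one_mul, mul_one, hM.zero]
      have h5 : ‖h ε 0‖ ≤ ‖h ε 0 - 𝓕 (w ε) 0‖ + ‖𝓕 (w ε) 0‖ := by
        simpa using norm_add_le (h ε 0 - 𝓕 (w ε) 0) (𝓕 (w ε) 0)
      have h6 := h2 0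
      linarith
    · simp only [norm_zero, ne_eq, Nat.add_eq_zero_iff, one_ne_zero, and_false, not_false_eq_true,
        zero_pow, zero_mul]
      positivity
  · refine (h1 ξ hξ p).trans ?_
    gcongr
    linarith

theorem NetDecay.ultraOn_fourierInv {n : ℕ} {M : ℕ → ℝ} (hM : IsWeightSequence M) {h : Net n}
    (hr : ∀ ε, RapidDecay (h ε)) (hd : NetDecay M Set.univ h) :
    UltraOn M Set.univ fun ε => 𝓕⁻ (h ε) := by
  obtain ⟨D, hD, hmom⟩ := exists_moment_le hM n
  obtain ⟨m, hm⟩ := hd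
  have h0 : ∀ (k : ℕ) (ε : Set.Ioc (0 : ℝ) 1), 0 ≤ (ε : ℝ)⁻¹ ^ k := fun k ε =>
    pow_nonneg (zero_le_one.trans (one_le_inv_index ε)) k
  have hD0 : 0 ≤ D := zero_le_one.trans hD
  have hpi := Real.pi_pos
  refine ultraOn_of_tempered hM
    (((tempered_const D).mul (tempered_inv_pow m) (h0 m)).mul ((tempered_inv_pow m).pow (h0 m) (n + 1))
      fun ε => pow_nonneg (h0 m ε) _)
    ((tempered_const (2 * Real.pi)).mul ((tempered_const D).mul (tempered_inv_pow m) (h0 m))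
      fun ε => mul_nonneg hD0 (h0 m ε))
    (fun ε => mul_nonneg (by positivity) (mul_nonneg hD0 (h0 m ε))) ?_
  filter_upwards [hm] with ε h1 x _ l
  refine ((hr ε).norm_iterD_fourierInv_le l x).trans ?_
  have h2 := hmom (h0 m ε) (one_le_pow₀ (one_le_inv_index ε)) h1 l.length
  refine (mul_le_mul_of_nonneg_left h2 (by positivity)).trans (le_of_eq ?_)
  rw [mul_pow (2 * Real.pi)]
  ring

theorem DecayingModification.isNegligible {n : ℕ} {M : ℕ → ℝ} {Γ : Set (Rn n)} {w h : Net n}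
    {K : Set (Rn n)} (hK : IsCompact K) (hw : IsTestNet K w)
    (hh : DecayingModification M Γ w h) :
    IsNegligible ⊤ fun ε x => 𝓕⁻ (h ε) x - w ε x := by
  have hr : ∀ ε, RapidDecay fun ξ => h ε ξ - 𝓕 (w ε) ξ := fun ε =>
    (hh.1 ε).sub (hw.rapidDecay hK ε)
  have e : (fun (ε : Set.Ioc (0 : ℝ) 1) x => 𝓕⁻ (h ε) x - w ε x)
      = fun ε => 𝓕⁻ fun ξ => h ε ξ - 𝓕 (w ε) ξ := by
    funext ε
    rw [fourierInv_sub (hh.1 ε) (hw.rapidDecay hK ε),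
      fourierInv_fourier (hw.contDiff ε) (hw.hasCompactSupport hK ε)]
  rw [e]
  intro S _ _ α
  have hpi := Real.pi_pos
  refine NegOn.of_le ((2 * Real.pi) ^ (dirs α).length * (2 * decayConst n)) fun m => ?_
  filter_upwards [hh.2.1 (dirs α).length m, hh.2.1 (n + 1 + (dirs α).length) m] with ε h1 h2 x _
  refine ((hr ε).norm_iterD_fourierInv_le (dirs α) x).trans ?_
  have h3 := integral_le_of_decay (fun ξ => by positivity) h1 fun ξ => by
    rw [← mul_assoc, ← pow_add]
    exact h2 ξ
  calc _ ≤ (2 * Real.pi) ^ (dirs α).length * (2 * (ε : ℝ) ^ m * decayConst n) := by gcongr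
    _ = _ := by ring

theorem exists_ultraRegular_of_microRegular {n : ℕ} {M : ℕ → ℝ} (hM : IsWeightSequence M)
    {Ω : Opens (Rn n)} {f : Colombeau Ω} {x₀ : Rn n} (hx : x₀ ∈ Ω)
    (hreg : ∀ ξ₀ ≠ 0, MicroRegular M f x₀ ξ₀) :
    ∃ (Ω' : Opens (Rn n)) (h : Ω' ≤ Ω), x₀ ∈ Ω' ∧ restrict h f ∈ UltraRegular M Affine Ω' := by
  obtain ⟨u, rfl⟩ := exists_cl_eq f
  obtain ⟨V, hxV, hVΩ, H⟩ := exists_decayingModification hM u hx hreg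
  obtain ⟨ψ, K, U, hK, hKV, hψ, hψs, hxU, hUV, hψ1, A, hA, hψu⟩ := exists_cutoff_opens hM hxV
  obtain ⟨h, hh⟩ := H ψ K A hK hKV hψ hψs hA hψu
  have hw := isTestNet_mul hψ.contDiffOn hK (hKV.trans hVΩ) hψs u.2
  have hv := (hh.netDecay_univ hM hK hw).ultraOn_fourierInv hM hh.1
  have hneg := hh.isNegligible hK hw
  have hsm : ∀ ε, ContDiff ℝ ∞ (𝓕⁻ (h ε)) := fun ε => (hh.1 ε).contDiff_fourierInv
  have hvK : ∀ S, UltraOn M S fun ε => 𝓕⁻ (h ε) := fun S => by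
    obtain ⟨m, hm⟩ := hv
    exact ⟨m, hm.mono fun ε hε x _ => hε x trivial⟩
  have hUΩ : U ≤ Ω := hUV.trans hVΩ
  refine ⟨U, hUΩ, hxU, ⟨fun ε => 𝓕⁻ (h ε), isModerate_iff.2
    ⟨fun ε => (hsm ε).contDiffOn, fun S _ _ l => (hvK S).modOn l⟩⟩, ?_,
    (isUltraModerate_affine_iff hM).2 ⟨fun ε => (hsm ε).contDiffOn, fun S _ _ => hvK S⟩⟩
  refine (cl_eq_restrict_iff hUΩ).2 ((hneg.mono le_top).congr fun ε x hx => ?_)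
  simp only [hψ1 x hx, one_mul]

/-! ### Projection to the directions -/

theorem iterD_sub {n : ℕ} (l : List (Fin n)) {f g : Rn n → ℂ} (hf : ContDiff ℝ ∞ f)
    (hg : ContDiff ℝ ∞ g) (x : Rn n) : iterD l (f - g) x = iterD l f x - iterD l g x := by
  have h := iterD_add (Ω := ⊤) l (hf.sub hg).contDiffOn hg.contDiffOn
    (show x ∈ ((⊤ : Opens (Rn n)) : Set (Rn n)) from trivial)
  rw [eq_sub_iff_add_eq]
  change iterD l (f - g + g) x = iterD l (f - g) x + iterD l g x at h
  rw [← h, sub_add_cancel]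

theorem UltraAt.sub {n : ℕ} {M : ℕ → ℝ} (hM : IsWeightSequence M) {A B : ℝ} (hA : 0 ≤ A)
    (hB : 0 ≤ B) {f g : Rn n → ℂ} (hf : ContDiff ℝ ∞ f) (hg : ContDiff ℝ ∞ g) {x : Rn n}
    (h1 : UltraAt M A A f x) (h2 : UltraAt M B B g x) : UltraAt M (A + B) (A + B) (f - g) x := by
  intro l
  have hl := (hM.pos l.length).le
  rw [iterD_sub l hf hg]
  calc ‖iterD l f x - iterD l g x‖ ≤ ‖iterD l f x‖ + ‖iterD l g x‖ := norm_sub_le _ _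
    _ ≤ A * A ^ l.length * M l.length + B * B ^ l.length * M l.length := add_le_add (h1 l) (h2 l)
    _ ≤ A * (A + B) ^ l.length * M l.length + B * (A + B) ^ l.length * M l.length := by
      gcongr <;> linarith
    _ = _ := by ring

theorem fourier_add_sub_le {n : ℕ} {a b c : Rn n → ℂ} (ha : Integrable a) (hb : Integrable b)
    (hc : Integrable c) (ξ : Rn n) :
    ‖𝓕 (fun x => a x + b x - c x) ξ‖ ≤ ‖𝓕 a ξ‖ + (‖𝓕 b ξ‖ + ‖𝓕 c ξ‖) := by
  have h : 𝓕 (fun x => a x + b x - c x) ξ = 𝓕 a ξ + 𝓕 b ξ - 𝓕 c ξ := by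
    have ha' := (Real.fourierIntegral_convergent_iff ξ).2 ha
    have hb' := (Real.fourierIntegral_convergent_iff ξ).2 hb
    have hc' := (Real.fourierIntegral_convergent_iff ξ).2 hc
    simp only [Real.fourier_eq, smul_sub, smul_add]
    have hab : Integrable fun v => 𝐞 (-inner ℝ v ξ) • a v + 𝐞 (-inner ℝ v ξ) • b v := ha'.add hb'
    rw [integral_sub hab hc', integral_add ha' hb']
  rw [h]
  have h1 := norm_sub_le (𝓕 a ξ + 𝓕 b ξ) (𝓕 c ξ)
  have h2 := norm_add_le (𝓕 a ξ) (𝓕 b ξ)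
  linarith

/-- A cutoff function `θ` of class `M`, equal to `1` on `S`, and a test net, negligibly close to
`θ u`, that decays in a conic neighborhood of `ξ₀`. -/
def HasDecayingCutoff {n : ℕ} (M : ℕ → ℝ) {Ω : Opens (Rn n)} (u : Moderate Ω) (ξ₀ : Rn n)
    (S : Set (Rn n)) : Prop :=
  ∃ (θ : Rn n → ℂ) (K : Set (Rn n)) (W : Net n), IsCompact K ∧ K ⊆ Ω ∧ ContDiff ℝ ∞ θ ∧
    tsupport θ ⊆ K ∧ (∃ A : ℝ, 1 ≤ A ∧ ∀ x, UltraAt M A A θ x) ∧ (∀ x ∈ S, θ x = 1) ∧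
    IsTestNet K W ∧ (IsNegligible ⊤ fun ε x => W ε x - θ x * (u : Net n) ε x) ∧
    ∃ Γ, IsConicNhd Γ ξ₀ ∧ NetDecay M Γ fun ε => 𝓕 (W ε)

theorem hasDecayingCutoff_empty {n : ℕ} {M : ℕ → ℝ} (hM : IsWeightSequence M) {Ω : Opens (Rn n)}
    (u : Moderate Ω) (ξ₀ : Rn n) : HasDecayingCutoff M u ξ₀ ∅ := by
  refine ⟨fun _ => 0, ∅, fun _ _ => 0, isCompact_empty, Set.empty_subset _, contDiff_const, ?_,
    ⟨1, le_rfl, fun x l => ?_⟩, by simp, ⟨isModerate_const ⊤ 0, fun _ => ?_⟩, ?_, Set.univ,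
    ⟨isOpen_univ, trivial, fun _ _ _ _ => trivial⟩, 0, Eventually.of_forall fun ε ξ _ p => ?_⟩
  · exact (tsupport_eq_empty_iff.2 rfl).subset
  · have := (hM.pos l.length).le
    rw [iterD_zero]
    simpa using this
  · exact (tsupport_eq_empty_iff.2 rfl).subset
  · refine (isNegligible_zero ⊤).congr fun ε x _ => ?_
    simp
  · have := (hM.pos p).le
    simpa [Real.fourier_eq] using this

theorem HasDecayingCutoff.union {n : ℕ} {M : ℕ → ℝ} (hM : IsWeightSequence M) {Ω : Opens (Rn n)}
    {u : Moderate Ω} {ξ₀ : Rn n} {S T : Set (Rn n)} (hS : HasDecayingCutoff M u ξ₀ S)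
    (hT : HasDecayingCutoff M u ξ₀ T) : HasDecayingCutoff M u ξ₀ (S ∪ T) := by
  obtain ⟨θ, K, W, hK, hKΩ, hθ, hθs, ⟨A, hA, hθu⟩, hθ1, hW, hWn, Γ, hΓ, hd⟩ := hS
  obtain ⟨τ, L, Z, hL, hLΩ, hτ, hτs, ⟨B, hB, hτu⟩, hτ1, hZ, hZn, Δ, hΔ, hd'⟩ := hT
  obtain ⟨Δ', hΔ', hdec⟩ := exists_conic_netDecay_mul hM hΔ
  have hA0 : 0 ≤ A := zero_le_one.trans hA
  have hB0 : 0 ≤ B := zero_le_one.trans hB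
  have hθm : IsModerate ⊤ fun _ => θ := isModerate_of_contDiffOn hθ.contDiffOn
  have hθZ := isTestNet_mul (Ω := ⊤) hθ.contDiffOn hK (Set.subset_univ K) hθs hZ.moderate
  have hθZd := hdec hK (fun _ => hθ) (fun _ => hθs) (ultraOn_const hM hA hθu _) hL hZ hd'
  have hsupp : ∀ {a b c : Rn n → ℂ}, tsupport a ⊆ K → tsupport b ⊆ L → tsupport c ⊆ K →
      tsupport (fun x => a x + b x - c x) ⊆ K ∪ L := by
    intro a b c ha hb hc
    refine closure_minimal (fun x hx => ?_) (hK.union hL).isClosed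
    by_contra hcon
    rw [Set.mem_union, not_or] at hcon
    refine hx ?_
    simp only
    rw [image_eq_zero_of_notMem_tsupport fun h => hcon.1 (ha h),
      image_eq_zero_of_notMem_tsupport fun h => hcon.2 (hb h),
      image_eq_zero_of_notMem_tsupport fun h => hcon.1 (hc h)]
    simp
  refine ⟨fun x => θ x + τ x - θ x * τ x, K ∪ L, fun ε x => W ε x + Z ε x - θ x * Z ε x,
    hK.union hL, Set.union_subset hKΩ hLΩ, (hθ.add hτ).sub (hθ.mul hτ),
    hsupp hθs hτs (tsupport_mul_net_subset hθs τ), ?_, ?_,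
    ⟨(hW.moderate.add hZ.moderate).sub hθZ.moderate,
      fun ε => hsupp (hW.support ε) (hZ.support ε) (hθZ.support ε)⟩, ?_, Γ ∩ (Δ ∩ Δ'), ?_, ?_⟩
  · have hprod : ∀ x, UltraAt M (A * B + (A + B)) (A * B + (A + B)) (θ * τ) x := fun x =>
      (UltraAt.mul hM (Ω := ⊤) hA0 hB0 hA0 hB0 trivial hθ.contDiffOn hτ.contDiffOn (hθu x)
        (hτu x)).mono hM (by linarith) (by linarith [mul_nonneg hA0 hB0]) (by positivity)
        (by positivity)
    have hdiff : ∀ x, UltraAt M (A * B + (A + B) + B) (A * B + (A + B) + B) (θ * τ - τ) x :=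
      fun x => (hprod x).sub hM (by positivity) hB0 (hθ.mul hτ) hτ (hτu x)
    refine ⟨A + (A * B + (A + B) + B), by nlinarith, fun x => ?_⟩
    have e : (fun x => θ x + τ x - θ x * τ x) = θ - (θ * τ - τ) := by
      funext x
      simp only [Pi.sub_apply, Pi.mul_apply]
      ring
    rw [e]
    exact (hθu x).sub hM hA0 (by positivity) hθ ((hθ.mul hτ).sub hτ) (hdiff x)
  · rintro x (hx | hx)
    · simp only [hθ1 x hx]; ring
    · simp only [hτ1 x hx]; ring
  · have hθU := isTestNet_mul hθ.contDiffOn hK hKΩ hθs u.2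
    have hτU := isTestNet_mul hτ.contDiffOn hL hLΩ hτs u.2
    let N₁ : Moderate (⊤ : Opens (Rn n)) := ⟨_, hW.moderate.sub hθU.moderate⟩
    let N₂ : Moderate (⊤ : Opens (Rn n)) := ⟨_, hZ.moderate.sub hτU.moderate⟩
    let Θ : Moderate (⊤ : Opens (Rn n)) := ⟨_, hθm⟩
    have hN₁ : N₁ ∈ Null (⊤ : Opens (Rn n)) := hWn
    have hN₂ : N₂ ∈ Null (⊤ : Opens (Rn n)) := hZn
    have hmem : N₁ + N₂ - Θ * N₂ ∈ Null (⊤ : Opens (Rn n)) :=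
      (Null ⊤).sub_mem ((Null ⊤).add_mem hN₁ hN₂) ((Null ⊤).mul_mem_left _ hN₂)
    refine IsNegligible.congr (fun ε x _ => ?_)
      (show IsNegligible ⊤ ((N₁ + N₂ - Θ * N₂ : Moderate (⊤ : Opens (Rn n))) : Net n) from hmem)
    change _ = (W ε x - θ x * (u : Net n) ε x) + (Z ε x - τ x * (u : Net n) ε x)
      - θ x * (Z ε x - τ x * (u : Net n) ε x)
    ring
  · refine ⟨hΓ.1.inter (hΔ.1.inter hΔ'.1), ⟨hΓ.2.1, hΔ.2.1, hΔ'.2.1⟩, fun ξ hξ t ht =>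
      ⟨hΓ.2.2 ξ hξ.1 t ht, hΔ.2.2 ξ hξ.2.1 t ht, hΔ'.2.2 ξ hξ.2.2 t ht⟩⟩
  · have hsum : NetDecay M (Δ ∩ Δ') fun ε ξ =>
        ((‖𝓕 (Z ε) ξ‖ + ‖𝓕 (fun x => θ x * Z ε x) ξ‖ : ℝ) : ℂ) :=
      hd'.inter_of_norm_le_add hM hθZd fun ε ξ => by
        rw [Complex.norm_real, Real.norm_of_nonneg (by positivity)]
    refine hd.inter_of_norm_le_add hM hsum fun ε ξ => ?_
    have hint : ∀ {K : Set (Rn n)} {w : Net n}, IsCompact K → IsTestNet K w →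
        Integrable (w ε) := fun hK hw =>
      (hw.contDiff ε).continuous.integrable_of_hasCompactSupport (hw.hasCompactSupport hK ε)
    refine (fourier_add_sub_le (hint hK hW) (hint hL hZ) (hint hK hθZ) ξ).trans (le_of_eq ?_)
    rw [Complex.norm_real, Real.norm_of_nonneg (by positivity)]

theorem exists_hasDecayingCutoff {n : ℕ} {M : ℕ → ℝ} (hM : IsWeightSequence M) {Ω : Opens (Rn n)}
    {u : Moderate Ω} {x₀ ξ₀ : Rn n} (h : MicroRegular M (cl u) x₀ ξ₀) :
    ∃ U ∈ 𝓝 x₀, HasDecayingCutoff M u ξ₀ U := by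
  obtain ⟨v, hvu, V, hxV, hVΩ, K', w, hK', hK'Ω, hw, hwv, Γ, hΓ, hd⟩ := h
  obtain ⟨Γ', hΓ', hdec⟩ := exists_conic_netDecay_mul hM hΓ
  obtain ⟨ψ, K, U, hK, hKV, hψ, hψs, hxU, _, hψ1, A, hA, hψu⟩ := exists_cutoff_opens hM hxV
  have hKΩ : K ⊆ Ω := hKV.trans hVΩ
  have hD : IsModerate Ω fun ε x => (v : Net n) ε x - (u : Net n) ε x := v.2.sub u.2
  have hneg := isNegligible_mul_of_support hψ.contDiffOn hK hKΩ hψs hD.1 (cl_eq_iff.1 hvu)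
  refine ⟨U, U.isOpen.mem_nhds hxU, ψ, K, fun ε x => ψ x * w ε x, hK, hKΩ, hψ, hψs,
    ⟨A, hA, hψu⟩, hψ1,
    isTestNet_mul (Ω := ⊤) hψ.contDiffOn hK (Set.subset_univ K) hψs hw.moderate,
    hneg.congr fun ε x _ => ?_, Γ', hΓ',
    hdec hK (fun _ => hψ) (fun _ => hψs) (ultraOn_const hM hA hψu _) hK' hw hd⟩
  simp only
  by_cases hx : x ∈ V
  · rw [hwv ε hx]; ring
  · rw [image_eq_zero_of_notMem_tsupport fun h => hx (hKV (hψs h))]; ring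

theorem exists_decaying_representative {n : ℕ} {M : ℕ → ℝ} (hM : IsWeightSequence M)
    {Ω : Opens (Rn n)} {u : Moderate Ω} (hu : HasCompactSupportIn Ω (u : Net n)) {ξ₀ : Rn n}
    (hreg : ∀ x ∈ Ω, MicroRegular M (cl u) x ξ₀) :
    ∃ Γ, IsConicNhd Γ ξ₀ ∧ ∃ v : Moderate Ω, cl v = cl u ∧ HasCompactSupportIn Ω (v : Net n) ∧
      HasFourierDecay M Γ (v : Net n) := by
  obtain ⟨K, hK, hKΩ, hsupp⟩ := hu
  have h : HasDecayingCutoff M u ξ₀ K := by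
    refine hK.induction_on (hasDecayingCutoff_empty hM u ξ₀) ?_ ?_ ?_
    · rintro s t hst ⟨θ, L, W, h1, h2, h3, h4, h5, h6, h7⟩
      exact ⟨θ, L, W, h1, h2, h3, h4, h5, fun x hx => h6 x (hst hx), h7⟩
    · exact fun s t hs ht => hs.union hM ht
    · intro x hx
      obtain ⟨U, hU, hc⟩ := exists_hasDecayingCutoff hM (hreg x (hKΩ hx))
      exact ⟨U, mem_nhdsWithin_of_mem_nhds hU, hc⟩
  obtain ⟨θ, L, W, hL, hLΩ, _, _, _, hθ1, hW, hWn, Γ, hΓ, hd⟩ := h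
  refine ⟨Γ, hΓ, ⟨W, hW.moderate.mono le_top⟩, cl_eq_iff.2 ((hWn.mono le_top).congr fun ε x _ => ?_),
    ⟨L, hL, hLΩ, hW.support⟩, (hasFourierDecay_iff hM).2 hd⟩
  simp only
  by_cases hx : x ∈ K
  · rw [hθ1 x hx, one_mul]
  · rw [image_eq_zero_of_notMem_tsupport fun h => hx (hsupp ε h), mul_zero]

/-! ### The four properties of the wave front set -/

theorem image_fst_waveFront {n : ℕ} {M : ℕ → ℝ} (hM : IsWeightSequence M) {Ω : Opens (Rn n)}
    (f : Colombeau Ω) : Prod.fst '' waveFront M f = singsupp M Affine f := by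
  ext x
  constructor
  · rintro ⟨p, hp, rfl⟩
    obtain ⟨hx, _, hreg⟩ := (mem_waveFront_iff hM).1 hp
    exact ⟨hx, fun ⟨Ω', h, hx', hf⟩ => hreg (microRegular_of_ultraRegular hM h hx' hf _)⟩
  · rintro ⟨hx, hsing⟩
    by_contra hcon
    refine hsing (exists_ultraRegular_of_microRegular hM hx fun ξ₀ hξ₀ => ?_)
    by_contra hreg
    exact hcon ⟨(x, ξ₀), (mem_waveFront_iff hM).2 ⟨hx, hξ₀, hreg⟩, rfl⟩

theorem image_snd_waveFront {n : ℕ} {M : ℕ → ℝ} (hM : IsWeightSequence M) {Ω : Opens (Rn n)}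
    {f : Colombeau Ω} (hf : f ∈ ColombeauC Ω) :
    Prod.snd '' waveFront M f = sigmaCone M f := by
  obtain ⟨u, rfl, hu⟩ := hf
  ext ξ
  constructor
  · rintro ⟨p, hp, rfl⟩
    obtain ⟨hx, hξ, hreg⟩ := (mem_waveFront_iff hM).1 hp
    refine ⟨hξ, fun ⟨Γ, hΓ, v, hvu, ⟨K, hK, hKΩ, hs⟩, hd⟩ => hreg ?_⟩
    exact ⟨v, hvu, Ω, hx, le_rfl, K, (v : Net n), hK, hKΩ, ⟨v.2.extend hK hKΩ hs, hs⟩,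
      fun _ _ _ => rfl, Γ, hΓ, (hasFourierDecay_iff hM).1 hd⟩
  · rintro ⟨hξ, hsig⟩
    by_contra hcon
    refine hsig (exists_decaying_representative hM hu fun x hx => ?_)
    by_contra hreg
    exact hcon ⟨(x, ξ), (mem_waveFront_iff hM).2 ⟨hx, hξ, hreg⟩, rfl⟩

theorem waveFront_subset_of_microRegular {n : ℕ} {M : ℕ → ℝ} (hM : IsWeightSequence M)
    {Ω : Opens (Rn n)} {f g : Colombeau Ω}
    (h : ∀ x ξ, MicroRegular M f x ξ → MicroRegular M g x ξ) : waveFront M g ⊆ waveFront M f := by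
  intro p hp
  rw [mem_waveFront_iff hM] at hp ⊢
  exact ⟨hp.1, hp.2.1, fun hreg => hp.2.2 (h _ _ hreg)⟩

end

end UltraReg

theorem mainTheorem4 {n : ℕ} (M : ℕ → ℝ) (hM : UltraReg.IsWeightSequence M)
    (Ω : TopologicalSpace.Opens (UltraReg.Rn n)) (f : UltraReg.Colombeau Ω) :
    Prod.fst '' UltraReg.waveFront M f = UltraReg.singsupp M UltraReg.Affine f ∧
    (f ∈ UltraReg.ColombeauC Ω →
      Prod.snd '' UltraReg.waveFront M f = UltraReg.sigmaCone M f) ∧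
    (∀ α : Fin n → ℕ,
      UltraReg.waveFront M (UltraReg.mderivG α f) ⊆ UltraReg.waveFront M f) ∧
    (∀ g ∈ UltraReg.UltraRegular M UltraReg.Affine Ω,
      UltraReg.waveFront M (g * f) ⊆ UltraReg.waveFront M f) :=
  ⟨UltraReg.image_fst_waveFront hM f, fun hf => UltraReg.image_snd_waveFront hM hf,
    fun α => UltraReg.waveFront_subset_of_microRegular hM fun _ _ h => h.mderivG hM α,
    fun _ hg => UltraReg.waveFront_subset_of_microRegular hM fun _ _ h => h.mul hM hg⟩
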